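/- Let $\mathbf V$ be a finite-dimensional vector space over a field of characteristic $0$ with basis $\mathbf e_1,\dots,\mathbf e_N$, let $xy$ be a skew-symmetric bilinear operation on $\mathbf V$ ($xy=-yx$) and let $\{x,y,z\}$ be a trilinear operation on $\mathbf V$ with $\{x,y,z\}=\{z,y,x\}$. Put $U=\sum_k u^k\mathbf e_k$ and $U_i=\partial^iU/\partial x^i$. The system $$U_t=U_3+3\,U\,U_2+3\,\{U,U_1,U\}$$ has a symmetry of the form $$\begin{aligned}U_\tau={}&U_5+5A_2(U,U_4)+5A_3(U_1,U_3)+5A_4(U_2,U_2)\\&+5B_2(U,U,U_3)+5B_3(U,U_1,U_2)+5B_4(U_1,U_1,U_1)\\&+5C_1(U,U,U,U_2)+5C_2(U,U_1,U_1,U)+5D_1(U,U,U,U,U_1)\end{aligned}$$ for some multilinear operations $A_i,B_i,C_i,D_1$ on $\mathbf V$ of arity $2,3,4,5$ respectively if and only if there is a Jordan triple system $F$ on $\mathbf V$, that is, a trilinear operation with $$F(x,y,z)=F(z,y,x),\qquad F(x,y,F(u,v,z))-F(F(x,y,u),v,z)-F(u,v,F(x,y,z))+F(u,F(y,x,v),z)=0,$$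 such that $$\{x,y,z\}=F(x,z,y)+F(z,x,y)+\tfrac12\,z(xy)+\tfrac12\,x(zy),$$ $$xF(y,z,u)=F(xy,z,u)+F(y,xz,u)+F(y,z,xu),$$ $$\begin{aligned}&z\bigl(2F(x,y,u)-2F(x,u,y)-x(uy)\bigr)+\mathcal J(uy,x,z)+x\,\mathcal J(y,z,u)\\&\qquad-\mathcal J(xy,z,u)-\mathcal J(y,xz,u)-\mathcal J(y,z,xu)=0\end{aligned}$$ hold for all $x,y,z,u,v\in\mathbf V$, where $\mathcal J(x,y,z)=z(xy)+x(yz)+y(zx)$. Here a system $U_\tau=G$ is a symmetry of $U_t=F_0$ if the evolutionary vector fields $D_{F_0}$ and $D_G$ commute as derivations of the ring of polynomials in the independent variables $u^k_i$ ($1\le k\le N$, $i\ge0$), where $D_{F_0}=\sum_{k,i}D^i(F_0^k)\,\partial/\partial u^k_i$ and $D=\sum_{k,i}u^k_{i+1}\,\partial/\partial u^k_i$. -/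

import Mathlib

namespace MKdV

/-- An `n`-linear operation on the `K`-module `V`. -/
abbrev Op (K V : Type*) [CommSemiring K] [AddCommMonoid V] [Module K V] (n : ℕ) :=
  MultilinearMap K (fun _ : Fin n => V) V

/-- Differential polynomials in the unknowns `u^i`, `i : ι`.
The variable `(i, k)` is the `k`-th derivative `u^i_k` of `u^i` with respect to `x`. -/
abbrev DiffPoly (K ι : Type*) [CommSemiring K] := MvPolynomial (ι × ℕ) K

/-- The total derivative `D = ∑ u^i_{k+1} ∂/∂u^i_k`. -/
noncomputable def totalD (K ι : Type*) [Field K] :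
    Derivation K (DiffPoly K ι) (DiffPoly K ι) :=
  MvPolynomial.mkDerivation K fun p => MvPolynomial.X (p.1, p.2 + 1)

/-- The evolutionary vector field `D_F = ∑ D^k(F^i) ∂/∂u^i_k` of the system `u^i_t = F^i`. -/
noncomputable def evolField {K ι : Type*} [Field K] (F : ι → DiffPoly K ι) :
    Derivation K (DiffPoly K ι) (DiffPoly K ι) :=
  MvPolynomial.mkDerivation K fun p => (totalD K ι)^[p.2] (F p.1)

/-- The system `u_τ = G` is a symmetry of the system `u_t = F`: the two evolutionary vector
fields commute. -/
def IsSymmetry {K ι : Type*} [Field K] (F G : ι → DiffPoly K ι) : Prop :=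
  ⁅evolField F, evolField G⁆ = 0

/-- The components, in the basis `b`, of `T(U_{a 0}, …, U_{a (n-1)})`, where
`U_k = ∑ j, u^j_k b_j`. The coefficients are the structural constants of `T`. -/
noncomputable def term {K V ι : Type*} [Field K] [AddCommGroup V] [Module K V] [Fintype ι]
    (b : Module.Basis ι K V) {n : ℕ} (T : Op K V n) (a : Fin n → ℕ) : ι → DiffPoly K ι :=
  fun i => ∑ J : Fin n → ι,
    MvPolynomial.C (b.repr (T fun s => b (J s)) i) * ∏ s, MvPolynomial.X (J s, a s)

/-- The right-hand side of `U_t = U_3 + 3 A(U, U_2) + 3 B(U, U_1, U)`, in components. -/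
noncomputable def mkdvRHS {K V ι : Type*} [Field K] [AddCommGroup V] [Module K V] [Fintype ι]
    (b : Module.Basis ι K V) (A : Op K V 2) (B : Op K V 3) : ι → DiffPoly K ι :=
  fun i => MvPolynomial.X (i, 3) + 3 * term b A ![0, 2] i + 3 * term b B ![0, 1, 0] i

/-- The right-hand side of the fifth-order homogeneous ansatz, in components. -/
noncomputable def fifthRHS {K V ι : Type*} [Field K] [AddCommGroup V] [Module K V] [Fintype ι]
    (b : Module.Basis ι K V) (A₂ A₃ A₄ : Op K V 2) (B₂ B₃ B₄ : Op K V 3) (C₁ C₂ : Op K V 4)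
    (D₁ : Op K V 5) : ι → DiffPoly K ι :=
  fun i => MvPolynomial.X (i, 5)
    + 5 * term b A₂ ![0, 4] i + 5 * term b A₃ ![1, 3] i + 5 * term b A₄ ![2, 2] i
    + 5 * term b B₂ ![0, 0, 3] i + 5 * term b B₃ ![0, 1, 2] i + 5 * term b B₄ ![1, 1, 1] i
    + 5 * term b C₁ ![0, 0, 0, 2] i + 5 * term b C₂ ![0, 1, 1, 0] i
    + 5 * term b D₁ ![0, 0, 0, 0, 1] i

/-- `F` is a Jordan triple system. -/
structure IsJordanTriple {K V : Type*} [Field K] [AddCommGroup V] [Module K V]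
    (F : Op K V 3) : Prop where
  symm : ∀ x y z : V, F ![x, y, z] = F ![z, y, x]
  jordan : ∀ x y z u v : V,
    F ![x, y, F ![u, v, z]] - F ![F ![x, y, u], v, z]
      - F ![u, v, F ![x, y, z]] + F ![u, F ![y, x, v], z] = 0

/-- The Jacobian `𝒥(x, y, z) = z(xy) + x(yz) + y(zx)` of a binary operation. -/
def jac {K V : Type*} [Field K] [AddCommGroup V] [Module K V] (A : Op K V 2) (x y z : V) : V :=
  A ![z, A ![x, y]] + A ![x, A ![y, z]] + A ![y, A ![z, x]]

end MKdV

/-!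
Write `a` for the skew-symmetric product, `F` for the triple product and `L_x = a x` for left
multiplications, and number the three identities that link `a`, `F` and the system as they occur
in the theorem. Both directions rest on the covariant derivative `∇ = D + L_U` on vectors of
differential polynomials. In terms of the covariant jets `∇^k U` the two systems read `∇_t U = ∇³U
+ 6 F(U, U, ∇U)` and `∇_τ U = ∇⁵U + 10 F(U, U, ∇³U) + …` (`fifthFlow`), where `∇_t = δ_t +
timeForm` and `∇_τ = δ_τ + fifthForm` correct the evolutionary fields by operators built from left
multiplications and from the operators `𝒥(x, y, ·)`. By the second identity these operators are
derivations of `F`, so `∇`, `∇_t` and `∇_τ` act on `F` by the Leibniz rule. The third identity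
says precisely how `L_x` and `𝒥(u, y, ·)` commute, and it makes the connection flat in the
directions `(x, t)` (`gauge_timeForm`) and, up to a vector `jordanDefect` that vanishes for Jordan
triple systems, in the directions `(x, τ)` (`gauge_fifthForm`).

*Sufficiency.* The flows commute on `U` up to terms of degree five and seven, which cancel by the
Jordan identity (`flow_commute`). Here commuting refers to `∇_t` and `∇_τ`; for the evolutionary
fields one also needs that the curvature in the directions `(t, τ)` vanishes. That curvature is
linear over differential polynomials and has no constant term. Since `D` is injective on
polynomials without constant term and does not raise orders of vanishing
(`mem_pow_of_totalD_mem`), the Jacobi identity for `∇`, `∇_t`, `∇_τ` shows that the order of the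
curvature grows without bound (`curvature_mem_order`).

*Necessity.* Solving the first identity for `F` determines it from `a` and the ternary operation
of the system (`tripleOp`). The symmetry equation is analysed degree by degree. The commutator
with the linear system `U_t = U₃` is the operator `D³ - δ₃`, which is injective on terms of degree
at least two (`mem_pow_of_totalD_cube_sub_mem`); hence the terms of degree two and three of the
symmetry are forced (`deviation_of_isSymmetry`). The equation in degree four contains the unknown
terms `C₁`, `C₂` only through `D³ - δ₃`; eliminating them from its polarised parts leaves the
second and third identities (`compatible_of_quartic`). Once these hold, the covariant form of the
flows is available, and the symmetry equation in degree five states that `quinticObstruction` lies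
in the image of the unknown quintic term; eliminating that term leaves the Jordan identity
(`jordan_of_quintic`).
-/

namespace MKdV

open MvPolynomial

/-! ### Orders of vanishing of polynomials -/

section Poly

variable {K σ : Type*} [Field K]

lemma derivation_mem_ideal {δ : Derivation K (MvPolynomial σ K) (MvPolynomial σ K)}
    {J : Ideal (MvPolynomial σ K)} (hδ : ∀ i, δ (X i) ∈ J) (p : MvPolynomial σ K) : δ p ∈ J := by
  induction p using MvPolynomial.induction_on with
  | C a => simp
  | add p q hp hq => rw [map_add]; exact add_mem hp hq
  | mul_X p i hp =>
    rw [Derivation.leibniz]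
    exact add_mem (J.smul_mem _ (hδ i)) (J.smul_mem _ hp)

/-- A derivation that sends the variables to polynomials of order at least `e` raises the order
of vanishing at the origin by at least `e - 1`. -/
lemma derivation_mem_pow {δ : Derivation K (MvPolynomial σ K) (MvPolynomial σ K)} {e : ℕ}
    (hδ : ∀ i, δ (X i) ∈ idealOfVars σ K ^ e) {k : ℕ} {p : MvPolynomial σ K}
    (hp : p ∈ idealOfVars σ K ^ (k + 1)) : δ p ∈ idealOfVars σ K ^ (k + e) := by
  induction k generalizing p with
  | zero => simpa using derivation_mem_ideal hδ p
  | succ k ih =>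
    rw [pow_succ] at hp
    induction hp using Submodule.mul_induction_on' with
    | mem_mul_mem a ha x hx =>
      rw [Derivation.leibniz, smul_eq_mul, smul_eq_mul]
      refine add_mem ?_ ?_
      · rw [pow_add]
        exact Ideal.mul_mem_mul ha (derivation_mem_ideal hδ x)
      · have := Ideal.mul_mem_mul hx (ih ha)
        rwa [← pow_succ', add_right_comm] at this
    | add x _ y _ hx hy => rw [map_add]; exact add_mem hx hy

lemma pderiv_mem_pow (v : σ) {k : ℕ} {p : MvPolynomial σ K}
    (hp : p ∈ idealOfVars σ K ^ (k + 1)) : pderiv v p ∈ idealOfVars σ K ^ k := by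
  rw [mem_pow_idealOfVars_iff'] at hp ⊢
  intro x hx
  rw [coeff_pderiv, hp, zero_mul]
  simpa using hx

/-- Partial derivatives detect the order of vanishing, in characteristic zero. -/
lemma mem_pow_of_pderiv_mem [CharZero K] {k : ℕ} {p : MvPolynomial σ K}
    (h0 : p ∈ idealOfVars σ K) (hp : ∀ v, pderiv v p ∈ idealOfVars σ K ^ k) :
    p ∈ idealOfVars σ K ^ (k + 1) := by
  rw [mem_pow_idealOfVars_iff']
  intro x hx
  by_cases hx0 : x = 0
  · rw [← pow_one (idealOfVars σ K), mem_pow_idealOfVars_iff'] at h0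
    exact h0 x (by simp [hx0])
  obtain ⟨v, hv⟩ : ∃ v, x v ≠ 0 := by
    by_contra! h
    exact hx0 (Finsupp.ext h)
  have hle : Finsupp.single v 1 ≤ x := by simpa [Nat.one_le_iff_ne_zero] using hv
  obtain ⟨y, rfl⟩ := exists_add_of_le hle
  have h1 := (mem_pow_idealOfVars_iff' k _).1 (hp v) y (by simp at hx; omega)
  rw [coeff_pderiv, add_comm y] at h1
  exact (mul_eq_zero.1 h1).resolve_right (by exact_mod_cast Nat.succ_ne_zero (y v))

/-- In degree `n`, the only element of the `(n+1)`-st power of the ideal of variables is zero. -/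
lemma eq_zero_of_isHomogeneous_of_mem {n : ℕ} {p : MvPolynomial σ K} (h : p.IsHomogeneous n)
    (hp : p ∈ idealOfVars σ K ^ (n + 1)) : p = 0 := by
  ext x
  by_cases hx : x.degree = n
  · exact (mem_pow_idealOfVars_iff' _ _).1 hp x (by omega)
  · rw [h.coeff_eq_zero hx, coeff_zero]

lemma mem_pow_of_isHomogeneous {n : ℕ} {p : MvPolynomial σ K} (h : p.IsHomogeneous n) :
    p ∈ idealOfVars σ K ^ n :=
  (mem_pow_idealOfVars_iff' _ _).2 fun _ hx => h.coeff_eq_zero hx.ne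

lemma eq_zero_of_forall_mem_pow {p : MvPolynomial σ K} (h : ∀ n, p ∈ idealOfVars σ K ^ n) :
    p = 0 := by
  ext x
  exact (mem_pow_idealOfVars_iff' _ _).1 (h (x.degree + 1)) x (by omega)

lemma isHomogeneous_mkDerivation {g : σ → MvPolynomial σ K} {e : ℕ}
    (hg : ∀ i, (g i).IsHomogeneous e) {m : ℕ} {p : MvPolynomial σ K}
    (hp : p.IsHomogeneous (m + 1)) : (mkDerivation K g p).IsHomogeneous (m + e) := by
  rw [← p.support_sum_monomial_coeff, map_sum]
  refine IsHomogeneous.sum _ _ _ fun s hs => ?_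
  rw [mkDerivation_monomial]
  refine (homogeneousSubmodule σ K (m + e)).smul_mem _ (IsHomogeneous.sum _ _ _ fun i hi => ?_)
  refine IsHomogeneous.mul (isHomogeneous_monomial _ ?_) (hg i)
  have hd : s.degree = m + 1 := by
    by_contra h
    exact mem_support_iff.1 hs (hp.coeff_eq_zero h)
  have hle : Finsupp.single i 1 ≤ s := by
    simpa [Nat.one_le_iff_ne_zero] using Finsupp.mem_support_iff.1 hi
  obtain ⟨y, rfl⟩ := exists_add_of_le hle
  simp at hd ⊢
  omega

end Poly

/-! ### The total derivative and evolutionary fields -/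

section Jet

variable {K ι : Type*} [Field K]

/-- The ideal of differential polynomials without constant term. -/
local notation "𝔪" => idealOfVars (ι × ℕ) K

@[simp] lemma totalD_X (j : ι) (n : ℕ) : totalD K ι (X (j, n)) = X (j, n + 1) :=
  mkDerivation_X _ _ _

@[simp] lemma evolField_X (F : ι → DiffPoly K ι) (j : ι) (n : ℕ) :
    evolField F (X (j, n)) = (totalD K ι)^[n] (F j) :=
  mkDerivation_X _ _ _

lemma totalD_mem_pow {k : ℕ} {p : DiffPoly K ι} (hp : p ∈ 𝔪 ^ k) : totalD K ι p ∈ 𝔪 ^ k := by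
  cases k with
  | zero => simp
  | succ k =>
    refine derivation_mem_pow (fun v => ?_) hp
    obtain ⟨j, n⟩ := v
    simpa using Ideal.subset_span (Set.mem_range_self _)

lemma totalD_iterate_mem_pow {k : ℕ} (n : ℕ) {p : DiffPoly K ι} (hp : p ∈ 𝔪 ^ k) :
    (totalD K ι)^[n] p ∈ 𝔪 ^ k := by
  induction n with
  | zero => exact hp
  | succ n ih => rw [Function.iterate_succ_apply']; exact totalD_mem_pow ih

lemma totalD_commutes_evolField (F : ι → DiffPoly K ι) (p : DiffPoly K ι) :
    evolField F (totalD K ι p) = totalD K ι (evolField F p) := by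
  have h : ⁅evolField F, totalD K ι⁆ = 0 := by
    refine derivation_ext fun v => ?_
    obtain ⟨j, n⟩ := v
    rw [Derivation.commutator_apply, totalD_X, evolField_X, evolField_X,
      Function.iterate_succ_apply', sub_self, Derivation.zero_apply]
  have := DFunLike.congr_fun h p
  rwa [Derivation.commutator_apply, Derivation.zero_apply, sub_eq_zero] at this

lemma pderiv_totalD_zero (j : ι) (p : DiffPoly K ι) :
    pderiv (j, 0) (totalD K ι p) = totalD K ι (pderiv (j, 0) p) := by
  classical
  have h : ⁅(pderiv (j, 0) : Derivation K (DiffPoly K ι) (DiffPoly K ι)), totalD K ι⁆ = 0 := by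
    refine derivation_ext fun v => ?_
    obtain ⟨i, n⟩ := v
    rw [Derivation.commutator_apply, totalD_X, pderiv_X, pderiv_X]
    by_cases hv : (i, n) = (j, 0)
    · simp_all
    · simp [hv]
  have := DFunLike.congr_fun h p
  rwa [Derivation.commutator_apply, Derivation.zero_apply, sub_eq_zero] at this

/-- The relation `[∂/∂u_{n+1}, D] = ∂/∂u_n`. -/
lemma pderiv_totalD_succ (j : ι) (n : ℕ) (p : DiffPoly K ι) :
    pderiv (j, n + 1) (totalD K ι p) = totalD K ι (pderiv (j, n + 1) p) + pderiv (j, n) p := by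
  classical
  have h : ⁅(pderiv (j, n + 1) : Derivation K (DiffPoly K ι) (DiffPoly K ι)), totalD K ι⁆
      = pderiv (j, n) := by
    refine derivation_ext fun v => ?_
    obtain ⟨i, m⟩ := v
    rw [Derivation.commutator_apply, totalD_X, pderiv_X, pderiv_X, pderiv_X]
    by_cases hv : (i, m) = (j, n)
    · simp_all
    · by_cases hw : (i, m) = (j, n + 1) <;> simp_all
  have := DFunLike.congr_fun h p
  rw [Derivation.commutator_apply, sub_eq_iff_eq_add'] at this
  exact this

lemma totalD_iterate_X (j : ι) (m k : ℕ) : (totalD K ι)^[m] (X (j, k)) = X (j, k + m) := by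
  induction m with
  | zero => simp
  | succ m ih => rw [Function.iterate_succ_apply', ih, totalD_X, add_assoc]

/-- The evolutionary field `u_k ↦ u_{k+3}` of the linear system `u_t = u_3`. -/
local notation "δ₃" => (evolField (fun i => X (i, 3)) : Derivation K (DiffPoly K ι) (DiffPoly K ι))

/-- The relation `[∂/∂u_{n+3}, δ₃] = ∂/∂u_n`. -/
lemma pderiv_evolField_three (j : ι) (n : ℕ) (p : DiffPoly K ι) :
    pderiv (j, n + 3) (δ₃ p) = δ₃ (pderiv (j, n + 3) p) + pderiv (j, n) p := by
  classical
  have h : ⁅(pderiv (j, n + 3) : Derivation K (DiffPoly K ι) (DiffPoly K ι)), δ₃⁆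
      = pderiv (j, n) := by
    refine derivation_ext fun v => ?_
    obtain ⟨i, m⟩ := v
    rw [Derivation.commutator_apply, evolField_X, totalD_iterate_X, pderiv_X, pderiv_X, pderiv_X]
    by_cases hv : (i, m) = (j, n)
    · simp_all [add_comm]
    · have : (i, 3 + m) ≠ (j, n + 3) := by
        intro h
        apply hv
        simp only [Prod.mk.injEq] at h ⊢
        exact ⟨h.1, by omega⟩
      by_cases hw : (i, m) = (j, n + 3) <;> simp_all
  have := DFunLike.congr_fun h p
  rw [Derivation.commutator_apply, sub_eq_iff_eq_add'] at this
  exact this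

lemma pderiv_evolField_three_of_lt (j : ι) {n : ℕ} (hn : n < 3) (p : DiffPoly K ι) :
    pderiv (j, n) (δ₃ p) = δ₃ (pderiv (j, n) p) := by
  classical
  have h : ⁅(pderiv (j, n) : Derivation K (DiffPoly K ι) (DiffPoly K ι)), δ₃⁆ = 0 := by
    refine derivation_ext fun v => ?_
    obtain ⟨i, m⟩ := v
    have : (i, 3 + m) ≠ (j, n) := by
      intro h
      have := congrArg Prod.snd h
      simp only at this
      omega
    rw [Derivation.commutator_apply, evolField_X, totalD_iterate_X, pderiv_X, pderiv_X]
    by_cases hw : (i, m) = (j, n) <;> simp_all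
  have := DFunLike.congr_fun h p
  rwa [Derivation.commutator_apply, Derivation.zero_apply, sub_eq_zero] at this

/-- A differential polynomial involves derivatives of bounded order only. -/
lemma exists_pderiv_eq_zero (p : DiffPoly K ι) :
    ∃ N, ∀ (j : ι) (n : ℕ), N ≤ n → pderiv (j, n) p = 0 := by
  refine ⟨p.vars.sup Prod.snd + 1, fun j n hn => pderiv_eq_zero_of_notMem_vars fun h => ?_⟩
  have := Finset.le_sup (f := Prod.snd) h
  simp only at this
  omega

/-- The total derivative does not raise the order of vanishing of a differential polynomial
without constant term; in particular it is injective on these. -/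
lemma mem_pow_of_totalD_mem [CharZero K] {k : ℕ} {p : DiffPoly K ι} (h0 : p ∈ 𝔪)
    (hp : totalD K ι p ∈ 𝔪 ^ k) : p ∈ 𝔪 ^ k := by
  cases k with
  | zero => simp
  | succ k =>
    refine mem_pow_of_pderiv_mem h0 ?_
    obtain ⟨N, hN⟩ := exists_pderiv_eq_zero p
    have key : ∀ m n j, N ≤ n + m → pderiv (j, n) p ∈ 𝔪 ^ k := by
      intro m
      induction m with
      | zero => intro n j h; rw [hN j n h]; exact zero_mem _
      | succ m ih =>
        intro n j h
        have h1 := pderiv_mem_pow (j, n + 1) hp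
        rw [pderiv_totalD_succ] at h1
        exact (add_mem_cancel_left (totalD_mem_pow (ih (n + 1) j (by omega)))).1 h1
    rintro ⟨j, n⟩
    exact key N n j (by omega)

/-- `p ↦ D³ p - δ p`, where `δ` is the evolutionary field of `u_t = u_3`, does not raise the order
of vanishing of a differential polynomial without constant and linear terms. Linear terms have to be
excluded, since `u_n` lies in the kernel. -/
lemma mem_pow_of_totalD_cube_sub_mem [CharZero K] {k : ℕ} {p : DiffPoly K ι} (h0 : p ∈ 𝔪 ^ 2)
    (hp : totalD K ι (totalD K ι (totalD K ι p)) - δ₃ p ∈ 𝔪 ^ k) :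
    p ∈ 𝔪 ^ k := by
  cases k with
  | zero => simp
  | succ k =>
    have h0' : p ∈ 𝔪 := by simpa using Ideal.pow_le_pow_right one_le_two h0
    refine mem_pow_of_pderiv_mem h0' ?_
    obtain ⟨N, hN⟩ := exists_pderiv_eq_zero p
    have hE : ∀ q ∈ 𝔪 ^ k, δ₃ q ∈ 𝔪 ^ k := by
      intro q hq
      cases k with
      | zero => simp
      | succ k =>
        refine derivation_mem_pow (fun v => ?_) hq
        rw [show v = (v.1, v.2) from rfl, evolField_X]
        exact totalD_iterate_mem_pow _ (by simpa using Ideal.subset_span (Set.mem_range_self _))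
    have key : ∀ m n j, N ≤ n + m → pderiv (j, n) p ∈ 𝔪 ^ k := by
      intro m
      induction m with
      | zero => intro n j h; rw [hN j n h]; exact zero_mem _
      | succ m ih =>
        intro n j h
        have h1 := pderiv_mem_pow (j, n + 2) hp
        have e1 := ih (n + 1) j (by omega)
        have e2 := ih (n + 2) j (by omega)
        -- The coefficient of `∂/∂u_{n+2}` in `D³ - δ` involves `∂p/∂u_n` only through
        -- `3 D(∂p/∂u_n)`; all other terms contain higher partial derivatives of `p`.
        have h3 : totalD K ι (pderiv (j, n) p) ∈ 𝔪 ^ k := by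
          have hs : pderiv (j, n + 2) (totalD K ι (totalD K ι (totalD K ι p)) - δ₃ p)
              = (3 : K) • totalD K ι (pderiv (j, n) p)
                + ((3 : K) • totalD K ι (totalD K ι (pderiv (j, n + 1) p))
                  + totalD K ι (totalD K ι (totalD K ι (pderiv (j, n + 2) p)))
                  - δ₃ (pderiv (j, n + 2) p)) := by
            cases n with
            | zero =>
              simp only [map_sub, map_add, pderiv_totalD_succ, pderiv_totalD_zero,
                pderiv_evolField_three_of_lt j (show 0 + 2 < 3 by norm_num)]
              module
            | succ n =>
              simp only [map_sub, map_add, pderiv_totalD_succ,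
                show n + 1 + 2 = n + 3 from rfl, pderiv_evolField_three]
              module
          rw [hs] at h1
          have h4 := (add_mem_cancel_right (sub_mem (add_mem (Submodule.smul_of_tower_mem _ (3 : K)
            (totalD_mem_pow (totalD_mem_pow e1))) (totalD_mem_pow (totalD_mem_pow
            (totalD_mem_pow e2)))) (hE _ e2))).1 h1
          have h5 := Submodule.smul_of_tower_mem (𝔪 ^ k) (3⁻¹ : K) h4
          rwa [inv_smul_smul₀ (by norm_num)] at h5
        refine mem_pow_of_totalD_mem ?_ h3
        simpa using pderiv_mem_pow (j, n) h0
    rintro ⟨j, n⟩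
    exact key N n j (by omega)

end Jet

/-! ### Operations as curried multilinear maps -/

section Curry

lemma update_two_zero {α : Type*} (x y z : α) : Function.update ![x, y] 0 z = ![z, y] := by
  funext s; fin_cases s <;> rfl

lemma update_two_one {α : Type*} (x y z : α) : Function.update ![x, y] 1 z = ![x, z] := by
  funext s; fin_cases s <;> rfl

lemma update_three_zero {α : Type*} (x y z t : α) :
    Function.update ![x, y, z] 0 t = ![t, y, z] := by
  funext s; fin_cases s <;> rfl

lemma update_three_one {α : Type*} (x y z t : α) :
    Function.update ![x, y, z] 1 t = ![x, t, z] := by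
  funext s; fin_cases s <;> rfl

lemma update_three_two {α : Type*} (x y z t : α) :
    Function.update ![x, y, z] 2 t = ![x, y, t] := by
  funext s; fin_cases s <;> rfl

variable {K V : Type*} [Field K] [AddCommGroup V] [Module K V]

/-- A binary operation as a curried bilinear map. -/
def bil (A : Op K V 2) : V →ₗ[K] V →ₗ[K] V :=
  LinearMap.mk₂ K (fun x y => A ![x, y])
    (fun x x' y => by simpa only [update_two_zero] using A.map_update_add ![0, y] 0 x x')
    (fun c x y => by simpa only [update_two_zero] using A.map_update_smul ![0, y] 0 c x)
    (fun x y y' => by simpa only [update_two_one] using A.map_update_add ![x, 0] 1 y y')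
    (fun c x y => by simpa only [update_two_one] using A.map_update_smul ![x, 0] 1 c y)

@[simp] lemma bil_apply (A : Op K V 2) (x y : V) : bil A x y = A ![x, y] := rfl

/-- A ternary operation as a curried trilinear map. -/
def tri (F : Op K V 3) : V →ₗ[K] V →ₗ[K] V →ₗ[K] V where
  toFun x := LinearMap.mk₂ K (fun y z => F ![x, y, z])
    (fun y y' z => by simpa only [update_three_one] using F.map_update_add ![x, 0, z] 1 y y')
    (fun c y z => by simpa only [update_three_one] using F.map_update_smul ![x, 0, z] 1 c y)
    (fun y z z' => by simpa only [update_three_two] using F.map_update_add ![x, y, 0] 2 z z')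
    (fun c y z => by simpa only [update_three_two] using F.map_update_smul ![x, y, 0] 2 c z)
  map_add' x x' := by
    ext y z
    change F ![x + x', y, z] = F ![x, y, z] + F ![x', y, z]
    simpa only [update_three_zero] using F.map_update_add ![0, y, z] 0 x x'
  map_smul' c x := by
    ext y z
    change F ![c • x, y, z] = c • F ![x, y, z]
    simpa only [update_three_zero] using F.map_update_smul ![0, y, z] 0 c x

@[simp] lemma tri_apply (F : Op K V 3) (x y z : V) : tri F x y z = F ![x, y, z] := rfl

end Curry

/-! ### Vectors of differential polynomials -/

section Ext

variable {K V ι : Type*} [Field K] [AddCommGroup V] [Module K V] [Fintype ι]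
  (b : Module.Basis ι K V)

/-- The value at the point `p` of the jet space of a vector of differential polynomials, seen as
a `V`-valued differential polynomial through the basis `b`. -/
noncomputable def evalAt (p : ι × ℕ → K) : (ι → DiffPoly K ι) →ₗ[K] V :=
  b.equivFun.symm.toLinearMap ∘ₗ (aeval (R := K) p).toLinearMap.compLeft ι

lemma evalAt_apply (p : ι × ℕ → K) (w : ι → DiffPoly K ι) :
    evalAt b p w = ∑ j, eval p (w j) • b j := by
  simp [evalAt, Module.Basis.equivFun_symm_apply, aeval_eq_eval]

/-- Identities between vectors of differential polynomials can be checked at the points of the jet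
space, because the field is infinite. -/
lemma ext_evalAt [CharZero K] {w w' : ι → DiffPoly K ι}
    (h : ∀ p, evalAt b p w = evalAt b p w') : w = w' := by
  funext i
  refine MvPolynomial.funext fun p => ?_
  have := congrArg (fun v => b.equivFun v i) (h p)
  simpa only [evalAt, LinearMap.comp_apply, LinearEquiv.coe_coe, LinearEquiv.apply_symm_apply,
    LinearMap.compLeft_apply, Function.comp_apply, AlgHom.toLinearMap_apply, aeval_eq_eval]
    using this

lemma evalAt_term_sum {n : ℕ} (T : Op K V n) (p : ι × ℕ → K) (w : Fin n → ι → DiffPoly K ι) :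
    evalAt b p (fun i => ∑ J : Fin n → ι, C (b.repr (T fun s => b (J s)) i) * ∏ s, w s (J s))
      = T fun s => evalAt b p (w s) := by
  classical
  simp only [evalAt_apply, T.map_sum, T.map_smul_univ, map_sum, map_mul, eval_C, map_prod,
    Finset.sum_smul]
  rw [Finset.sum_comm]
  refine Finset.sum_congr rfl fun J _ => ?_
  conv_rhs => rw [← b.sum_repr (T fun s => b (J s)), Finset.smul_sum]
  exact Finset.sum_congr rfl fun i _ => by rw [smul_smul, mul_comm]

/-- The extension of an operation on `V` to vectors of differential polynomials, by
multilinearity over the ring of differential polynomials. -/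
noncomputable def extOp [CharZero K] {n : ℕ} (T : Op K V n) : Op K (ι → DiffPoly K ι) n where
  toFun w i := ∑ J : Fin n → ι, C (b.repr (T fun s => b (J s)) i) * ∏ s, w s (J s)
  map_update_add' w s x y := by
    refine ext_evalAt b fun p => ?_
    have h : ∀ z, (fun t => evalAt b p (Function.update w s z t))
        = Function.update (fun t => evalAt b p (w t)) s (evalAt b p z) :=
      fun z => funext fun t => by by_cases ht : t = s <;> [(subst ht; simp); simp [ht]]
    rw [map_add]
    simp only [evalAt_term_sum, h, map_add, T.map_update_add]
  map_update_smul' w s c x := by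
    refine ext_evalAt b fun p => ?_
    have h : ∀ z, (fun t => evalAt b p (Function.update w s z t))
        = Function.update (fun t => evalAt b p (w t)) s (evalAt b p z) :=
      fun z => funext fun t => by by_cases ht : t = s <;> [(subst ht; simp); simp [ht]]
    rw [map_smul]
    simp only [evalAt_term_sum, h, map_smul, T.map_update_smul]

variable [CharZero K]

lemma evalAt_extOp {n : ℕ} (T : Op K V n) (p : ι × ℕ → K) (w : Fin n → ι → DiffPoly K ι) :
    evalAt b p (extOp b T w) = T fun s => evalAt b p (w s) :=
  evalAt_term_sum b T p w

/-- The `k`-th derivative `U_k` of the vector of unknowns. -/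
noncomputable def jet (K ι : Type*) [Field K] (k : ℕ) : ι → DiffPoly K ι := fun j => X (j, k)

lemma term_eq_extOp {n : ℕ} (T : Op K V n) (a : Fin n → ℕ) :
    term b T a = extOp b T fun s => jet K ι (a s) := rfl

lemma evalAt_bil (A : Op K V 2) (p : ι × ℕ → K) (x y : ι → DiffPoly K ι) :
    evalAt b p (bil (extOp b A) x y) = bil A (evalAt b p x) (evalAt b p y) := by
  rw [bil_apply, evalAt_extOp, bil_apply]
  congr 1
  funext s
  fin_cases s <;> rfl

lemma evalAt_tri (F : Op K V 3) (p : ι × ℕ → K) (x y z : ι → DiffPoly K ι) :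
    evalAt b p (tri (extOp b F) x y z)
      = tri F (evalAt b p x) (evalAt b p y) (evalAt b p z) := by
  rw [tri_apply, evalAt_extOp, tri_apply]
  congr 1
  funext s
  fin_cases s <;> rfl

omit [CharZero K] in
/-- The jets of the unknowns can be given arbitrary values in `V`. -/
lemma exists_evalAt_jet (v : ℕ → V) : ∃ p, ∀ k, evalAt b p (jet K ι k) = v k :=
  ⟨fun q => b.repr (v q.2) q.1, fun k => by
    simp [evalAt_apply, jet, b.sum_repr]⟩

omit [CharZero K] in
lemma evalAt_smul (p : ι × ℕ → K) (r : DiffPoly K ι) (w : ι → DiffPoly K ι) :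
    evalAt b p (r • w) = eval p r • evalAt b p w := by
  simp [evalAt_apply, Finset.smul_sum, smul_smul]

/-! ### The componentwise action of derivations -/

/-- The componentwise action of a derivation on vectors of differential polynomials. -/
noncomputable def vec {K ι : Type*} [Field K]
    (δ : Derivation K (DiffPoly K ι) (DiffPoly K ι)) :
    (ι → DiffPoly K ι) →ₗ[K] (ι → DiffPoly K ι) :=
  (δ : DiffPoly K ι →ₗ[K] DiffPoly K ι).compLeft ι

@[simp] lemma vec_apply {K ι : Type*} [Field K]
    (δ : Derivation K (DiffPoly K ι) (DiffPoly K ι)) (w : ι → DiffPoly K ι) (i : ι) :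
    vec δ w i = δ (w i) := rfl

/-- The Leibniz rule for a product over a finite set. -/
lemma derivation_prod {R S α : Type*} [CommRing R] [CommRing S] [Algebra R S] [DecidableEq α]
    (δ : Derivation R S S) (t : Finset α) (g : α → S) :
    δ (∏ i ∈ t, g i) = ∑ s ∈ t, ∏ i ∈ t, Function.update g s (δ (g s)) i := by
  induction t using Finset.induction_on with
  | empty => simp
  | insert a t ha ih =>
    rw [Finset.prod_insert ha, Derivation.leibniz, ih, Finset.sum_insert ha,
      Finset.prod_insert ha, Function.update_self, Finset.prod_congr rfl (fun i hi =>
      Function.update_of_ne (ne_of_mem_of_not_mem hi ha) _ _), smul_eq_mul, smul_eq_mul,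
      mul_comm (∏ i ∈ t, g i), add_comm, Finset.mul_sum]
    congr 1
    refine Finset.sum_congr rfl fun s hs => ?_
    rw [Finset.prod_insert ha, Function.update_of_ne (ne_of_mem_of_not_mem hs ha).symm]

/-- A derivation obeys the Leibniz rule with respect to every operation with constant coefficients.
-/
lemma vec_extOp (δ : Derivation K (DiffPoly K ι) (DiffPoly K ι)) {n : ℕ} (T : Op K V n)
    (w : Fin n → ι → DiffPoly K ι) :
    vec δ (extOp b T w) = ∑ s, extOp b T (Function.update w s (vec δ (w s))) := by
  classical
  funext i
  simp only [vec_apply, extOp, MultilinearMap.coe_mk, map_sum, Finset.sum_apply]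
  rw [Finset.sum_comm]
  refine Finset.sum_congr rfl fun J _ => ?_
  rw [Derivation.leibniz, derivation_C, smul_zero, add_zero, derivation_prod, smul_eq_mul,
    Finset.mul_sum]
  refine Finset.sum_congr rfl fun s _ => ?_
  congr 1
  refine Finset.prod_congr rfl fun t _ => ?_
  by_cases h : t = s
  · subst h; simp
  · simp [h]

lemma vec_bil (δ : Derivation K (DiffPoly K ι) (DiffPoly K ι)) (A : Op K V 2)
    (x y : ι → DiffPoly K ι) :
    vec δ (bil (extOp b A) x y)
      = bil (extOp b A) (vec δ x) y + bil (extOp b A) x (vec δ y) := by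
  rw [bil_apply, vec_extOp, Fin.sum_univ_two, update_two_zero, update_two_one]
  rfl

lemma vec_tri (δ : Derivation K (DiffPoly K ι) (DiffPoly K ι)) (F : Op K V 3)
    (x y z : ι → DiffPoly K ι) :
    vec δ (tri (extOp b F) x y z)
      = tri (extOp b F) (vec δ x) y z + tri (extOp b F) x (vec δ y) z
        + tri (extOp b F) x y (vec δ z) := by
  rw [tri_apply, vec_extOp, Fin.sum_univ_three, update_three_zero, update_three_one,
    update_three_two]
  rfl

/-! ### Orders of vanishing and homogeneity -/

/-- Vectors of differential polynomials all of whose terms have degree at least `k`. -/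
noncomputable def order (K ι : Type*) [Field K] (k : ℕ) :
    Submodule (DiffPoly K ι) (ι → DiffPoly K ι) :=
  Submodule.pi Set.univ fun _ => idealOfVars (ι × ℕ) K ^ k

lemma mem_order {K ι : Type*} [Field K] {k : ℕ} {w : ι → DiffPoly K ι} :
    w ∈ order K ι k ↔ ∀ i, w i ∈ idealOfVars (ι × ℕ) K ^ k := by
  simp [order]

lemma order_mono {K ι : Type*} [Field K] {k l : ℕ} (h : k ≤ l) : order K ι l ≤ order K ι k :=
  fun _ hw => mem_order.2 fun i => Ideal.pow_le_pow_right h (mem_order.1 hw i)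

lemma smul_mem_order {K ι : Type*} [Field K] {k : ℕ} {w : ι → DiffPoly K ι} (c : K)
    (h : w ∈ order K ι k) : c • w ∈ order K ι k :=
  Submodule.smul_of_tower_mem _ c h

lemma jet_mem_order {K ι : Type*} [Field K] (k : ℕ) : jet K ι k ∈ order K ι 1 :=
  mem_order.2 fun j => by
    rw [pow_one]
    exact Ideal.subset_span (Set.mem_range_self (j, k))

lemma extOp_mem_order {n : ℕ} (T : Op K V n) {w : Fin n → ι → DiffPoly K ι} {k : Fin n → ℕ}
    (h : ∀ s, w s ∈ order K ι (k s)) : extOp b T w ∈ order K ι (∑ s, k s) := by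
  refine mem_order.2 fun i => ?_
  refine Ideal.sum_mem _ fun J _ => Ideal.mul_mem_left _ _ ?_
  rw [← Finset.prod_pow_eq_pow_sum]
  exact Ideal.prod_mem_prod fun s _ => mem_order.1 (h s) _

lemma bil_mem_order (A : Op K V 2) {x y : ι → DiffPoly K ι} {k l : ℕ}
    (hx : x ∈ order K ι k) (hy : y ∈ order K ι l) :
    bil (extOp b A) x y ∈ order K ι (k + l) := by
  have := extOp_mem_order b A (w := ![x, y]) (k := ![k, l])
    (fun s => by fin_cases s <;> assumption)
  simpa [Fin.sum_univ_two] using this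

lemma tri_mem_order (F : Op K V 3) {x y z : ι → DiffPoly K ι} {k l m : ℕ}
    (hx : x ∈ order K ι k) (hy : y ∈ order K ι l) (hz : z ∈ order K ι m) :
    tri (extOp b F) x y z ∈ order K ι (k + l + m) := by
  have := extOp_mem_order b F (w := ![x, y, z]) (k := ![k, l, m])
    (fun s => by fin_cases s <;> assumption)
  simpa [Fin.sum_univ_three] using this

lemma vec_totalD_mem_order {K ι : Type*} [Field K] {k : ℕ} {w : ι → DiffPoly K ι}
    (h : w ∈ order K ι k) : vec (totalD K ι) w ∈ order K ι k :=
  mem_order.2 fun i => totalD_mem_pow (mem_order.1 h i)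

lemma vec_evolField_mem_order {K ι : Type*} [Field K] {k e : ℕ} {G w : ι → DiffPoly K ι}
    (hG : G ∈ order K ι e) (h : w ∈ order K ι (k + 1)) :
    vec (evolField G) w ∈ order K ι (k + e) :=
  mem_order.2 fun i => derivation_mem_pow (fun v => by
    rw [show v = (v.1, v.2) from rfl, evolField_X]
    exact totalD_iterate_mem_pow _ (mem_order.1 hG _)) (mem_order.1 h i)

/-- Vectors of homogeneous differential polynomials of degree `k`. -/
noncomputable def homog (K ι : Type*) [Field K] (k : ℕ) : Submodule K (ι → DiffPoly K ι) :=
  Submodule.pi Set.univ fun _ => homogeneousSubmodule (ι × ℕ) K k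

lemma mem_homog {K ι : Type*} [Field K] {k : ℕ} {w : ι → DiffPoly K ι} :
    w ∈ homog K ι k ↔ ∀ i, (w i).IsHomogeneous k := by
  simp [homog]

lemma jet_mem_homog {K ι : Type*} [Field K] (k : ℕ) : jet K ι k ∈ homog K ι 1 :=
  mem_homog.2 fun _ => isHomogeneous_X _ _

lemma homog_le_order {K ι : Type*} [Field K] {k : ℕ} {w : ι → DiffPoly K ι}
    (h : w ∈ homog K ι k) : w ∈ order K ι k :=
  mem_order.2 fun i => mem_pow_of_isHomogeneous (mem_homog.1 h i)

lemma eq_zero_of_mem_homog_of_mem_order {K ι : Type*} [Field K] {k : ℕ} {w : ι → DiffPoly K ι}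
    (h : w ∈ homog K ι k) (h' : w ∈ order K ι (k + 1)) : w = 0 :=
  funext fun i => eq_zero_of_isHomogeneous_of_mem (mem_homog.1 h i) (mem_order.1 h' i)

lemma extOp_mem_homog {n : ℕ} (T : Op K V n) {w : Fin n → ι → DiffPoly K ι} {k : Fin n → ℕ}
    (h : ∀ s, w s ∈ homog K ι (k s)) : extOp b T w ∈ homog K ι (∑ s, k s) := by
  refine mem_homog.2 fun i => IsHomogeneous.sum _ _ _ fun J _ => ?_
  rw [← zero_add (∑ s, k s)]
  exact (isHomogeneous_C _ _).mul (IsHomogeneous.prod _ _ _ fun s _ => mem_homog.1 (h s) _)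

lemma term_mem_homog {n : ℕ} (T : Op K V n) (a : Fin n → ℕ) : term b T a ∈ homog K ι n := by
  rw [term_eq_extOp]
  simpa using extOp_mem_homog b T (k := fun _ => 1) fun s => jet_mem_homog (a s)

lemma bil_mem_homog (A : Op K V 2) {x y : ι → DiffPoly K ι} {k l : ℕ}
    (hx : x ∈ homog K ι k) (hy : y ∈ homog K ι l) :
    bil (extOp b A) x y ∈ homog K ι (k + l) := by
  have := extOp_mem_homog b A (w := ![x, y]) (k := ![k, l])
    (fun s => by fin_cases s <;> assumption)
  simpa [Fin.sum_univ_two] using this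

lemma tri_mem_homog (F : Op K V 3) {x y z : ι → DiffPoly K ι} {k l m : ℕ}
    (hx : x ∈ homog K ι k) (hy : y ∈ homog K ι l) (hz : z ∈ homog K ι m) :
    tri (extOp b F) x y z ∈ homog K ι (k + l + m) := by
  have := extOp_mem_homog b F (w := ![x, y, z]) (k := ![k, l, m])
    (fun s => by fin_cases s <;> assumption)
  simpa [Fin.sum_univ_three] using this

lemma isHomogeneous_totalD {K ι : Type*} [Field K] {k : ℕ} {p : DiffPoly K ι}
    (h : p.IsHomogeneous k) : (totalD K ι p).IsHomogeneous k := by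
  cases k with
  | zero =>
    rw [← homogeneousComponent_eq_self h, homogeneousComponent_zero, derivation_C]
    exact isHomogeneous_zero _ _ _
  | succ k => exact isHomogeneous_mkDerivation (fun _ => isHomogeneous_X _ _) h

lemma vec_totalD_mem_homog {K ι : Type*} [Field K] {k : ℕ} {w : ι → DiffPoly K ι}
    (h : w ∈ homog K ι k) : vec (totalD K ι) w ∈ homog K ι k :=
  mem_homog.2 fun i => isHomogeneous_totalD (mem_homog.1 h i)

lemma vec_evolField_mem_homog {K ι : Type*} [Field K] {k e : ℕ} {G w : ι → DiffPoly K ι}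
    (hG : G ∈ homog K ι e) (h : w ∈ homog K ι (k + 1)) :
    vec (evolField G) w ∈ homog K ι (k + e) := by
  refine mem_homog.2 fun i => isHomogeneous_mkDerivation (fun v => ?_) (mem_homog.1 h i)
  induction v.2 with
  | zero => exact mem_homog.1 hG _
  | succ n ih => rw [Function.iterate_succ_apply']; exact isHomogeneous_totalD ih

/-! ### Evolutionary fields acting on vectors -/

@[simp] lemma vec_totalD_jet {K ι : Type*} [Field K] (k : ℕ) :
    vec (totalD K ι) (jet K ι k) = jet K ι (k + 1) :=
  funext fun j => totalD_X j k

lemma vec_evolField_jet_zero {K ι : Type*} [Field K] (G : ι → DiffPoly K ι) :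
    vec (evolField G) (jet K ι 0) = G :=
  funext fun j => evolField_X G j 0

lemma vec_evolField_jet_succ {K ι : Type*} [Field K] (G : ι → DiffPoly K ι) (k : ℕ) :
    vec (evolField G) (jet K ι (k + 1)) = vec (totalD K ι) (vec (evolField G) (jet K ι k)) := by
  funext j
  simp only [vec_apply, jet, evolField_X, Function.iterate_succ_apply']

lemma vec_evolField_totalD {K ι : Type*} [Field K] (G w : ι → DiffPoly K ι) :
    vec (evolField G) (vec (totalD K ι) w) = vec (totalD K ι) (vec (evolField G) w) :=
  funext fun i => totalD_commutes_evolField G (w i)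

lemma evolField_add {K ι : Type*} [Field K] (F G : ι → DiffPoly K ι) :
    evolField (F + G) = evolField F + evolField G := by
  refine derivation_ext fun v => ?_
  rw [show v = (v.1, v.2) from rfl, Derivation.add_apply]
  simp only [evolField_X, Pi.add_apply]
  induction v.2 with
  | zero => rfl
  | succ n ih => simp only [Function.iterate_succ_apply', ih, map_add]

lemma vec_evolField_add {K ι : Type*} [Field K] (F G w : ι → DiffPoly K ι) :
    vec (evolField (F + G)) w = vec (evolField F) w + vec (evolField G) w := by
  rw [evolField_add]; rfl

/-- Two systems are symmetries of each other as soon as the evolutionary fields commute on the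
unknowns themselves. -/
lemma isSymmetry_iff {K ι : Type*} [Field K] (F G : ι → DiffPoly K ι) :
    IsSymmetry F G ↔ vec (evolField F) G = vec (evolField G) F := by
  constructor
  · intro h
    funext j
    have := DFunLike.congr_fun h (X (j, 0))
    rwa [Derivation.commutator_apply, evolField_X, evolField_X, Derivation.zero_apply,
      sub_eq_zero] at this
  · intro h
    refine derivation_ext fun v => ?_
    rw [show v = (v.1, v.2) from rfl, Derivation.commutator_apply, Derivation.zero_apply,
      sub_eq_zero]
    have key : ∀ n, vec (evolField F) (vec (evolField G) (jet K ι n))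
        = vec (evolField G) (vec (evolField F) (jet K ι n)) := by
      intro n
      induction n with
      | zero => rw [vec_evolField_jet_zero, vec_evolField_jet_zero, h]
      | succ n ih =>
        rw [vec_evolField_jet_succ, vec_evolField_totalD, ih, vec_evolField_jet_succ,
          vec_evolField_totalD]
    exact congrFun (key v.2) v.1

end Ext

/-! ### Compatible products -/

section Identities

variable {K V : Type*} [Field K] [AddCommGroup V] [Module K V]

/-- The Jacobian `z(xy) + x(yz) + y(zx)` of a curried bilinear operation. -/
def jacobian (a : V →ₗ[K] V →ₗ[K] V) (x y z : V) : V :=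
  a z (a x y) + a x (a y z) + a y (a z x)

lemma jacobian_cycle (a : V →ₗ[K] V →ₗ[K] V) (x y z : V) :
    jacobian a x y z = jacobian a y z x := by
  simp only [jacobian]
  abel

/-- The identities linking a skew-symmetric product `a` and a triple product `f`, without the
Jordan identity: left multiplications are derivations of `f`, and the defect of left
multiplications from being derivations of the Jacobian is expressed through `f`. -/
structure Compatible (a : V →ₗ[K] V →ₗ[K] V) (f : V →ₗ[K] V →ₗ[K] V →ₗ[K] V) : Prop where
  skew : ∀ x y, a x y = - a y x
  symm : ∀ x y z, f x y z = f z y x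
  der : ∀ x y z u, a x (f y z u) = f (a x y) z u + f y (a x z) u + f y z (a x u)
  third : ∀ x y z u, a z ((2 : K) • f x y u - (2 : K) • f x u y - a x (a u y))
    + jacobian a (a u y) x z + a x (jacobian a y z u) - jacobian a (a x y) z u
    - jacobian a y (a x z) u - jacobian a y z (a x u) = 0

namespace Compatible

variable {a : V →ₗ[K] V →ₗ[K] V} {f : V →ₗ[K] V →ₗ[K] V →ₗ[K] V} (h : Compatible a f)

include h

lemma self [CharZero K] (x : V) : a x x = 0 := by
  have h2 : (2 : K) • a x x = 0 := by
    linear_combination (norm := module) h.skew x x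
  exact (smul_eq_zero.1 h2).resolve_left two_ne_zero

lemma jacobian_eq (x y z : V) :
    jacobian a x y z = a x (a y z) - a y (a x z) - a (a x y) z := by
  rw [jacobian, h.skew z x, h.skew z (a x y), map_neg]
  module

lemma jacobian_swap (x y z : V) : jacobian a x y z = - jacobian a y x z := by
  rw [h.jacobian_eq, h.jacobian_eq, h.skew y x, map_neg, LinearMap.neg_apply]
  module

lemma jacobian_self [CharZero K] (x z : V) : jacobian a x x z = 0 := by
  rw [h.jacobian_eq, h.self, map_zero, LinearMap.zero_apply]
  module

/-- The operators `jacobian a x y` are derivations of the triple product. -/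
lemma jacobian_der (x y p q r : V) : jacobian a x y (f p q r)
    = f (jacobian a x y p) q r + f p (jacobian a x y q) r + f p q (jacobian a x y r) := by
  simp only [h.jacobian_eq, h.der, map_add, map_sub, LinearMap.sub_apply]
  module

lemma jacobian_mid (x p q r z : V) : jacobian a x (f p q r) z
    = f (jacobian a z x p) q r + f p (jacobian a z x q) r + f p q (jacobian a z x r) := by
  rw [jacobian_cycle, jacobian_cycle, h.jacobian_der]

/-- The third identity, as a formula for the commutator of a left multiplication and of an
operator `jacobian a u y`. -/
lemma mul_jacobian (x u y z : V) : a x (jacobian a u y z)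
    = jacobian a (a x u) y z + jacobian a u (a x y) z + jacobian a u y (a x z)
      + a ((2 : K) • f x y u - (2 : K) • f x u y - a x (a u y)) z + jacobian a x (a u y) z := by
  have h1 := h.third x y z u
  rw [h.skew z, jacobian_cycle a y z u, jacobian_cycle a z u y, jacobian_cycle a (a x y) z u,
    jacobian_cycle a z u (a x y), jacobian_cycle a y (a x z) u, jacobian_cycle a (a x z) u y,
    jacobian_cycle a y z (a x u), jacobian_cycle a z (a x u) y,
    h.jacobian_swap (a u y) x z] at h1
  linear_combination (norm := module) h1

/-- The vector `2 F(x,y,x) - 2 F(x,x,y) - x(xy)` is annihilated by `x`. -/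
lemma mul_defect [CharZero K] (x y : V) :
    a x ((2 : K) • f x y x - (2 : K) • f x x y - a x (a x y)) = 0 := by
  have h1 := h.mul_jacobian x x y x
  rw [jacobian_cycle a x y x, jacobian_cycle a y x x, h.self, jacobian_cycle a x (a x y) x,
    jacobian_cycle a (a x y) x x, h.jacobian_self, h.jacobian_self, h.skew _ x] at h1
  simp only [map_zero, jacobian, LinearMap.zero_apply, add_zero, zero_add] at h1
  linear_combination (norm := module) h1

end Compatible

/-! ### The gauge derivative -/

/-- The covariant derivative `D + L_u`, where `L_u` is the left multiplication by `u`. -/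
def gauge (a : V →ₗ[K] V →ₗ[K] V) (D : V →ₗ[K] V) (u : V) : V →ₗ[K] V := D + a u

/-- Derivations of both the binary and the triple product. -/
structure IsDer (a : V →ₗ[K] V →ₗ[K] V) (f : V →ₗ[K] V →ₗ[K] V →ₗ[K] V) (D : V →ₗ[K] V) :
    Prop where
  bil : ∀ x y, D (a x y) = a (D x) y + a x (D y)
  tri : ∀ x y z, D (f x y z) = f (D x) y z + f x (D y) z + f x y (D z)

section Gauge

variable {a : V →ₗ[K] V →ₗ[K] V} {f : V →ₗ[K] V →ₗ[K] V →ₗ[K] V}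
  (h : Compatible a f) {D : V →ₗ[K] V} (hD : IsDer a f D) (u : V)

include h hD

lemma gauge_tri (x y z : V) : gauge a D u (f x y z)
    = f (gauge a D u x) y z + f x (gauge a D u y) z + f x y (gauge a D u z) := by
  simp only [gauge, LinearMap.add_apply, hD.tri, h.der, map_add]
  module

/-- The covariant derivative is not a derivation of the binary product; the defect is a Jacobian. -/
lemma gauge_bil (x y : V) : gauge a D u (a x y)
    = a (gauge a D u x) y + a x (gauge a D u y) + jacobian a u x y := by
  simp only [gauge, LinearMap.add_apply, hD.bil, h.jacobian_eq, map_add]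
  module

lemma gauge_jacobian (x y z : V) : gauge a D u (jacobian a x y z)
    = jacobian a (gauge a D u x) y z + jacobian a x (gauge a D u y) z
      + jacobian a x y (gauge a D u z)
      + a ((2 : K) • f u y x - (2 : K) • f u x y - a u (a x y)) z + jacobian a u (a x y) z := by
  have h1 := h.mul_jacobian u x y z
  have h2 : D (jacobian a x y z)
      = jacobian a (D x) y z + jacobian a x (D y) z + jacobian a x y (D z) := by
    simp only [jacobian, map_add, hD.bil]
    module
  simp only [gauge, LinearMap.add_apply, h2, h1]
  simp only [jacobian, map_add, LinearMap.add_apply]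
  module

/-! ### The component of the connection along the third-order flow -/

omit h hD

lemma jacobian_add_mid (x y y' z : V) :
    jacobian a x (y + y') z = jacobian a x y z + jacobian a x y' z := by
  simp only [jacobian, map_add, LinearMap.add_apply]
  module

lemma jacobian_smul_mid (c : K) (x y z : V) :
    jacobian a x (c • y) z = c • jacobian a x y z := by
  simp only [jacobian, map_smul, LinearMap.smul_apply]
  module

/-- The operator `z ↦ 𝒥(x, y, z)`. -/
def jacobianMap (a : V →ₗ[K] V →ₗ[K] V) (x y : V) : V →ₗ[K] V :=
  a x ∘ₗ a y - a y ∘ₗ a x - a (a x y)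

include h in
lemma jacobianMap_apply (x y z : V) : jacobianMap a x y z = jacobian a x y z := by
  rw [h.jacobian_eq]
  rfl

/-- The `t`-component of the connection: a derivation of the triple product built from
`w₀ = U`, `w₁ = ∇U`, `w₂ = ∇²U`. -/
def timeForm (a : V →ₗ[K] V →ₗ[K] V) (f : V →ₗ[K] V →ₗ[K] V →ₗ[K] V) (w₀ w₁ w₂ : V) :
    V →ₗ[K] V :=
  a (w₂ + a w₀ w₁ + (2 : K) • f w₀ w₀ w₀) - jacobianMap a w₀ w₁

include h in
lemma timeForm_apply (w₀ w₁ w₂ z : V) : timeForm a f w₀ w₁ w₂ z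
    = a (w₂ + a w₀ w₁ + (2 : K) • f w₀ w₀ w₀) z - jacobian a w₀ w₁ z := by
  rw [← jacobianMap_apply h]
  rfl

include h in
/-- The operators `𝒥(x, ·, z)` annihilate `f(x, x, x)`. -/
lemma jacobian_cube [CharZero K] (x z : V) : jacobian a x (f x x x) z = 0 := by
  have h0 : jacobian a z x x = 0 := by
    rw [jacobian_cycle, h.jacobian_self]
  rw [h.jacobian_mid, h0]
  simp

include h in
lemma mul_cube [CharZero K] (x : V) : a x (f x x x) = 0 := by
  rw [h.der, h.self]
  simp

include h hD in
/-- Flatness of the connection in the directions `x` and `t`: if `w_k` are the covariant jets `∇^k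
U` and `δ` is a derivation commuting with `D` such that `(δ + timeForm) U = ∇³U + 6 F(U, U, ∇U)`,
this is the statement that `δ + timeForm` commutes with `∇`. -/
lemma gauge_timeForm [CharZero K] {w₀ w₁ w₂ w₃ : V} (h₁ : gauge a D w₀ w₀ = w₁)
    (h₂ : gauge a D w₀ w₁ = w₂) (h₃ : gauge a D w₀ w₂ = w₃) (z : V) :
    gauge a D w₀ (timeForm a f w₀ w₁ w₂ z)
      = timeForm a f w₀ w₁ w₂ (gauge a D w₀ z) - a (timeForm a f w₀ w₁ w₂ w₀) z
        + a (w₃ + (6 : K) • f w₀ w₀ w₁) z := by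
  simp only [timeForm_apply h, map_add, map_sub, map_smul, gauge_bil h hD, gauge_tri h hD,
    gauge_jacobian h hD, h₁, h₂, h₃, jacobian_cube h,
    h.self, h.jacobian_self, LinearMap.add_apply, LinearMap.smul_apply, LinearMap.sub_apply,
    jacobian_cycle a w₀ w₁ w₀, jacobian_cycle a w₁ w₀ w₀, h.skew _ w₀, mul_cube h, h.symm w₁ w₀ w₀,
    map_neg, LinearMap.neg_apply, map_zero, LinearMap.zero_apply]
  module

end Gauge

end Identities

/-! ### The component of the connection along the fifth-order flow -/

section FifthForm

variable {K V : Type*} [Field K] [AddCommGroup V] [Module K V]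
  {a : V →ₗ[K] V →ₗ[K] V} {f : V →ₗ[K] V →ₗ[K] V →ₗ[K] V}

/-- The linearisation of `jacobian_cube` at `x` in the direction `y`. -/
lemma jacobian_cube_linearised (h : Compatible a f) [CharZero K] (x y z : V) :
    jacobian a y (f x x x) z + jacobian a x ((2 : K) • f x x y + f x y x) z = 0 := by
  have h0 : jacobian a z x x = 0 := by
    rw [jacobian_cycle, h.jacobian_self]
  have h1 : jacobian a z y x = - jacobian a z x y := by
    rw [jacobian_cycle, jacobian_cycle a z x y, h.jacobian_swap, jacobian_cycle a x y z,
      jacobian_cycle a y z x]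
  rw [jacobian_add_mid, jacobian_smul_mid, h.jacobian_mid, h.jacobian_mid, h.jacobian_mid, h0, h1,
    h.symm x x (- _), h.symm x x (jacobian a z x y)]
  simp only [map_neg, map_zero, LinearMap.neg_apply, LinearMap.zero_apply]
  module

/-- The combination of Jacobians left over by the terms quadratic in `w₁` of the curvature in the
directions `x` and `τ`; it vanishes by four instances of the third compatibility identity. -/
lemma jacobian_residual (h : Compatible a f) [CharZero K] (x y z : V) :
    (2 : K) • jacobian a y (f x y x) z + (2 : K) • jacobian a x (f y x y) z
      + a ((4 : K) • f x y (a x y) - (4 : K) • f y x (a x y)) z = 0 := by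
  have h0 : jacobian a z x x = 0 := by
    rw [jacobian_cycle, h.jacobian_self]
  have h0' : jacobian a z y y = 0 := by
    rw [jacobian_cycle, h.jacobian_self]
  have e1 := congrArg (fun t => a t y) (h.third z x x y)
  have e2 := congrArg (fun t => a t x) (h.third z x y y)
  have e3 := h.third (a x y) x z y
  have e4 := h.third z y (a x y) x
  rw [h.jacobian_mid, h.jacobian_mid, h0, h0']
  have s1 : ∀ p q, a (a p q) x = - a x (a p q) := fun p q => h.skew _ _
  have s2 : ∀ p q, a (a p q) y = - a y (a p q) := fun p q => h.skew _ _
  have s3 : ∀ p q, a (a p q) z = - a z (a p q) := fun p q => h.skew _ _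
  have s4 : ∀ p q r, a (f p q r) x = - a x (f p q r) := fun p q r => h.skew _ _
  have s5 : ∀ p q r, a (f p q r) y = - a y (f p q r) := fun p q r => h.skew _ _
  have s6 : ∀ p q r, a (f p q r) z = - a z (f p q r) := fun p q r => h.skew _ _
  have s7 : a y x = - a x y := h.skew _ _
  have s8 : a z x = - a x z := h.skew _ _
  have s9 : a z y = - a y z := h.skew _ _
  have s10 : a (a x z) (a x y) = - a (a x y) (a x z) := h.skew _ _
  have s12 : a (a y z) (a x y) = - a (a x y) (a y z) := h.skew _ _
  have s13 : ∀ p q r s t, a (a p (a q r)) (a s t) = - a (a s t) (a p (a q r)) :=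
    fun _ _ _ _ _ => h.skew _ _
  simp only [jacobian, map_add, map_sub, map_neg, map_smul, map_zero, LinearMap.add_apply,
    LinearMap.neg_apply, LinearMap.sub_apply, LinearMap.smul_apply, LinearMap.zero_apply,
    s1, s2, s3, s4, s5, s6, s7, s8, s9, s10, s12, s13, h.self, h.der] at e1 e2 e3 e4 ⊢
  simp only [h.symm] at e1 e2 e3 e4 ⊢
  linear_combination (norm := module) (2:K) • e1 - (2:K) • e2 + (2:K) • e3 + (2:K) • e4

/-- The vector whose left multiplication is the leading part of `fifthForm`. -/
def fifthVector (a : V →ₗ[K] V →ₗ[K] V) (f : V →ₗ[K] V →ₗ[K] V →ₗ[K] V)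
    (w₀ w₁ w₂ w₃ w₄ : V) : V :=
  w₄ + a w₀ w₃ - a w₁ w₂ + (8 : K) • f w₀ w₀ w₂ + (2 : K) • f w₀ w₂ w₀ + (4 : K) • f w₀ w₁ w₁
    + (6 : K) • f w₁ w₀ w₁ + (2 : K) • a w₀ (a w₀ (a w₀ w₁)) + (16 : K) • a w₀ (f w₀ w₀ w₁)
    + (2 : K) • a w₁ (f w₀ w₀ w₀) + (6 : K) • f w₀ w₀ (f w₀ w₀ w₀)

/-- The right-hand side of the fifth-order system in terms of the covariant jets `w_k = ∇^k U`. -/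
def fifthFlow (f : V →ₗ[K] V →ₗ[K] V →ₗ[K] V) (w₀ w₁ w₂ w₃ w₅ : V) : V :=
  w₅ + (10 : K) • f w₀ w₀ w₃ + (10 : K) • f w₀ w₁ w₂ + (10 : K) • f w₀ w₂ w₁
    + (20 : K) • f w₁ w₀ w₂ + (10 : K) • f w₁ w₁ w₁
    + (20 : K) • f w₀ w₀ (f w₀ w₀ w₁) + (10 : K) • f w₀ (f w₀ w₀ w₀) w₁

/-- A combination that vanishes when `f` satisfies the Jordan identity; it is the contribution to
the curvature in the directions `x` and `τ` that the compatibility identities do not cancel. -/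
def jordanDefect (f : V →ₗ[K] V →ₗ[K] V →ₗ[K] V) (w₀ w₁ : V) : V :=
  (2 : K) • f w₀ w₁ (f w₀ w₀ w₀) + (6 : K) • f w₀ w₀ (f w₀ w₁ w₀)
    - (8 : K) • f w₀ (f w₀ w₀ w₁) w₀ + (6 : K) • f w₁ w₀ (f w₀ w₀ w₀)
    - (6 : K) • f w₀ (f w₀ w₀ w₀) w₁

/-- The part of the curvature in the directions `x` and `τ` that is a left multiplication. -/
lemma gauge_fifthVector [CharZero K] (h : Compatible a f) {D : V →ₗ[K] V} (hD : IsDer a f D)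
    {w₀ w₁ w₂ w₃ w₄ w₅ : V} (h₁ : gauge a D w₀ w₀ = w₁) (h₂ : gauge a D w₀ w₁ = w₂)
    (h₃ : gauge a D w₀ w₂ = w₃) (h₄ : gauge a D w₀ w₃ = w₄) (h₅ : gauge a D w₀ w₄ = w₅) :
    gauge a D w₀ (fifthVector a f w₀ w₁ w₂ w₃ w₄) + a (fifthVector a f w₀ w₁ w₂ w₃ w₄) w₀
      + (- jacobian a w₀ w₃ w₀ + jacobian a w₁ w₂ w₀ + (2 : K) • jacobian a w₁ (f w₀ w₀ w₀) w₀
        - (4 : K) • jacobian a w₀ (f w₀ w₀ w₁) w₀)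
      - ((2 : K) • f w₀ w₃ w₀ - (2 : K) • f w₀ w₀ w₃ - a w₀ (a w₀ w₃))
      + ((2 : K) • f w₀ w₂ w₁ - (2 : K) • f w₀ w₁ w₂ - a w₀ (a w₁ w₂))
      + (2 : K) • ((2 : K) • f w₀ (f w₀ w₀ w₀) w₁ - (2 : K) • f w₀ w₁ (f w₀ w₀ w₀)
        - a w₀ (a w₁ (f w₀ w₀ w₀)))
      - (4 : K) • ((2 : K) • f w₀ (f w₀ w₀ w₁) w₀ - (2 : K) • f w₀ w₀ (f w₀ w₀ w₁)
        - a w₀ (a w₀ (f w₀ w₀ w₁)))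
      = fifthFlow f w₀ w₁ w₂ w₃ w₅ + jordanDefect f w₀ w₁
        + (4 : K) • f w₀ w₁ (a w₀ w₁) - (4 : K) • f w₁ w₀ (a w₀ w₁) := by
  have e1 := h.third w₀ w₂ w₀ w₀
  have e2 := h.third w₁ w₁ w₀ w₀
  have e3 := h.third w₀ w₁ w₁ w₀
  have e4 := h.third w₀ w₀ w₀ (a w₀ w₁)
  have s0 : ∀ p q, a (a p q) w₀ = - a w₀ (a p q) := fun p q => h.skew _ _
  have s1 : ∀ p q, a (a p q) w₁ = - a w₁ (a p q) := fun p q => h.skew _ _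
  have s3 : ∀ p q r, a (f p q r) w₀ = - a w₀ (f p q r) := fun p q r => h.skew _ _
  have s6 : a w₁ w₀ = - a w₀ w₁ := h.skew _ _
  have s7 : a w₂ w₀ = - a w₀ w₂ := h.skew _ _
  have s8 : a w₃ w₀ = - a w₀ w₃ := h.skew _ _
  have s9 : a w₄ w₀ = - a w₀ w₄ := h.skew _ _
  have s12 : ∀ p q r s t, a (f p q r) (a s t) = - a (a s t) (f p q r) :=
    fun _ _ _ _ _ => h.skew _ _
  simp only [fifthVector, fifthFlow, jordanDefect, map_add, map_sub, map_smul, gauge_bil h hD,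
    gauge_tri h hD, h₁, h₂, h₃, h₄, h₅]
  simp only [jacobian, map_add, map_sub, map_neg, map_smul, map_zero, LinearMap.add_apply,
    LinearMap.neg_apply, LinearMap.sub_apply, LinearMap.smul_apply, LinearMap.zero_apply,
    s0, s1, s3, s6, s7, s8, s9, s12, h.self, h.der] at e1 e2 e3 e4 ⊢
  simp only [h.symm] at e1 e2 e3 e4 ⊢
  linear_combination (norm := module) -(2:K) • e1 - (2:K) • e2 - (2:K) • e3 - (2:K) • e4

/-- The `τ`-component of the connection: a derivation of the triple product built from the
covariant jets `w_k = ∇^k U`. -/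
def fifthForm (a : V →ₗ[K] V →ₗ[K] V) (f : V →ₗ[K] V →ₗ[K] V →ₗ[K] V)
    (w₀ w₁ w₂ w₃ w₄ : V) : V →ₗ[K] V :=
  a (fifthVector a f w₀ w₁ w₂ w₃ w₄) - jacobianMap a w₀ w₃ + jacobianMap a w₁ w₂
    + (2 : K) • jacobianMap a w₁ (f w₀ w₀ w₀) - (4 : K) • jacobianMap a w₀ (f w₀ w₀ w₁)

lemma fifthForm_apply (h : Compatible a f) (w₀ w₁ w₂ w₃ w₄ z : V) :
    fifthForm a f w₀ w₁ w₂ w₃ w₄ z = a (fifthVector a f w₀ w₁ w₂ w₃ w₄) z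
      - jacobian a w₀ w₃ z + jacobian a w₁ w₂ z + (2 : K) • jacobian a w₁ (f w₀ w₀ w₀) z
      - (4 : K) • jacobian a w₀ (f w₀ w₀ w₁) z := by
  simp only [← jacobianMap_apply h]
  rfl

/-- Reduction of the Jacobian of `U` and `fifthVector`, by which `∇` fails to be a derivation in
`fifthForm`, to Jacobians that also arise from the other terms of `fifthForm`. -/
lemma jacobian_fifthVector [CharZero K] (h : Compatible a f) (w₀ w₁ w₂ w₃ w₄ z : V) :
    jacobian a w₀ (fifthVector a f w₀ w₁ w₂ w₃ w₄) z
      = jacobian a w₀ w₄ z + jacobian a w₀ (a w₀ w₃) z - jacobian a w₀ (a w₁ w₂) z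
        + (4 : K) • jacobian a w₀ (f w₀ w₀ w₂) z
        + (4 : K) • jacobian a w₀ (f w₀ w₁ w₁) z + (4 : K) • jacobian a w₀ (f w₁ w₀ w₁) z
        + (4 : K) • jacobian a w₀ (a w₀ (f w₀ w₀ w₁)) z
        - (2 : K) • jacobian a w₀ (a w₁ (f w₀ w₀ w₀)) z
        - (2 : K) • jacobian a w₂ (f w₀ w₀ w₀) z - (2 : K) • jacobian a w₁ (f w₀ w₁ w₀) z
        - a ((4 : K) • f w₀ w₁ (a w₀ w₁) - (4 : K) • f w₁ w₀ (a w₀ w₁)) z := by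
  have e1 := jacobian_cube_linearised h w₀ w₂ z
  have e2 := jacobian_residual h w₀ w₁ z
  have e3 : a w₁ (f w₀ w₀ w₀) + a w₀ ((2 : K) • f w₀ w₀ w₁ + f w₀ w₁ w₀) = 0 := by
    simp only [map_add, map_smul, h.der, h.self, h.skew w₁ w₀, map_neg, LinearMap.neg_apply,
      map_zero, LinearMap.zero_apply, h.symm (a w₀ w₁) w₀ w₀]
    module
  have e4 := h.mul_defect w₀ w₁
  have e5 : jacobian a w₀ (f w₀ w₀ (f w₀ w₀ w₀)) z = 0 := by
    have h0 : jacobian a z w₀ w₀ = 0 := by rw [jacobian_cycle, h.jacobian_self]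
    rw [h.jacobian_mid, h0, jacobian_cycle a z w₀, jacobian_cube h]
    simp
  have e6 : fifthVector a f w₀ w₁ w₂ w₃ w₄
      = w₄ + a w₀ w₃ - a w₁ w₂ + (8 : K) • f w₀ w₀ w₂ + (2 : K) • f w₀ w₂ w₀
        + (4 : K) • f w₀ w₁ w₁ + (6 : K) • f w₁ w₀ w₁ + (4 : K) • a w₀ (f w₀ w₀ w₁)
        - (2 : K) • a w₁ (f w₀ w₀ w₀) + (6 : K) • f w₀ w₀ (f w₀ w₀ w₀) := by
    simp only [map_add, map_sub, map_smul] at e3 e4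
    rw [fifthVector]
    linear_combination (norm := module) (4 : K) • e3 - (2 : K) • e4
  rw [e6]
  simp only [sub_eq_add_neg, ← neg_smul, ← neg_one_smul K (a w₁ w₂), jacobian_add_mid,
    jacobian_smul_mid, e5] at e1 e2 ⊢
  linear_combination (norm := module) (2 : K) • e1 + e2

/-- Curvature of the connection in the directions `x` and `τ`. -/
lemma gauge_fifthForm [CharZero K] (h : Compatible a f) {D : V →ₗ[K] V} (hD : IsDer a f D)
    {w₀ w₁ w₂ w₃ w₄ w₅ : V} (h₁ : gauge a D w₀ w₀ = w₁) (h₂ : gauge a D w₀ w₁ = w₂)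
    (h₃ : gauge a D w₀ w₂ = w₃) (h₄ : gauge a D w₀ w₃ = w₄) (h₅ : gauge a D w₀ w₄ = w₅) (z : V) :
    gauge a D w₀ (fifthForm a f w₀ w₁ w₂ w₃ w₄ z)
      = fifthForm a f w₀ w₁ w₂ w₃ w₄ (gauge a D w₀ z)
        - a (fifthForm a f w₀ w₁ w₂ w₃ w₄ w₀) z
        + a (fifthFlow f w₀ w₁ w₂ w₃ w₅ + jordanDefect f w₀ w₁) z := by
  have e1 := congrArg (fun t => a t z) (gauge_fifthVector h hD h₁ h₂ h₃ h₄ h₅)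
  have e2 := jacobian_fifthVector h w₀ w₁ w₂ w₃ w₄ z
  simp only [fifthForm_apply h]
  generalize fifthVector a f w₀ w₁ w₂ w₃ w₄ = n at *
  simp only [map_add, map_sub, map_smul, gauge_bil h hD, gauge_jacobian h hD, gauge_tri h hD,
    h₁, h₂, h₃, h₄, e2, LinearMap.add_apply, LinearMap.sub_apply, LinearMap.smul_apply,
    jacobian_add_mid, h.jacobian_self, h.symm w₁ w₀ w₀, map_neg, LinearMap.neg_apply] at e1 ⊢
  linear_combination (norm := module) e1

end FifthForm

/-! ### Commuting flows of a Jordan triple system -/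

section JordanFlows

variable {K V : Type*} [Field K] [AddCommGroup V] [Module K V]
  {f : V →ₗ[K] V →ₗ[K] V →ₗ[K] V}

/-- The identities of a Jordan triple system, for a curried triple product. -/
structure JordanTriple (f : V →ₗ[K] V →ₗ[K] V →ₗ[K] V) : Prop where
  symm : ∀ x y z, f x y z = f z y x
  jordan : ∀ x y z u v, f x y (f u v z) - f (f x y u) v z - f u v (f x y z)
    + f u (f y x v) z = 0

/-- Derivations of a triple product. -/
def IsTripleDer (f : V →ₗ[K] V →ₗ[K] V →ₗ[K] V) (D : V →ₗ[K] V) : Prop :=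
  ∀ x y z, D (f x y z) = f (D x) y z + f x (D y) z + f x y (D z)

/-- The terms of degree five in the commutator of the third- and fifth-order flows with cubic
nonlinearities. -/
def quinticObstruction (f : V →ₗ[K] V →ₗ[K] V →ₗ[K] V) (w₀ w₁ w₂ w₃ : V) : V :=
    (60 : K) • f w₀ w₀ (f w₀ w₁ w₃) + (60 : K) • f w₀ w₀ (f w₀ w₂ w₂)
      + (60 : K) • f w₀ w₀ (f w₁ w₀ w₃) + (240 : K) • f w₀ w₀ (f w₁ w₁ w₂)
      + (60 : K) • f w₀ w₀ (f w₁ w₂ w₁) + (60 : K) • f w₀ w₀ (f w₂ w₀ w₂)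
      + (60 : K) • f w₀ w₁ (f w₀ w₀ w₃) + (120 : K) • f w₀ w₁ (f w₀ w₁ w₂)
      + (60 : K) • f w₀ w₁ (f w₀ w₂ w₁) + (180 : K) • f w₀ w₁ (f w₁ w₀ w₂)
      + (120 : K) • f w₀ w₁ (f w₁ w₁ w₁) + (60 : K) • f w₀ w₂ (f w₀ w₀ w₂)
      + (60 : K) • f w₀ w₂ (f w₀ w₁ w₁) + (60 : K) • f w₀ w₂ (f w₁ w₀ w₁)
      + (60 : K) • f w₀ (f w₀ w₀ w₁) w₃ + (60 : K) • f w₀ (f w₀ w₀ w₂) w₂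
      + (60 : K) • f w₀ (f w₀ w₁ w₁) w₂ + (60 : K) • f w₀ (f w₀ w₁ w₂) w₁
      + (60 : K) • f w₀ (f w₁ w₀ w₁) w₂ + (60 : K) • f w₀ (f w₁ w₀ w₂) w₁
      + (60 : K) • f w₀ (f w₁ w₁ w₁) w₁ + (60 : K) • f w₁ w₀ (f w₀ w₀ w₃)
      + (180 : K) • f w₁ w₀ (f w₀ w₁ w₂) + (60 : K) • f w₁ w₀ (f w₀ w₂ w₁)
      + (240 : K) • f w₁ w₀ (f w₁ w₀ w₂) + (180 : K) • f w₁ w₀ (f w₁ w₁ w₁)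
      + (120 : K) • f w₁ w₁ (f w₀ w₀ w₂) + (120 : K) • f w₁ w₁ (f w₀ w₁ w₁)
      + (120 : K) • f w₁ w₁ (f w₁ w₀ w₁) + (60 : K) • f w₁ w₂ (f w₀ w₀ w₁)
      + (120 : K) • f w₁ (f w₀ w₀ w₁) w₂ + (60 : K) • f w₁ (f w₀ w₀ w₂) w₁
      + (60 : K) • f w₁ (f w₀ w₁ w₁) w₁ + (60 : K) • f w₁ (f w₁ w₀ w₁) w₁
      + (120 : K) • f w₂ w₀ (f w₀ w₀ w₂) + (120 : K) • f w₂ w₀ (f w₀ w₁ w₁)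
      + (120 : K) • f w₂ w₀ (f w₁ w₀ w₁) + (60 : K) • f w₂ w₁ (f w₀ w₀ w₁)
      + (60 : K) • f w₃ w₀ (f w₀ w₀ w₁)

/-- The values of a trilinear map, as an opaque function; the normalisation of large linear
combinations is much faster for such functions than for linear maps. -/
lemma exists_function_eq (f : V →ₗ[K] V →ₗ[K] V →ₗ[K] V) :
    ∃ g : V → V → V → V, ∀ x y z, f x y z = g x y z := ⟨_, fun _ _ _ => rfl⟩

lemma exists_function_eq₂ (a : V →ₗ[K] V →ₗ[K] V) :
    ∃ g : V → V → V, ∀ x y, a x y = g x y := ⟨_, fun _ _ => rfl⟩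

lemma iterate_succ_of_eq {V : Type*} {D : V → V} {k : ℕ} {x y z : V} (h : D^[k] x = y)
    (h' : D y = z) : D^[k + 1] x = z := by
  rw [Function.iterate_succ_apply', h, h']

lemma iterate_jet {V : Type*} {D : V → V} {w : ℕ → V} (hDw : ∀ k, D (w k) = w (k + 1))
    (k l : ℕ) : D^[k] (w l) = w (l + k) := by
  induction k with
  | zero => rfl
  | succ k ih => rw [Function.iterate_succ_apply', ih, hDw, Nat.add_assoc]

lemma jordanDefect_eq_zero [CharZero K] (h : JordanTriple f) (w₀ w₁ : V) :
    jordanDefect f w₀ w₁ = 0 := by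
  have e1 := h.jordan w₀ w₁ w₀ w₀ w₀
  have e2 := h.jordan w₀ w₀ w₀ w₀ w₁
  have e3 := h.jordan w₀ w₀ w₁ w₀ w₀
  rw [jordanDefect]
  simp only [h.symm] at e1 e2 e3 ⊢
  linear_combination (norm := module) -(14 / 3 : K) • e1 - (10 / 3 : K) • e2 - (6 : K) • e3

set_option maxHeartbeats 2000000 in
/-- The quintic correction `20 f(U,U,f(U,U,U₁)) + 10 f(U,f(U,U,U),U₁)` of the fifth-order flow
compensates the obstruction when `f` is a Jordan triple system. -/
lemma quinticObstruction_add_eq_zero (h : JordanTriple f) (w₀ w₁ w₂ w₃ : V) :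
    quinticObstruction f w₀ w₁ w₂ w₃
      + (-(60 : K) • f w₀ w₀ (f w₀ w₁ w₃) - (60 : K) • f w₀ w₀ (f w₀ w₂ w₂)
      - (60 : K) • f w₀ w₀ (f w₁ w₀ w₃) - (180 : K) • f w₀ w₀ (f w₁ w₁ w₂)
      - (60 : K) • f w₀ w₀ (f w₁ w₂ w₁) - (60 : K) • f w₀ w₀ (f w₂ w₀ w₂)
      - (60 : K) • f w₀ w₁ (f w₀ w₀ w₃) - (120 : K) • f w₀ w₁ (f w₀ w₁ w₂)
      - (60 : K) • f w₀ w₁ (f w₀ w₂ w₁) - (180 : K) • f w₀ w₁ (f w₁ w₀ w₂)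
      - (120 : K) • f w₀ w₁ (f w₁ w₁ w₁) - (60 : K) • f w₀ w₂ (f w₀ w₀ w₂)
      - (60 : K) • f w₀ w₂ (f w₀ w₁ w₁) - (60 : K) • f w₀ w₂ (f w₁ w₀ w₁)
      - (60 : K) • f w₀ (f w₀ w₀ w₁) w₃ - (60 : K) • f w₀ (f w₀ w₀ w₂) w₂
      - (30 : K) • f w₀ (f w₀ w₁ w₀) w₃ - (120 : K) • f w₀ (f w₀ w₁ w₁) w₂
      - (60 : K) • f w₀ (f w₀ w₁ w₂) w₁ - (30 : K) • f w₀ (f w₀ w₂ w₀) w₂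
      - (60 : K) • f w₀ (f w₀ w₂ w₁) w₁ - (60 : K) • f w₀ (f w₁ w₀ w₁) w₂
      - (60 : K) • f w₀ (f w₁ w₀ w₂) w₁ - (60 : K) • f w₀ (f w₁ w₁ w₁) w₁
      - (60 : K) • f w₁ w₀ (f w₀ w₀ w₃) - (120 : K) • f w₁ w₀ (f w₀ w₁ w₂)
      - (60 : K) • f w₁ w₀ (f w₀ w₂ w₁) - (180 : K) • f w₁ w₀ (f w₁ w₀ w₂)
      - (120 : K) • f w₁ w₀ (f w₁ w₁ w₁) - (120 : K) • f w₁ w₁ (f w₀ w₀ w₂)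
      - (120 : K) • f w₁ w₁ (f w₀ w₁ w₁) - (120 : K) • f w₁ w₁ (f w₁ w₀ w₁)
      - (60 : K) • f w₁ w₂ (f w₀ w₀ w₁) - (30 : K) • f w₁ (f w₀ w₀ w₀) w₃
      - (180 : K) • f w₁ (f w₀ w₀ w₁) w₂ - (60 : K) • f w₁ (f w₀ w₀ w₂) w₁
      - (90 : K) • f w₁ (f w₀ w₁ w₀) w₂ - (120 : K) • f w₁ (f w₀ w₁ w₁) w₁
      - (30 : K) • f w₁ (f w₀ w₂ w₀) w₁ - (60 : K) • f w₁ (f w₁ w₀ w₁) w₁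
      - (60 : K) • f w₂ w₀ (f w₀ w₀ w₂) - (60 : K) • f w₂ w₀ (f w₀ w₁ w₁)
      - (60 : K) • f w₂ w₀ (f w₁ w₀ w₁) - (60 : K) • f w₂ w₁ (f w₀ w₀ w₁)
      - (30 : K) • f w₂ (f w₀ w₀ w₀) w₂) = 0 := by
  rw [quinticObstruction]
  have e1 := h.jordan w₁ w₁ w₂ w₀ w₀
  have e2 := h.jordan w₀ w₀ w₃ w₁ w₀
  have e3 := h.jordan w₁ w₀ w₃ w₀ w₀
  have e4 := h.jordan w₂ w₀ w₂ w₀ w₀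
  have e5 := h.jordan w₀ w₀ w₂ w₂ w₀
  have e6 := h.jordan w₀ w₁ w₂ w₁ w₀
  have e7 := h.jordan w₂ w₀ w₁ w₀ w₁
  have e8 := h.jordan w₂ w₀ w₁ w₁ w₀
  have e9 := h.jordan w₁ w₀ w₁ w₁ w₁
  have e10 := h.jordan w₁ w₁ w₁ w₁ w₀
  have e11 := h.jordan w₁ w₀ w₂ w₁ w₀
  obtain ⟨g, hg⟩ := exists_function_eq f
  have hs : ∀ x y z, g x y z = g z y x := fun x y z => by rw [← hg, ← hg, h.symm]
  simp only [hg] at e1 e2 e3 e4 e5 e6 e7 e8 e9 e10 e11 ⊢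
  simp only [hs] at e1 e2 e3 e4 e5 e6 e7 e8 e9 e10 e11 ⊢
  linear_combination (norm := module)
       -(60 : K) • e1 - (30 : K) • e2 - (30 : K) • e3 - (30 : K) • e4 - (30 : K) • e5
        - (60 : K) • e6 - (60 : K) • e7 - (30 : K) • e8 - (20 : K) • e9 - (40 : K) • e10
        - (90 : K) • e11

set_option maxHeartbeats 2000000 in
/-- The terms of degree seven in the commutator of the flows vanish. -/
lemma septic_eq_zero (h : JordanTriple f) (w₀ w₁ w₂ : V) :
    -(120 : K) • f w₀ w₀ (f w₀ w₁ (f w₀ w₀ w₁)) - (60 : K) • f w₀ w₀ (f w₀ (f w₀ w₀ w₀) w₂)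
      - (60 : K) • f w₀ w₀ (f w₀ (f w₀ w₁ w₀) w₁) - (60 : K) • f w₀ w₀ (f w₁ (f w₀ w₀ w₀) w₁)
      + (60 : K) • f w₀ (f w₀ w₀ w₀) (f w₀ w₀ w₂) + (60 : K) • f w₀ (f w₀ w₀ w₀) (f w₀ w₁ w₁)
      + (60 : K) • f w₀ (f w₀ w₀ w₀) (f w₁ w₀ w₁) + (120 : K) • f w₀ (f w₀ w₀ w₁) (f w₀ w₀ w₁)
      - (60 : K) • f w₀ (f w₀ (f w₀ w₀ w₀) w₁) w₁ + (60 : K) • f w₀ (f w₀ (f w₀ w₀ w₁) w₀) w₁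
      - (120 : K) • f w₁ w₀ (f w₀ w₀ (f w₀ w₀ w₁)) - (60 : K) • f w₁ w₀ (f w₀ (f w₀ w₀ w₀) w₁)
      + (60 : K) • f w₁ (f w₀ w₀ w₀) (f w₀ w₀ w₁) + (120 : K) • f (f w₀ w₀ w₁) w₀ (f w₀ w₀ w₁)
      = 0 := by
  have e1 := h.jordan (f w₀ w₀ w₁) w₀ w₁ w₀ w₀
  have e2 := h.jordan w₁ (f w₀ w₀ w₀) w₁ w₀ w₀
  have e3 := h.jordan w₂ w₀ w₀ w₀ (f w₀ w₀ w₀)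
  have e4 := h.jordan w₂ (f w₀ w₀ w₀) w₀ w₀ w₀
  have e5 := h.jordan w₁ w₀ w₀ (f w₀ w₀ w₁) w₀
  have e6 := congrArg (fun t => f t w₁ w₀) (h.jordan w₀ w₀ w₁ w₀ w₀)
  have e7 := h.jordan w₀ w₁ w₁ w₀ (f w₀ w₀ w₀)
  have e8 := h.jordan w₁ w₀ w₁ (f w₀ w₀ w₀) w₀
  have e9 := congrArg (fun t => f w₁ t w₀) (h.jordan w₀ w₁ w₀ w₀ w₀)
  have e10 := congrArg (fun t => f w₁ t w₀) (h.jordan w₀ w₀ w₀ w₀ w₁)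
  have e11 := h.jordan w₀ (f w₀ w₁ w₀) w₀ w₀ w₁
  have e12 := h.jordan w₀ w₀ w₁ (f w₀ w₁ w₀) w₀
  have e13 := h.jordan w₁ w₀ w₀ (f w₀ w₁ w₀) w₀
  have e14 := congrArg (fun t => f t w₁ w₀) (h.jordan w₁ w₀ w₀ w₀ w₀)
  have e15 := congrArg (fun t => f w₁ t w₀) (h.jordan w₀ w₀ w₁ w₀ w₀)
  have e16 := h.jordan w₀ w₁ w₀ w₀ (f w₀ w₁ w₀)
  have e17 := h.jordan w₀ w₁ w₀ (f w₀ w₀ w₁) w₀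
  have e18 := h.jordan w₀ w₀ w₁ w₀ (f w₀ w₁ w₀)
  have e19 := h.jordan w₀ w₀ w₀ (f w₁ w₀ w₁) w₀
  have e20 := h.jordan w₀ w₀ w₂ (f w₀ w₀ w₀) w₀
  have e21 := h.jordan w₀ w₀ w₀ (f w₀ w₀ w₂) w₀
  have e22 := congrArg (fun t => f t w₀ w₂) (h.jordan w₀ w₀ w₀ w₀ w₀)
  have e23 := congrArg (fun t => f t w₀ w₀) (h.jordan w₀ w₀ w₂ w₀ w₀)
  simp only [map_add, map_sub, map_zero, LinearMap.add_apply, LinearMap.sub_apply,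
    LinearMap.zero_apply] at e6 e9 e10 e14 e15 e22 e23
  obtain ⟨g, hg⟩ := exists_function_eq f
  have hs : ∀ x y z, g x y z = g z y x := fun x y z => by rw [← hg, ← hg, h.symm]
  simp only [hg] at e1 e2 e3 e4 e5 e6 e7 e8 e9 e10 e11 e12
  simp only [hg] at e13 e14 e15 e16 e17 e18 e19 e20 e21 e22 e23 ⊢
  simp only [hs] at e1 e2 e3 e4 e5 e6 e7 e8 e9 e10 e11 e12
  simp only [hs] at e13 e14 e15 e16 e17 e18 e19 e20 e21 e22 e23 ⊢
  linear_combination (norm := module)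
      (60 : K) • e1 + (60 : K) • e2 - (20 : K) • e3 + (20 : K) • e4 - (60 : K) • e5
        + (60 : K) • e6 - (60 : K) • e7 - (60 : K) • e8 - (20 : K) • e9 + (20 : K) • e10
        + (20 : K) • e11 - (60 : K) • e12 - (60 : K) • e13 + (60 : K) • e14 - (60 : K) • e15
        - (20 : K) • e16 + (120 : K) • e17 - (60 : K) • e18 + (60 : K) • e19 - (20 : K) • e20
        + (20 : K) • e21 + (20 : K) • e22 - (20 : K) • e23

/-- The fifth-order flow without its quintic terms. -/
def fifthCubic (f : V →ₗ[K] V →ₗ[K] V →ₗ[K] V) (w₀ w₁ w₂ w₃ w₅ : V) : V :=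
  w₅ + (10 : K) • f w₀ w₀ w₃ + (10 : K) • f w₀ w₁ w₂ + (10 : K) • f w₀ w₂ w₁
    + (20 : K) • f w₁ w₀ w₂ + (10 : K) • f w₁ w₁ w₁

/-- The quintic terms of the fifth-order flow. -/
def quinticTerm (f : V →ₗ[K] V →ₗ[K] V →ₗ[K] V) (w₀ w₁ : V) : V :=
  (20 : K) • f w₀ w₀ (f w₀ w₀ w₁) + (10 : K) • f w₀ (f w₀ w₀ w₀) w₁

lemma fifthFlow_eq (w₀ w₁ w₂ w₃ w₅ : V) :
    fifthFlow f w₀ w₁ w₂ w₃ w₅ = fifthCubic f w₀ w₁ w₂ w₃ w₅ + quinticTerm f w₀ w₁ := by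
  rw [fifthFlow, fifthCubic, quinticTerm]
  module

set_option maxHeartbeats 2000000 in
/-- The commutator of the flows `T` and `S` on `w 0`, when both are derivations of the triple
product, `T` commutes with `N`, and `S` commutes with `N` up to the errors `ρ k`. The vector `q`
collects the terms by which `S` deviates from its cubic part. -/
lemma flow_commutator (hs : ∀ x y z, f x y z = f z y x) {N T S : V →ₗ[K] V}
    (hN : IsTripleDer f N) (hT : IsTripleDer f T) (hS : IsTripleDer f S) {w ρ : ℕ → V} {q : V}
    (hw : ∀ k, N (w k) = w (k + 1)) (hT₀ : T (w 0) = w 3 + (6 : K) • f (w 0) (w 0) (w 1))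
    (hT₁ : ∀ k, T (w (k + 1)) = N (T (w k)))
    (hS₀ : S (w 0) = fifthCubic f (w 0) (w 1) (w 2) (w 3) (w 5) + q)
    (hS₁ : ∀ k, S (w (k + 1)) = N (S (w k)) + ρ k) :
    T (S (w 0)) - S (T (w 0)) = quinticObstruction f (w 0) (w 1) (w 2) (w 3)
      + (T q - N (N (N q))) - (N (N (ρ 0)) + N (ρ 1) + ρ 2)
      - (6 : K) • (f q (w 0) (w 1) + f (w 0) q (w 1) + f (w 0) (w 0) (N q + ρ 0)) := by
  set p := f (w 0) (w 0) (w 1) with hp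
  set c := (10 : K) • f (w 0) (w 0) (w 3) + (10 : K) • f (w 0) (w 1) (w 2)
    + (10 : K) • f (w 0) (w 2) (w 1) + (20 : K) • f (w 1) (w 0) (w 2)
    + (10 : K) • f (w 1) (w 1) (w 1) with hc
  have p1 : N^[1] p =
      f (w 0) (w 0) (w 2) + f (w 0) (w 1) (w 1) + f (w 1) (w 0) (w 1) := by
    rw [Function.iterate_one]
    simp only [hp, hN _ _ _, hw, Nat.reduceAdd]
    module
  have p2 : N^[2] p =
      f (w 0) (w 0) (w 3) + (2 : K) • f (w 0) (w 1) (w 2) + f (w 0) (w 2) (w 1)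
        + (3 : K) • f (w 1) (w 0) (w 2) + (2 : K) • f (w 1) (w 1) (w 1) := by
    refine iterate_succ_of_eq p1 ?_
    simp only [map_add, hN _ _ _, hw, Nat.reduceAdd]
    simp only [hs]
    module
  have p3 : N^[3] p =
      f (w 0) (w 0) (w 4) + (3 : K) • f (w 0) (w 1) (w 3) + (3 : K) • f (w 0) (w 2) (w 2)
        + f (w 0) (w 3) (w 1) + (4 : K) • f (w 1) (w 0) (w 3) + (9 : K) • f (w 1) (w 1) (w 2)
        + (3 : K) • f (w 1) (w 2) (w 1) + (3 : K) • f (w 2) (w 0) (w 2) := by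
    refine iterate_succ_of_eq p2 ?_
    simp only [map_add, map_smul, hN _ _ _, hw, Nat.reduceAdd]
    simp only [hs]
    module
  have p4 : N^[4] p =
      f (w 0) (w 0) (w 5) + (4 : K) • f (w 0) (w 1) (w 4) + (6 : K) • f (w 0) (w 2) (w 3)
        + (4 : K) • f (w 0) (w 3) (w 2) + f (w 0) (w 4) (w 1) + (5 : K) • f (w 1) (w 0) (w 4)
        + (16 : K) • f (w 1) (w 1) (w 3) + (18 : K) • f (w 1) (w 2) (w 2)
        + (4 : K) • f (w 1) (w 3) (w 1) + (10 : K) • f (w 2) (w 0) (w 3)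
        + (12 : K) • f (w 2) (w 1) (w 2) := by
    refine iterate_succ_of_eq p3 ?_
    simp only [map_add, map_smul, hN _ _ _, hw, Nat.reduceAdd]
    simp only [hs]
    module
  have p5 : N^[5] p =
      f (w 0) (w 0) (w 6) + (5 : K) • f (w 0) (w 1) (w 5) + (10 : K) • f (w 0) (w 2) (w 4)
        + (10 : K) • f (w 0) (w 3) (w 3) + (5 : K) • f (w 0) (w 4) (w 2) + f (w 0) (w 5) (w 1)
        + (6 : K) • f (w 1) (w 0) (w 5) + (25 : K) • f (w 1) (w 1) (w 4)
        + (40 : K) • f (w 1) (w 2) (w 3) + (30 : K) • f (w 1) (w 3) (w 2)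
        + (5 : K) • f (w 1) (w 4) (w 1) + (15 : K) • f (w 2) (w 0) (w 4)
        + (50 : K) • f (w 2) (w 1) (w 3) + (30 : K) • f (w 2) (w 2) (w 2)
        + (10 : K) • f (w 3) (w 0) (w 3) := by
    refine iterate_succ_of_eq p4 ?_
    simp only [map_add, map_smul, hN _ _ _, hw, Nat.reduceAdd]
    simp only [hs]
    module
  have c1 : N^[1] c =
      (10 : K) • f (w 0) (w 0) (w 4) + (20 : K) • f (w 0) (w 1) (w 3)
        + (20 : K) • f (w 0) (w 2) (w 2) + (10 : K) • f (w 0) (w 3) (w 1)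
        + (30 : K) • f (w 1) (w 0) (w 3) + (50 : K) • f (w 1) (w 1) (w 2)
        + (20 : K) • f (w 1) (w 2) (w 1) + (20 : K) • f (w 2) (w 0) (w 2) := by
    rw [Function.iterate_one]
    simp only [hc, map_add, map_smul, hN _ _ _, hw, Nat.reduceAdd]
    simp only [hs]
    module
  have c2 : N^[2] c =
      (10 : K) • f (w 0) (w 0) (w 5) + (30 : K) • f (w 0) (w 1) (w 4)
        + (40 : K) • f (w 0) (w 2) (w 3) + (30 : K) • f (w 0) (w 3) (w 2)
        + (10 : K) • f (w 0) (w 4) (w 1) + (40 : K) • f (w 1) (w 0) (w 4)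
        + (100 : K) • f (w 1) (w 1) (w 3) + (110 : K) • f (w 1) (w 2) (w 2)
        + (30 : K) • f (w 1) (w 3) (w 1) + (70 : K) • f (w 2) (w 0) (w 3)
        + (70 : K) • f (w 2) (w 1) (w 2) := by
    refine iterate_succ_of_eq c1 ?_
    simp only [map_add, map_smul, hN _ _ _, hw, Nat.reduceAdd]
    simp only [hs]
    module
  have c3 : N^[3] c =
      (10 : K) • f (w 0) (w 0) (w 6) + (40 : K) • f (w 0) (w 1) (w 5)
        + (70 : K) • f (w 0) (w 2) (w 4) + (70 : K) • f (w 0) (w 3) (w 3)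
        + (40 : K) • f (w 0) (w 4) (w 2) + (10 : K) • f (w 0) (w 5) (w 1)
        + (50 : K) • f (w 1) (w 0) (w 5) + (170 : K) • f (w 1) (w 1) (w 4)
        + (250 : K) • f (w 1) (w 2) (w 3) + (200 : K) • f (w 1) (w 3) (w 2)
        + (40 : K) • f (w 1) (w 4) (w 1) + (110 : K) • f (w 2) (w 0) (w 4)
        + (310 : K) • f (w 2) (w 1) (w 3) + (180 : K) • f (w 2) (w 2) (w 2)
        + (70 : K) • f (w 3) (w 0) (w 3) := by
    refine iterate_succ_of_eq c2 ?_
    simp only [map_add, map_smul, hN _ _ _, hw, Nat.reduceAdd]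
    simp only [hs]
    module
  have t : ∀ k, T (w k) = w (k + 3) + (6 : K) • N^[k] p := fun k => by
    induction k with
    | zero => exact hT₀
    | succ k ih => rw [hT₁, ih, map_add, map_smul, hw, Function.iterate_succ_apply', add_right_comm]
  have s0 : S (w 0) = w 5 + c + q := by
    rw [hS₀, fifthCubic, hc]
    module
  have s1 : S (w 1) = w 6 + N^[1] c + (N q + ρ 0) := by
    rw [hS₁, s0, map_add, map_add, hw, Function.iterate_one, add_assoc]
  have s2 : S (w 2) = w 7 + N^[2] c + (N (N q) + N (ρ 0) + ρ 1) := by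
    rw [hS₁, s1, Function.iterate_succ_apply' N 1]
    simp only [map_add, hw, Nat.reduceAdd, add_assoc]
  have s3 : S (w 3) = w 8 + N^[3] c + (N (N (N q)) + N (N (ρ 0)) + N (ρ 1) + ρ 2) := by
    rw [hS₁, s2, Function.iterate_succ_apply' N 2]
    simp only [map_add, hw, Nat.reduceAdd, add_assoc]
  rw [hT₀, s0]
  simp only [hc, hp, map_add, map_smul, hT _ _ _, hS _ _ _]
  rw [s0, s1, s3, t 0, t 1, t 2, t 3, t 5, p1, p2, p3, p5, c1, c3, Function.iterate_zero_apply,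
    quinticObstruction]
  simp only [hc, hp, map_add, map_smul, LinearMap.add_apply, LinearMap.smul_apply, Nat.reduceAdd]
  obtain ⟨g, hg⟩ := exists_function_eq f
  have hs' : ∀ x y z, g x y z = g z y x := fun x y z => by rw [← hg, ← hg, hs]
  simp only [hg]
  simp only [hs']
  module

/-- Adding a left multiplication or a connection form to a derivation of the triple product yields a
derivation again. -/
lemma isTripleDer_gauge {a : V →ₗ[K] V →ₗ[K] V} (h : Compatible a f) {D : V →ₗ[K] V}
    (hD : IsTripleDer f D) (u : V) : IsTripleDer f (gauge a D u) := by
  intro x y z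
  simp only [gauge, LinearMap.add_apply, hD _ _ _, h.der, map_add]
  module

lemma isTripleDer_timeForm {a : V →ₗ[K] V →ₗ[K] V} (h : Compatible a f) {D : V →ₗ[K] V}
    (hD : IsTripleDer f D) (w₀ w₁ w₂ : V) : IsTripleDer f (D + timeForm a f w₀ w₁ w₂) := by
  intro x y z
  simp only [LinearMap.add_apply, hD _ _ _, timeForm_apply h, h.der, h.jacobian_der, map_add,
    map_sub, LinearMap.sub_apply]
  module

lemma isTripleDer_fifthForm {a : V →ₗ[K] V →ₗ[K] V} (h : Compatible a f) {D : V →ₗ[K] V}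
    (hD : IsTripleDer f D) (w₀ w₁ w₂ w₃ w₄ : V) :
    IsTripleDer f (D + fifthForm a f w₀ w₁ w₂ w₃ w₄) := by
  intro x y z
  simp only [LinearMap.add_apply, hD _ _ _, fifthForm_apply h]
  generalize fifthVector a f w₀ w₁ w₂ w₃ w₄ = n
  generalize f w₀ w₀ w₀ = p
  generalize f w₀ w₀ w₁ = q
  simp only [h.der, h.jacobian_der, map_add, map_smul, map_sub, LinearMap.sub_apply,
    LinearMap.add_apply, LinearMap.smul_apply]
  module

set_option maxHeartbeats 2000000 in
/-- For a Jordan triple system the third- and fifth-order flows commute on `w 0`. -/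
lemma flow_commute (h : JordanTriple f) {N T S : V →ₗ[K] V}
    (hN : IsTripleDer f N) (hT : IsTripleDer f T) (hS : IsTripleDer f S) {w : ℕ → V}
    (hw : ∀ k, N (w k) = w (k + 1)) (hT₀ : T (w 0) = w 3 + (6 : K) • f (w 0) (w 0) (w 1))
    (hT₁ : ∀ k, T (w (k + 1)) = N (T (w k)))
    (hS₀ : S (w 0) = fifthFlow f (w 0) (w 1) (w 2) (w 3) (w 5))
    (hS₁ : ∀ k, S (w (k + 1)) = N (S (w k))) :
    T (S (w 0)) = S (T (w 0)) := by
  have hq := flow_commutator h.symm hN hT hS hw hT₀ hT₁ (hS₀.trans (fifthFlow_eq ..)) (ρ := 0)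
    fun k => (hS₁ k).trans (add_zero _).symm
  have h5 := quinticObstruction_add_eq_zero h (w 0) (w 1) (w 2) (w 3)
  have h7 := septic_eq_zero h (w 0) (w 1) (w 2)
  have t1 : T (w 1) = w 4 + (6 : K) • N (f (w 0) (w 0) (w 1)) := by
    rw [hT₁, hT₀, map_add, map_smul, hw]
  rw [← sub_eq_zero, hq]
  simp only [quinticTerm, map_add, map_smul, hT _ _ _, hT₀, t1, Pi.zero_apply, map_zero]
  simp only [hN _ _ _, hw, map_add, map_smul, LinearMap.add_apply, LinearMap.smul_apply,
    Nat.reduceAdd]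
  obtain ⟨g, hg⟩ := exists_function_eq f
  have hs : ∀ x y z, g x y z = g z y x := fun x y z => by rw [← hg, ← hg, h.symm]
  simp only [hg] at h5 h7 ⊢
  simp only [hs] at h5 h7 ⊢
  linear_combination (norm := module) h5 + h7

end JordanFlows

/-! ### Operations of arity four and five -/

section CurryHigher

variable {K V : Type*} [Field K] [AddCommGroup V] [Module K V]

/-- A quaternary operation as a curried linear map. -/
def quad (C : Op K V 4) : V →ₗ[K] V →ₗ[K] V →ₗ[K] V →ₗ[K] V where
  toFun x := tri (C.curryLeft x)
  map_add' x x' := by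
    ext y z t
    simp
  map_smul' c x := by
    ext y z t
    simp

@[simp] lemma quad_apply (C : Op K V 4) (x y z t : V) : quad C x y z t = C ![x, y, z, t] := rfl

/-- A quinary operation as a curried linear map. -/
def quint (E : Op K V 5) : V →ₗ[K] V →ₗ[K] V →ₗ[K] V →ₗ[K] V →ₗ[K] V where
  toFun x := quad (E.curryLeft x)
  map_add' x x' := by
    ext y z t s
    simp
  map_smul' c x := by
    ext y z t s
    simp

@[simp] lemma quint_apply (E : Op K V 5) (x y z t s : V) :
    quint E x y z t s = E ![x, y, z, t, s] := rfl

end CurryHigher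

/-! ### The coefficients of the fifth-order symmetry -/

section Coefficients

variable {K V : Type*} [Field K] [AddCommGroup V] [Module K V]
  (a : V →ₗ[K] V →ₗ[K] V) (f : V →ₗ[K] V →ₗ[K] V →ₗ[K] V)

/-- The coefficient of `(U, U, U₃)` in the fifth-order symmetry. -/
def coeffB₂ : Op K V 3 :=
  MultilinearMap.mk' (fun v => (2 : K) • a (v 0) (a (v 1) (v 2)) + (2 : K) • f (v 0) (v 1) (v 2))
    (fun m i x y => by fin_cases i <;> simp <;> module)
    (fun m i c x => by fin_cases i <;> simp <;> module)

/-- The coefficient of `(U, U₁, U₂)` in the fifth-order symmetry. -/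
def coeffB₃ : Op K V 3 :=
  MultilinearMap.mk' (fun v => a (v 1) (a (v 0) (v 2)) + a (v 0) (a (v 1) (v 2))
      + (2 : K) • f (v 0) (v 1) (v 2) + (2 : K) • f (v 0) (v 2) (v 1)
      + (4 : K) • f (v 1) (v 0) (v 2))
    (fun m i x y => by fin_cases i <;> simp <;> module)
    (fun m i c x => by fin_cases i <;> simp <;> module)

/-- The coefficient of `(U₁, U₁, U₁)` in the fifth-order symmetry. -/
def coeffB₄ : Op K V 3 :=
  MultilinearMap.mk' (fun v => (2 : K) • f (v 0) (v 1) (v 2))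
    (fun m i x y => by fin_cases i <;> simp)
    (fun m i c x => by fin_cases i <;> simp <;> module)

/-- The coefficient of `(U, U, U, U₂)` in the fifth-order symmetry. -/
def coeffC₁ : Op K V 4 :=
  MultilinearMap.mk' (fun v => (9 / 5 : K) • a (v 0) (a (v 1) (a (v 2) (v 3)))
      + (4 : K) • f (v 0) (v 1) (a (v 2) (v 3)) + (8 / 5 : K) • a (v 0) (f (v 1) (v 2) (v 3))
      + (2 / 5 : K) • a (v 0) (f (v 1) (v 3) (v 2)))
    (fun m i x y => by fin_cases i <;> simp <;> module)
    (fun m i c x => by fin_cases i <;> simp <;> module)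

/-- The coefficient of `(U, U₁, U₁, U)` in the fifth-order symmetry. -/
def coeffC₂ : Op K V 4 :=
  MultilinearMap.mk' (fun v => (2 / 5 : K) • a (v 1) (a (v 0) (a (v 3) (v 2)))
      + (1 / 5 : K) • a (v 0) (a (v 1) (a (v 3) (v 2)))
      + (2 : K) • f (v 0) (v 1) (a (v 3) (v 2)) + (2 : K) • f (v 0) (a (v 3) (v 1)) (v 2)
      + (4 : K) • f (v 1) (v 0) (a (v 3) (v 2)) + (4 / 5 : K) • a (v 0) (f (v 3) (v 1) (v 2))
      + (6 / 5 : K) • a (v 0) (f (v 1) (v 3) (v 2)))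
    (fun m i x y => by fin_cases i <;> simp <;> module)
    (fun m i c x => by fin_cases i <;> simp <;> module)

/-- The coefficient of `(U, U, U, U, U₁)` in the fifth-order symmetry, without the terms that are
quadratic in the triple product. -/
def coeffD₁ : Op K V 5 :=
  MultilinearMap.mk' (fun v => a (v 0) (a (v 1) (a (v 2) (a (v 3) (v 4))))
      + (2 : K) • f (v 0) (v 1) (a (v 2) (a (v 3) (v 4)))
      + (8 / 5 : K) • a (v 0) (f (v 1) (v 2) (a (v 3) (v 4)))
      + (2 / 5 : K) • a (v 0) (f (v 1) (a (v 2) (v 4)) (v 3))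
      + (16 / 5 : K) • a (v 0) (a (v 1) (f (v 2) (v 3) (v 4)))
      + (2 / 5 : K) • a (a (v 0) (v 4)) (f (v 1) (v 2) (v 3)))
    (fun m i x y => by fin_cases i <;> simp <;> module)
    (fun m i c x => by fin_cases i <;> simp <;> module)

/-- The part of the coefficient of `(U, U, U, U, U₁)` that is quadratic in the triple product. -/
def quinticOp : Op K V 5 :=
  MultilinearMap.mk' (fun v => (20 : K) • f (v 0) (v 1) (f (v 2) (v 3) (v 4))
      + (10 : K) • f (v 0) (f (v 1) (v 2) (v 3)) (v 4))
    (fun m i x y => by fin_cases i <;> simp <;> module)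
    (fun m i c x => by fin_cases i <;> simp <;> module)

end Coefficients

/-! ### The covariant systems in terms of ordinary jets -/

section Expansion

variable {K V : Type*} [Field K] [CharZero K] [AddCommGroup V] [Module K V]
  {a : V →ₗ[K] V →ₗ[K] V} {f : V →ₗ[K] V →ₗ[K] V →ₗ[K] V}

/-- The covariant jets `∇^k U`. -/
def covJet (a : V →ₗ[K] V →ₗ[K] V) (D : V →ₗ[K] V) (u : V) (k : ℕ) : V :=
  (gauge a D u)^[k] u

omit [CharZero K] in
lemma gauge_covJet (D : V →ₗ[K] V) (u : V) (k : ℕ) :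
    gauge a D u (covJet a D u k) = covJet a D u (k + 1) :=
  (Function.iterate_succ_apply' _ _ _).symm

variable (h : Compatible a f) {D : V →ₗ[K] V} (hD : IsDer a f D) {u : ℕ → V}
  (hu : ∀ k, D (u k) = u (k + 1))

include h hu

lemma covJet_one : covJet a D (u 0) 1 = u 1 := by
  rw [← gauge_covJet, gauge, LinearMap.add_apply, covJet, Function.iterate_zero_apply, hu,
    h.self, add_zero]

lemma covJet_two : covJet a D (u 0) 2 = u 2 + a (u 0) (u 1) := by
  rw [← gauge_covJet, covJet_one h hu, gauge, LinearMap.add_apply, hu]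

include hD

lemma covJet_three : covJet a D (u 0) 3
    = u 3 + (2 : K) • a (u 0) (u 2) + a (u 0) (a (u 0) (u 1)) := by
  rw [← gauge_covJet, covJet_two h hu, gauge, LinearMap.add_apply, map_add, map_add, hu,
    hD.bil, hu, hu, h.self]
  module

lemma covJet_four : covJet a D (u 0) 4 = u 4 + (3 : K) • a (u 0) (u 3) + (2 : K) • a (u 1) (u 2)
    + a (u 1) (a (u 0) (u 1)) + (3 : K) • a (u 0) (a (u 0) (u 2))
    + a (u 0) (a (u 0) (a (u 0) (u 1))) := by
  rw [← gauge_covJet, covJet_three h hD hu, gauge, LinearMap.add_apply]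
  simp only [map_add, map_smul, hD.bil, hu, h.self, Nat.reduceAdd, map_zero]
  module

lemma covJet_five : covJet a D (u 0) 5 = u 5 + (4 : K) • a (u 0) (u 4) + (5 : K) • a (u 1) (u 3)
    + a (u 2) (a (u 0) (u 1)) + (4 : K) • a (u 1) (a (u 0) (u 2))
    + (5 : K) • a (u 0) (a (u 1) (u 2)) + (6 : K) • a (u 0) (a (u 0) (u 3))
    + a (a (u 0) (u 1)) (a (u 0) (u 1))
    + a (u 1) (a (u 0) (a (u 0) (u 1))) + (2 : K) • a (u 0) (a (u 1) (a (u 0) (u 1)))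
    + (4 : K) • a (u 0) (a (u 0) (a (u 0) (u 2)))
    + a (u 0) (a (u 0) (a (u 0) (a (u 0) (u 1)))) := by
  rw [← gauge_covJet, covJet_four h hD hu, gauge, LinearMap.add_apply]
  simp only [map_add, map_smul, hD.bil, hu, h.self, Nat.reduceAdd, map_zero]
  module

/-- The third-order flow in terms of the ordinary jets. -/
lemma third_expand : covJet a D (u 0) 3 + (6 : K) • f (u 0) (u 0) (u 1)
      - timeForm a f (u 0) (u 1) (covJet a D (u 0) 2) (u 0)
    = u 3 + (3 : K) • a (u 0) (u 2) + (6 : K) • f (u 0) (u 0) (u 1)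
      + (3 : K) • a (u 0) (a (u 0) (u 1)) := by
  rw [timeForm_apply h, covJet_three h hD hu, covJet_two h hu, jacobian_cycle, jacobian_cycle,
    h.jacobian_self, h.skew _ (u 0)]
  simp only [map_add, map_smul, mul_cube h]
  module

/-- The fifth-order flow in terms of the ordinary jets. -/
lemma fifth_expand : fifthCubic f (u 0) (u 1) (covJet a D (u 0) 2) (covJet a D (u 0) 3)
        (covJet a D (u 0) 5)
      - fifthForm a f (u 0) (u 1) (covJet a D (u 0) 2) (covJet a D (u 0) 3)
        (covJet a D (u 0) 4) (u 0)
    = u 5 + (5 : K) • a (u 0) (u 4) + (5 : K) • a (u 1) (u 3)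
      + (5 : K) • coeffB₂ a f ![u 0, u 0, u 3] + (5 : K) • coeffB₃ a f ![u 0, u 1, u 2]
      + (5 : K) • coeffB₄ f ![u 1, u 1, u 1] + (5 : K) • coeffC₁ a f ![u 0, u 0, u 0, u 2]
      + (5 : K) • coeffC₂ a f ![u 0, u 1, u 1, u 0]
      + (5 : K) • coeffD₁ a f ![u 0, u 0, u 0, u 0, u 1] := by
  rw [covJet_five h hD hu, covJet_four h hD hu, covJet_three h hD hu, covJet_two h hu]
  generalize u 0 = x, u 1 = y, u 2 = z, u 3 = t, u 4 = r, u 5 = s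
  change _ = s + (5 : K) • a x r + (5 : K) • a y t
      + (5 : K) • ((2 : K) • a x (a x t) + (2 : K) • f x x t)
      + (5 : K) • (a y (a x z) + a x (a y z) + (2 : K) • f x y z + (2 : K) • f x z y
        + (4 : K) • f y x z)
      + (5 : K) • ((2 : K) • f y y y)
      + (5 : K) • ((9 / 5 : K) • a x (a x (a x z)) + (4 : K) • f x x (a x z)
        + (8 / 5 : K) • a x (f x x z) + (2 / 5 : K) • a x (f x z x))
      + (5 : K) • ((2 / 5 : K) • a y (a x (a x y)) + (1 / 5 : K) • a x (a y (a x y))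
        + (2 : K) • f x y (a x y) + (2 : K) • f x (a x y) y + (4 : K) • f y x (a x y)
        + (4 / 5 : K) • a x (f x y y) + (6 / 5 : K) • a x (f y x y))
      + (5 : K) • (a x (a x (a x (a x y))) + (2 : K) • f x x (a x (a x y))
        + (8 / 5 : K) • a x (f x x (a x y)) + (2 / 5 : K) • a x (f x (a x y) x)
        + (16 / 5 : K) • a x (a x (f x x y)) + (2 / 5 : K) • a (a x y) (f x x x))
  have e1 : a x (f x x (f x x x)) = 0 := by
    rw [h.der, h.der, h.self]
    simp
  have s1 : ∀ p q, a (a p q) x = - a x (a p q) := fun p q => h.skew _ _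
  have s6 : ∀ p q r, a (f p q r) x = - a x (f p q r) := fun p q r => h.skew _ _
  have s8 : a z x = - a x z := h.skew _ _
  have s9 : a t x = - a x t := h.skew _ _
  have s10 : a r x = - a x r := h.skew _ _
  have s2 : a (f x x x) (a x y) = - a (a x y) (f x x x) := h.skew _ _
  rw [fifthForm_apply h]
  simp only [fifthVector, fifthCubic, jacobian, map_add, map_sub, map_neg, map_smul,
    LinearMap.add_apply, LinearMap.sub_apply, LinearMap.smul_apply, s1,
    s2, s6, s8, s9, s10, mul_cube h, e1, h.self, map_zero]
  module

end Expansion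

section Transfer

variable {K V ι : Type*} [Field K] [CharZero K] [AddCommGroup V] [Module K V] [Fintype ι]
  (b : Module.Basis ι K V) (A : Op K V 2) (F : Op K V 3)

/-! ### Transfer of identities to differential polynomials -/

variable {A F}

lemma compatible_ext (h : Compatible (bil A) (tri F)) :
    Compatible (bil (extOp b A)) (tri (extOp b F)) where
  skew x y := ext_evalAt b fun p => by
    rw [map_neg, evalAt_bil, evalAt_bil, h.skew]
  symm x y z := ext_evalAt b fun p => by
    rw [evalAt_tri, evalAt_tri, h.symm]
  der x y z u := ext_evalAt b fun p => by
    simp only [map_add, evalAt_bil, evalAt_tri, h.der]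
  third x y z u := ext_evalAt b fun p => by
    have := h.third (evalAt b p x) (evalAt b p y) (evalAt b p z) (evalAt b p u)
    simpa only [jacobian, map_add, map_sub, map_smul, map_zero, evalAt_bil, evalAt_tri] using this

lemma jordanTriple_ext (h : JordanTriple (tri F)) : JordanTriple (tri (extOp b F)) where
  symm x y z := ext_evalAt b fun p => by
    rw [evalAt_tri, evalAt_tri, h.symm]
  jordan x y z u v := ext_evalAt b fun p => by
    have := h.jordan (evalAt b p x) (evalAt b p y) (evalAt b p z) (evalAt b p u) (evalAt b p v)
    simpa only [map_add, map_sub, map_zero, evalAt_tri] using this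

variable (A F)

lemma isDer_vec (δ : Derivation K (DiffPoly K ι) (DiffPoly K ι)) :
    IsDer (bil (extOp b A)) (tri (extOp b F)) (vec δ) where
  bil := vec_bil b δ A
  tri := vec_tri b δ F

lemma isTripleDer_vec (δ : Derivation K (DiffPoly K ι) (DiffPoly K ι)) :
    IsTripleDer (tri (extOp b F)) (vec δ) := vec_tri b δ F

/-! ### Terms of the ansatz -/

lemma term_two (i j : ℕ) :
    term b A ![i, j] = bil (extOp b A) (jet K ι i) (jet K ι j) := by
  rw [term_eq_extOp, bil_apply]
  congr 1
  funext s
  fin_cases s <;> rfl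

lemma term_three (i j k : ℕ) :
    term b F ![i, j, k] = extOp b F ![jet K ι i, jet K ι j, jet K ι k] := by
  rw [term_eq_extOp]
  congr 1
  funext s
  fin_cases s <;> rfl

lemma term_four (C : Op K V 4) (i j k l : ℕ) :
    term b C ![i, j, k, l] = extOp b C ![jet K ι i, jet K ι j, jet K ι k, jet K ι l] := by
  rw [term_eq_extOp]
  congr 1
  funext s
  fin_cases s <;> rfl

lemma term_five (E : Op K V 5) (i j k l m : ℕ) : term b E ![i, j, k, l, m]
      = extOp b E ![jet K ι i, jet K ι j, jet K ι k, jet K ι l, jet K ι m] := by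
  rw [term_eq_extOp]
  congr 1
  funext s
  fin_cases s <;> rfl

lemma extOp_coeffB₂ : extOp b (coeffB₂ (bil A) (tri F))
    = coeffB₂ (bil (extOp b A)) (tri (extOp b F)) :=
  MultilinearMap.ext fun w => ext_evalAt b fun p => by
    rw [evalAt_extOp]
    simp only [coeffB₂, MultilinearMap.mk'_apply, map_add, map_smul, evalAt_bil, evalAt_tri]

lemma extOp_coeffB₃ : extOp b (coeffB₃ (bil A) (tri F))
    = coeffB₃ (bil (extOp b A)) (tri (extOp b F)) :=
  MultilinearMap.ext fun w => ext_evalAt b fun p => by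
    rw [evalAt_extOp]
    simp only [coeffB₃, MultilinearMap.mk'_apply, map_add, map_smul, evalAt_bil, evalAt_tri]

lemma extOp_coeffB₄ : extOp b (coeffB₄ (tri F)) = coeffB₄ (tri (extOp b F)) :=
  MultilinearMap.ext fun w => ext_evalAt b fun p => by
    rw [evalAt_extOp]
    simp only [coeffB₄, MultilinearMap.mk'_apply, map_smul, evalAt_tri]

lemma extOp_coeffC₁ : extOp b (coeffC₁ (bil A) (tri F))
    = coeffC₁ (bil (extOp b A)) (tri (extOp b F)) :=
  MultilinearMap.ext fun w => ext_evalAt b fun p => by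
    rw [evalAt_extOp]
    simp only [coeffC₁, MultilinearMap.mk'_apply, map_add, map_smul, evalAt_bil, evalAt_tri]

lemma extOp_coeffC₂ : extOp b (coeffC₂ (bil A) (tri F))
    = coeffC₂ (bil (extOp b A)) (tri (extOp b F)) :=
  MultilinearMap.ext fun w => ext_evalAt b fun p => by
    rw [evalAt_extOp]
    simp only [coeffC₂, MultilinearMap.mk'_apply, map_add, map_smul, evalAt_bil, evalAt_tri]

lemma extOp_coeffD₁ : extOp b (coeffD₁ (bil A) (tri F))
    = coeffD₁ (bil (extOp b A)) (tri (extOp b F)) :=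
  MultilinearMap.ext fun w => ext_evalAt b fun p => by
    rw [evalAt_extOp]
    simp only [coeffD₁, MultilinearMap.mk'_apply, map_add, map_smul, evalAt_bil, evalAt_tri]

lemma extOp_quinticOp : extOp b (quinticOp (tri F)) = quinticOp (tri (extOp b F)) :=
  MultilinearMap.ext fun w => ext_evalAt b fun p => by
    rw [evalAt_extOp]
    simp only [quinticOp, MultilinearMap.mk'_apply, map_add, map_smul, evalAt_tri]

omit [CharZero K] in
lemma fifthRHS_eq (A₂ A₃ A₄ : Op K V 2) (B₂ B₃ B₄ : Op K V 3) (C₁ C₂ : Op K V 4)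
    (D₁ : Op K V 5) : fifthRHS b A₂ A₃ A₄ B₂ B₃ B₄ C₁ C₂ D₁ = jet K ι 5
      + (5 : K) • term b A₂ ![0, 4] + (5 : K) • term b A₃ ![1, 3] + (5 : K) • term b A₄ ![2, 2]
      + (5 : K) • term b B₂ ![0, 0, 3] + (5 : K) • term b B₃ ![0, 1, 2]
      + (5 : K) • term b B₄ ![1, 1, 1] + (5 : K) • term b C₁ ![0, 0, 0, 2]
      + (5 : K) • term b C₂ ![0, 1, 1, 0] + (5 : K) • term b D₁ ![0, 0, 0, 0, 1] := by
  funext i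
  have h5 : (5 : DiffPoly K ι) = C 5 := (map_ofNat C 5).symm
  simp only [fifthRHS, h5, Pi.add_apply, Pi.smul_apply, smul_eq_C_mul, jet]

omit [CharZero K] in
lemma mkdvRHS_eq (B : Op K V 3) : mkdvRHS b A B = jet K ι 3 + (3 : K) • term b A ![0, 2]
      + (3 : K) • term b B ![0, 1, 0] := by
  funext i
  have h3 : (3 : DiffPoly K ι) = C 3 := (map_ofNat C 3).symm
  simp only [mkdvRHS, h3, Pi.add_apply, Pi.smul_apply, smul_eq_C_mul, jet]

lemma extOp_zero {n : ℕ} (w : Fin n → ι → DiffPoly K ι) : extOp b (0 : Op K V n) w = 0 :=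
  ext_evalAt b fun p => by simp [evalAt_extOp]

lemma extOp_add {n : ℕ} (S T : Op K V n) (w : Fin n → ι → DiffPoly K ι) :
    extOp b (S + T) w = extOp b S w + extOp b T w :=
  ext_evalAt b fun p => by simp [evalAt_extOp]

lemma extOp_smul {n : ℕ} (c : K) (T : Op K V n) (w : Fin n → ι → DiffPoly K ι) :
    extOp b (c • T) w = c • extOp b T w :=
  ext_evalAt b fun p => by simp [evalAt_extOp]

/-! ### The covariant form of the systems -/

variable {A F} {B : Op K V 3}

/-- The ternary operation `B` of the system is the one built from `F` and the binary product `A`. -/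
def IsModel (A : Op K V 2) (B F : Op K V 3) : Prop :=
  ∀ x y z, B ![x, y, z] = F ![x, z, y] + F ![z, x, y]
    + (1 / 2 : K) • A ![z, A ![x, y]] + (1 / 2 : K) • A ![x, A ![z, y]]

lemma mkdvRHS_eq_jets (hB : IsModel A B F) :
    mkdvRHS b A B = jet K ι 3 + (3 : K) • bil (extOp b A) (jet K ι 0) (jet K ι 2)
      + (6 : K) • tri (extOp b F) (jet K ι 0) (jet K ι 0) (jet K ι 1)
      + (3 : K) • bil (extOp b A) (jet K ι 0) (bil (extOp b A) (jet K ι 0) (jet K ι 1)) := by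
  have key : extOp b B ![jet K ι 0, jet K ι 1, jet K ι 0]
      = (2 : K) • tri (extOp b F) (jet K ι 0) (jet K ι 0) (jet K ι 1)
        + bil (extOp b A) (jet K ι 0) (bil (extOp b A) (jet K ι 0) (jet K ι 1)) :=
    ext_evalAt b fun p => by
      rw [← tri_apply, evalAt_tri, tri_apply, hB]
      simp only [map_add, map_smul, evalAt_tri, evalAt_bil]
      simp only [tri_apply, bil_apply]
      module
  rw [mkdvRHS_eq, term_two, term_three, key]
  module

/-- The gauge-covariant form of the third-order system. -/
lemma mkdvRHS_eq_covJet (h : Compatible (bil A) (tri F)) (hB : IsModel A B F) :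
    mkdvRHS b A B = covJet (bil (extOp b A)) (vec (totalD K ι)) (jet K ι 0) 3
      + (6 : K) • tri (extOp b F) (jet K ι 0) (jet K ι 0) (jet K ι 1)
      - timeForm (bil (extOp b A)) (tri (extOp b F)) (jet K ι 0) (jet K ι 1)
        (covJet (bil (extOp b A)) (vec (totalD K ι)) (jet K ι 0) 2) (jet K ι 0) := by
  rw [mkdvRHS_eq_jets b hB, third_expand (compatible_ext b h) (isDer_vec b A F _)
    vec_totalD_jet]

/-- The gauge-covariant form of the fifth-order system. -/
lemma fifthRHS_eq_covJet (h : Compatible (bil A) (tri F)) :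
    fifthRHS b A A 0 (coeffB₂ (bil A) (tri F)) (coeffB₃ (bil A) (tri F)) (coeffB₄ (tri F))
        (coeffC₁ (bil A) (tri F)) (coeffC₂ (bil A) (tri F)) (coeffD₁ (bil A) (tri F))
      = fifthCubic (tri (extOp b F)) (jet K ι 0) (jet K ι 1)
        (covJet (bil (extOp b A)) (vec (totalD K ι)) (jet K ι 0) 2)
        (covJet (bil (extOp b A)) (vec (totalD K ι)) (jet K ι 0) 3)
        (covJet (bil (extOp b A)) (vec (totalD K ι)) (jet K ι 0) 5)
      - fifthForm (bil (extOp b A)) (tri (extOp b F)) (jet K ι 0) (jet K ι 1)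
        (covJet (bil (extOp b A)) (vec (totalD K ι)) (jet K ι 0) 2)
        (covJet (bil (extOp b A)) (vec (totalD K ι)) (jet K ι 0) 3)
        (covJet (bil (extOp b A)) (vec (totalD K ι)) (jet K ι 0) 4) (jet K ι 0) := by
  rw [fifth_expand (compatible_ext b h) (isDer_vec b A F _) vec_totalD_jet, fifthRHS_eq]
  simp only [term_two, term_three, term_four, term_five, extOp_coeffB₂, extOp_coeffB₃,
    extOp_coeffB₄, extOp_coeffC₁, extOp_coeffC₂, extOp_coeffD₁]
  rw [bil_apply (extOp b 0), extOp_zero, smul_zero, add_zero]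

lemma term_quinticOp : term b (quinticOp (tri F)) ![0, 0, 0, 0, 1]
    = quinticTerm (tri (extOp b F)) (jet K ι 0) (jet K ι 1) := by
  rw [term_five, extOp_quinticOp]
  rfl

end Transfer

/-! ### The covariant flows -/

section CovariantFlows

variable {K V : Type*} [Field K] [CharZero K] [AddCommGroup V] [Module K V]
  {a : V →ₗ[K] V →ₗ[K] V} {f : V →ₗ[K] V →ₗ[K] V →ₗ[K] V}

/-- The covariant time derivative of the third-order flow. -/
def timeFlow (a : V →ₗ[K] V →ₗ[K] V) (f : V →ₗ[K] V →ₗ[K] V →ₗ[K] V) (D δ : V →ₗ[K] V) (u : V) :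
    V →ₗ[K] V :=
  δ + timeForm a f u (covJet a D u 1) (covJet a D u 2)

/-- The covariant time derivative of the fifth-order flow. -/
def fifthTimeFlow (a : V →ₗ[K] V →ₗ[K] V) (f : V →ₗ[K] V →ₗ[K] V →ₗ[K] V) (D δ : V →ₗ[K] V)
    (u : V) : V →ₗ[K] V :=
  δ + fifthForm a f u (covJet a D u 1) (covJet a D u 2) (covJet a D u 3) (covJet a D u 4)

variable (h : Compatible a f) {D δ ε : V →ₗ[K] V} (hD : IsDer a f D) (hδ : IsDer a f δ)
  (hδD : ∀ z, δ (D z) = D (δ z)) {u : V}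

include h hD hδ hδD

lemma timeFlow_gauge (hu : timeFlow a f D δ u u
      = covJet a D u 3 + (6 : K) • f u u (covJet a D u 1)) (z : V) :
    timeFlow a f D δ u (gauge a D u z) = gauge a D u (timeFlow a f D δ u z) := by
  have e := gauge_timeForm h hD (gauge_covJet D u 0) (gauge_covJet D u 1) (gauge_covJet D u 2) z
  simp only [zero_add, Nat.reduceAdd] at e
  have hu' := congrArg (fun t => a t z) hu
  simp only [timeFlow, LinearMap.add_apply, map_add] at hu' e ⊢
  rw [e]
  simp only [gauge, LinearMap.add_apply, map_add, hδ.bil, hδD]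
  linear_combination (norm := module) hu'

lemma fifthTimeFlow_gauge {q : V} (hu : fifthTimeFlow a f D δ u u
      = fifthCubic f u (covJet a D u 1) (covJet a D u 2) (covJet a D u 3) (covJet a D u 5) + q)
    (z : V) :
    fifthTimeFlow a f D δ u (gauge a D u z) = gauge a D u (fifthTimeFlow a f D δ u z)
      + a (q - quinticTerm f u (covJet a D u 1) - jordanDefect f u (covJet a D u 1)) z := by
  have e := gauge_fifthForm h hD (gauge_covJet D u 0) (gauge_covJet D u 1) (gauge_covJet D u 2)
    (gauge_covJet D u 3) (gauge_covJet D u 4) z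
  rw [fifthFlow_eq] at e
  simp only [zero_add, Nat.reduceAdd] at e
  have hu' := congrArg (fun t => a t z) hu
  simp only [fifthTimeFlow, LinearMap.add_apply, map_add, map_sub, LinearMap.sub_apply] at hu' e ⊢
  rw [e]
  simp only [gauge, LinearMap.add_apply, map_add, hδ.bil, hδD]
  linear_combination (norm := module) hu'

omit [CharZero K] h hD hδ hδD in
/-- The Jacobi identity for `∇`, the third-order flow and a flow commuting with `∇` up to a left
multiplication. -/
lemma commutator_gauge {N T S : V →ₗ[K] V} {r : V} (hT : ∀ z, T (N z) = N (T z))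
    (hS : ∀ z, S (N z) = N (S z) + a r z) (z : V) :
    T (S (N z)) - S (T (N z)) = N (T (S z) - S (T z)) + (T (a r z) - a r (T z)) := by
  rw [hS, hT, hS, map_add, hT, map_sub]
  module

end CovariantFlows

/-! ### The curvature of the connection in the two time directions -/

section Curvature

variable {K ι : Type*} [Field K] [Fintype ι]

omit [Fintype ι] in
lemma smul_mem_order_succ {k : ℕ} {r : DiffPoly K ι} {w : ι → DiffPoly K ι}
    (hr : r ∈ MvPolynomial.idealOfVars (ι × ℕ) K) (hw : w ∈ order K ι k) :
    r • w ∈ order K ι (k + 1) :=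
  mem_order.2 fun i => by
    rw [pow_succ']
    exact Ideal.mul_mem_mul hr (mem_order.1 hw i)

/-- Additive maps that are linear over the ring of differential polynomials and that send constant
vectors to vectors of order `k` raise the order of vectors without constant term. -/
lemma map_mem_order_of_const [DecidableEq ι] {k : ℕ}
    {R : (ι → DiffPoly K ι) →ₗ[K] (ι → DiffPoly K ι)}
    (hR : ∀ (r : DiffPoly K ι) (w : ι → DiffPoly K ι), R (r • w) = r • R w)
    (hc : ∀ j, R (Pi.single j 1) ∈ order K ι k) {w : ι → DiffPoly K ι} (hw : w ∈ order K ι 1) :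
    R w ∈ order K ι (k + 1) := by
  have e : w = ∑ j, w j • (Pi.single j 1 : ι → DiffPoly K ι) := by
    funext i
    simp [Finset.sum_apply, Pi.single_apply]
  rw [e, map_sum]
  refine Submodule.sum_mem _ fun j _ => ?_
  rw [hR]
  refine smul_mem_order_succ ?_ (hc j)
  simpa using mem_order.1 hw j

omit [Fintype ι] in
lemma vec_smul (δ : Derivation K (DiffPoly K ι) (DiffPoly K ι)) (r : DiffPoly K ι)
    (w : ι → DiffPoly K ι) : vec δ (r • w) = δ r • w + r • vec δ w := by
  funext i
  simp only [vec_apply, Pi.smul_apply, smul_eq_mul, Derivation.leibniz, Pi.add_apply]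
  ring

omit [Fintype ι] in
lemma vec_single [DecidableEq ι] (δ : Derivation K (DiffPoly K ι) (DiffPoly K ι)) (j : ι) :
    vec δ (Pi.single j 1) = 0 := by
  funext i
  rw [vec_apply, Pi.single_apply]
  split <;> simp

omit [Fintype ι] in
lemma mem_order_zero (w : ι → DiffPoly K ι) : w ∈ order K ι 0 :=
  mem_order.2 fun i => by simp

/-- If the covariant flows `δ + M` and `ε + N` commute with `∇` up to order `m`, their curvature `R`
has order `m` on constant vectors. The last hypothesis says that the commutator of `δ` and `ε` on
the unknowns `U` is no larger than `R U`. By the Jacobi identity for `∇` and the two flows, `D (R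
z)` is then of order `k + 1` whenever `R` is of order `k`, and `D` does not raise the order of
vectors without constant term; so the order of `R` grows until it reaches `m`. -/
lemma curvature_mem_order [CharZero K] [DecidableEq ι]
    {a : (ι → DiffPoly K ι) →ₗ[K] (ι → DiffPoly K ι) →ₗ[K] (ι → DiffPoly K ι)}
    {δ ε : Derivation K (DiffPoly K ι) (DiffPoly K ι)}
    {M N R : (ι → DiffPoly K ι) →ₗ[K] (ι → DiffPoly K ι)} {m : ℕ} {r : ι → DiffPoly K ι}
    (hR : R = ((vec δ + M) ∘ₗ (vec ε + N) - (vec ε + N) ∘ₗ (vec δ + M))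
      - (vec δ ∘ₗ vec ε - vec ε ∘ₗ vec δ))
    (hao : ∀ (x y : ι → DiffPoly K ι) k l, x ∈ order K ι k → y ∈ order K ι l →
      a x y ∈ order K ι (k + l))
    (hδa : ∀ x y, vec δ (a x y) = a (vec δ x) y + a x (vec δ y))
    (hεa : ∀ x y, vec ε (a x y) = a (vec ε x) y + a x (vec ε y))
    (hδo : ∀ k, ∀ w ∈ order K ι k, vec δ w ∈ order K ι k)
    (hεo : ∀ k, ∀ w ∈ order K ι k, vec ε w ∈ order K ι k)
    (hMS : ∀ (c : DiffPoly K ι) y, M (c • y) = c • M y)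
    (hNS : ∀ (c : DiffPoly K ι) y, N (c • y) = c • N y)
    (hMo : ∀ k, ∀ w ∈ order K ι k, M w ∈ order K ι (k + 1))
    (hNo : ∀ k, ∀ w ∈ order K ι k, N w ∈ order K ι (k + 1))
    (hT : ∀ z, (vec δ + M) (gauge a (vec (totalD K ι)) (jet K ι 0) z)
      = gauge a (vec (totalD K ι)) (jet K ι 0) ((vec δ + M) z))
    (hS : ∀ z, (vec ε + N) (gauge a (vec (totalD K ι)) (jet K ι 0) z)
      = gauge a (vec (totalD K ι)) (jet K ι 0) ((vec ε + N) z) + a r z)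
    (hr : r ∈ order K ι m)
    (hU : ∀ k, (∀ (c : DiffPoly K ι) y, R (c • y) = c • R y) →
      (∀ j, R (Pi.single j 1) ∈ order K ι k) →
      vec δ (vec ε (jet K ι 0)) - vec ε (vec δ (jet K ι 0)) ∈ order K ι (k + 1)) :
    (∀ (c : DiffPoly K ι) y, R (c • y) = c • R y) ∧ ∀ j, R (Pi.single j 1) ∈ order K ι m := by
  have hRapp : ∀ z, R z = (vec δ (N z) + M (vec ε z) + M (N z))
      - (vec ε (M z) + N (vec δ z) + N (M z)) := fun z => by
    rw [hR]
    simp only [LinearMap.sub_apply, LinearMap.comp_apply, LinearMap.add_apply, map_add]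
    abel
  have hRS : ∀ (c : DiffPoly K ι) y, R (c • y) = c • R y := fun c y => by
    simp only [hRapp, hNS, hMS, vec_smul, map_add]
    module
  refine ⟨hRS, ?_⟩
  have hRc : ∀ j, R (Pi.single j 1) = vec δ (N (Pi.single j 1)) + M (N (Pi.single j 1))
      - (vec ε (M (Pi.single j 1)) + N (M (Pi.single j 1))) := fun j => by
    rw [hRapp, vec_single, vec_single, map_zero, map_zero, add_zero, add_zero]
  have h1 : ∀ j, R (Pi.single j 1) ∈ order K ι 1 := fun j => by
    have hn := hNo 0 _ (mem_order_zero (Pi.single j 1))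
    have hm := hMo 0 _ (mem_order_zero (Pi.single j 1))
    rw [hRc]
    exact sub_mem (add_mem (hδo _ _ hn) (order_mono (by omega) (hMo _ _ hn)))
      (add_mem (hεo _ _ hm) (order_mono (by omega) (hNo _ _ hm)))
  suffices H : ∀ k, k ≤ m → ∀ j, R (Pi.single j 1) ∈ order K ι k from H m le_rfl
  intro k
  induction k with
  | zero => exact fun _ j => mem_order_zero _
  | succ k ih =>
    intro hk j
    have ihk := ih (by omega)
    set z : ι → DiffPoly K ι := Pi.single j 1 with hz
    have hDz : vec (totalD K ι) z = 0 := vec_single _ j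
    have hδz : vec δ z = 0 := vec_single _ j
    have hεz : vec ε z = 0 := vec_single _ j
    have key := commutator_gauge (a := a) (N := gauge a (vec (totalD K ι)) (jet K ι 0)) hT hS z
    have hC : ∀ y, (vec δ + M) ((vec ε + N) y) - (vec ε + N) ((vec δ + M) y)
        = R y + (vec δ (vec ε y) - vec ε (vec δ y)) := fun y => by
      rw [hR]
      simp only [LinearMap.sub_apply, LinearMap.comp_apply]
      abel
    rw [hC, hC, hδz, hεz, map_zero, map_zero, sub_zero, add_zero] at key
    have hg : gauge a (vec (totalD K ι)) (jet K ι 0) z = a (jet K ι 0) z := by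
      rw [gauge, LinearMap.add_apply, hDz, zero_add]
    rw [hg, gauge, LinearMap.add_apply] at key
    have hcomm : vec δ (vec ε (a (jet K ι 0) z)) - vec ε (vec δ (a (jet K ι 0) z))
        = a (vec δ (vec ε (jet K ι 0)) - vec ε (vec δ (jet K ι 0))) z := by
      simp only [hδa, hεa, hδz, hεz, map_zero, add_zero, map_sub, LinearMap.sub_apply]
    have hdefect : (vec δ + M) (a r z) - a r ((vec δ + M) z) ∈ order K ι m := by
      have ha : a r z ∈ order K ι m := by simpa using hao r z m 0 hr (mem_order_zero _)
      have hb : a r ((vec δ + M) z) ∈ order K ι m := by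
        simpa using hao r _ m 0 hr (mem_order_zero ((vec δ + M) z))
      exact sub_mem (add_mem (hδo _ _ ha) (order_mono (by omega) (hMo _ _ ha))) hb
    have hD : vec (totalD K ι) (R z) = R (a (jet K ι 0) z)
        + a (vec δ (vec ε (jet K ι 0)) - vec ε (vec δ (jet K ι 0))) z
        - ((vec δ + M) (a r z) - a r ((vec δ + M) z)) - a (jet K ι 0) (R z) := by
      rw [← hcomm, key]
      abel
    have hU1 := jet_mem_order (K := K) (ι := ι) 0
    have hDo : vec (totalD K ι) (R z) ∈ order K ι (k + 1) := by
      rw [hD]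
      refine sub_mem (sub_mem (add_mem ?_ ?_) (order_mono hk hdefect)) ?_
      · exact map_mem_order_of_const hRS ihk
          (by simpa using hao _ _ 1 0 hU1 (mem_order_zero z))
      · simpa using hao _ z _ 0 (hU k hRS ihk) (mem_order_zero _)
      · simpa [add_comm] using hao _ _ 1 k hU1 (ihk j)
    refine mem_order.2 fun i => mem_pow_of_totalD_mem ?_ (mem_order.1 hDo i)
    simpa using mem_order.1 (h1 j) i

end Curvature

/-! ### A compatible Jordan triple system yields a symmetry -/

section Concrete

variable {K V ι : Type*} [Field K] [CharZero K] [AddCommGroup V] [Module K V] [Fintype ι]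
  (b : Module.Basis ι K V) {A : Op K V 2} {F : Op K V 3}

/-- The covariant derivative `∇ = D + L_U` on vectors of differential polynomials. -/
noncomputable def nabla (A : Op K V 2) : (ι → DiffPoly K ι) →ₗ[K] (ι → DiffPoly K ι) :=
  gauge (bil (extOp b A)) (vec (totalD K ι)) (jet K ι 0)

/-- The covariant derivative `∇^k U` of the vector of unknowns. -/
noncomputable def covU (A : Op K V 2) (k : ℕ) : ι → DiffPoly K ι :=
  covJet (bil (extOp b A)) (vec (totalD K ι)) (jet K ι 0) k

/-- The covariant derivative along the third-order flow of the system with right-hand side `G`. -/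
noncomputable def nablaT (A : Op K V 2) (F : Op K V 3) (G : ι → DiffPoly K ι) :
    (ι → DiffPoly K ι) →ₗ[K] (ι → DiffPoly K ι) :=
  vec (evolField G) + timeForm (bil (extOp b A)) (tri (extOp b F)) (covU b A 0) (covU b A 1)
    (covU b A 2)

/-- The covariant derivative along the fifth-order flow of the system with right-hand side `G`. -/
noncomputable def nablaTau (A : Op K V 2) (F : Op K V 3) (G : ι → DiffPoly K ι) :
    (ι → DiffPoly K ι) →ₗ[K] (ι → DiffPoly K ι) :=
  vec (evolField G) + fifthForm (bil (extOp b A)) (tri (extOp b F)) (covU b A 0) (covU b A 1)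
    (covU b A 2) (covU b A 3) (covU b A 4)

/-- The curvature in the directions `t` and `τ`: the commutator of the covariant derivatives minus
that of the evolutionary fields. -/
noncomputable def curvature (A : Op K V 2) (F : Op K V 3) (G G' : ι → DiffPoly K ι) :
    (ι → DiffPoly K ι) →ₗ[K] (ι → DiffPoly K ι) :=
  (nablaT b A F G ∘ₗ nablaTau b A F G' - nablaTau b A F G' ∘ₗ nablaT b A F G)
    - (vec (evolField G) ∘ₗ vec (evolField G') - vec (evolField G') ∘ₗ vec (evolField G))

lemma bil_smul_right (x y : ι → DiffPoly K ι) (c : DiffPoly K ι) :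
    bil (extOp b A) x (c • y) = c • bil (extOp b A) x y :=
  ext_evalAt b fun p => by
    simp only [evalAt_smul, evalAt_bil, map_smul]

lemma jacobian_mem_order {x y z : ι → DiffPoly K ι} {k l m : ℕ} (hx : x ∈ order K ι k)
    (hy : y ∈ order K ι l) (hz : z ∈ order K ι m) :
    jacobian (bil (extOp b A)) x y z ∈ order K ι (k + l + m) := by
  have h1 := bil_mem_order b A hz (bil_mem_order b A hx hy)
  have h2 := bil_mem_order b A hx (bil_mem_order b A hy hz)
  have h3 := bil_mem_order b A hy (bil_mem_order b A hz hx)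
  rw [show m + (k + l) = k + l + m by ring] at h1
  rw [show k + (l + m) = k + l + m by ring] at h2
  rw [show l + (m + k) = k + l + m by ring] at h3
  exact add_mem (add_mem h1 h2) h3

lemma timeForm_smul {w₀ w₁ w₂ : ι → DiffPoly K ι} (c : DiffPoly K ι) (z : ι → DiffPoly K ι) :
    timeForm (bil (extOp b A)) (tri (extOp b F)) w₀ w₁ w₂ (c • z)
      = c • timeForm (bil (extOp b A)) (tri (extOp b F)) w₀ w₁ w₂ z := by
  simp only [timeForm, jacobianMap, LinearMap.sub_apply, LinearMap.comp_apply, bil_smul_right,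
    smul_sub]

lemma fifthForm_smul {w₀ w₁ w₂ w₃ w₄ : ι → DiffPoly K ι} (c : DiffPoly K ι)
    (z : ι → DiffPoly K ι) :
    fifthForm (bil (extOp b A)) (tri (extOp b F)) w₀ w₁ w₂ w₃ w₄ (c • z)
      = c • fifthForm (bil (extOp b A)) (tri (extOp b F)) w₀ w₁ w₂ w₃ w₄ z := by
  simp only [fifthForm, jacobianMap, LinearMap.sub_apply, LinearMap.add_apply,
    LinearMap.smul_apply, LinearMap.comp_apply, bil_smul_right, smul_sub, smul_add]
  module

lemma timeForm_mem_order (h : Compatible (bil A) (tri F)) {w₀ w₁ w₂ z : ι → DiffPoly K ι} {k : ℕ}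
    (h₀ : w₀ ∈ order K ι 1) (h₁ : w₁ ∈ order K ι 1) (h₂ : w₂ ∈ order K ι 1)
    (hz : z ∈ order K ι k) :
    timeForm (bil (extOp b A)) (tri (extOp b F)) w₀ w₁ w₂ z ∈ order K ι (k + 1) := by
  rw [timeForm_apply (compatible_ext b h)]
  have hm : w₂ + bil (extOp b A) w₀ w₁ + (2 : K) • tri (extOp b F) w₀ w₀ w₀ ∈ order K ι 1 :=
    add_mem (add_mem h₂ (order_mono (by omega) (bil_mem_order b A h₀ h₁)))
      (smul_mem_order _ (order_mono (by omega) (tri_mem_order b F h₀ h₀ h₀)))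
  exact sub_mem (order_mono (by omega) (bil_mem_order b A hm hz))
    (order_mono (by omega) (jacobian_mem_order b h₀ h₁ hz))

lemma fifthVector_mem_order {w₀ w₁ w₂ w₃ w₄ : ι → DiffPoly K ι}
    (h₀ : w₀ ∈ order K ι 1) (h₁ : w₁ ∈ order K ι 1) (h₂ : w₂ ∈ order K ι 1)
    (h₃ : w₃ ∈ order K ι 1) (h₄ : w₄ ∈ order K ι 1) :
    fifthVector (bil (extOp b A)) (tri (extOp b F)) w₀ w₁ w₂ w₃ w₄ ∈ order K ι 1 := by
  have ha : ∀ {x y : ι → DiffPoly K ι}, x ∈ order K ι 1 → y ∈ order K ι 1 →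
      bil (extOp b A) x y ∈ order K ι 1 := fun hx hy =>
    order_mono (by omega) (bil_mem_order b A hx hy)
  have hf : ∀ {x y z : ι → DiffPoly K ι}, x ∈ order K ι 1 → y ∈ order K ι 1 →
      z ∈ order K ι 1 → tri (extOp b F) x y z ∈ order K ι 1 := fun hx hy hz =>
    order_mono (by omega) (tri_mem_order b F hx hy hz)
  have hs : ∀ (c : K) {x : ι → DiffPoly K ι}, x ∈ order K ι 1 → c • x ∈ order K ι 1 :=
    fun c _ hx => smul_mem_order c hx
  rw [fifthVector]
  refine add_mem (add_mem (add_mem (add_mem (add_mem (add_mem (add_mem (add_mem (sub_mem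
    (add_mem h₄ (ha h₀ h₃)) (ha h₁ h₂)) (hs _ (hf h₀ h₀ h₂))) (hs _ (hf h₀ h₂ h₀)))
    (hs _ (hf h₀ h₁ h₁))) (hs _ (hf h₁ h₀ h₁))) (hs _ (ha h₀ (ha h₀ (ha h₀ h₁)))))
    (hs _ (ha h₀ (hf h₀ h₀ h₁)))) (hs _ (ha h₁ (hf h₀ h₀ h₀)))) (hs _ (hf h₀ h₀ (hf h₀ h₀ h₀)))

lemma fifthForm_mem_order (h : Compatible (bil A) (tri F)) {w₀ w₁ w₂ w₃ w₄ z : ι → DiffPoly K ι}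
    {k : ℕ} (h₀ : w₀ ∈ order K ι 1) (h₁ : w₁ ∈ order K ι 1) (h₂ : w₂ ∈ order K ι 1)
    (h₃ : w₃ ∈ order K ι 1) (h₄ : w₄ ∈ order K ι 1) (hz : z ∈ order K ι k) :
    fifthForm (bil (extOp b A)) (tri (extOp b F)) w₀ w₁ w₂ w₃ w₄ z ∈ order K ι (k + 1) := by
  rw [fifthForm_apply (compatible_ext b h)]
  have hf : ∀ {x y z : ι → DiffPoly K ι}, x ∈ order K ι 1 → y ∈ order K ι 1 →
      z ∈ order K ι 1 → tri (extOp b F) x y z ∈ order K ι 1 := fun hx hy hz =>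
    order_mono (by omega) (tri_mem_order b F hx hy hz)
  have hj : ∀ {x y : ι → DiffPoly K ι}, x ∈ order K ι 1 → y ∈ order K ι 1 →
      jacobian (bil (extOp b A)) x y z ∈ order K ι (k + 1) := fun hx hy =>
    order_mono (by omega) (jacobian_mem_order b hx hy hz)
  have hn := fifthVector_mem_order b (A := A) (F := F) h₀ h₁ h₂ h₃ h₄
  exact sub_mem (add_mem (add_mem (sub_mem (order_mono (by omega) (bil_mem_order b A hn hz))
    (hj h₀ h₃)) (hj h₁ h₂)) (smul_mem_order _ (hj h₁ (hf h₀ h₀ h₀))))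
    (smul_mem_order _ (hj h₀ (hf h₀ h₀ h₁)))

lemma gauge_mem_order {w : ι → DiffPoly K ι} {k : ℕ} (hw : w ∈ order K ι k) :
    gauge (bil (extOp b A)) (vec (totalD K ι)) (jet K ι 0) w ∈ order K ι k :=
  add_mem (vec_totalD_mem_order hw)
    (order_mono (by omega) (bil_mem_order b A (jet_mem_order 0) hw))

lemma covU_mem_order (k : ℕ) : covU b A k ∈ order K ι 1 := by
  induction k with
  | zero => exact jet_mem_order 0
  | succ k ih =>
    rw [covU, ← gauge_covJet]
    exact gauge_mem_order b ih

omit [CharZero K] [Fintype ι] in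
lemma vec_evolField_mem_order' {k : ℕ} {G w : ι → DiffPoly K ι} (hG : G ∈ order K ι 1)
    (h : w ∈ order K ι k) : vec (evolField G) w ∈ order K ι k := by
  cases k with
  | zero => exact mem_order_zero _
  | succ k => exact vec_evolField_mem_order hG h

lemma mkdvRHS_mem_order (B : Op K V 3) : mkdvRHS b A B ∈ order K ι 1 := by
  rw [mkdvRHS_eq]
  exact add_mem (add_mem (jet_mem_order 3) (smul_mem_order _ (order_mono (by omega)
    (homog_le_order (term_mem_homog b A _))))) (smul_mem_order _ (order_mono (by omega)
    (homog_le_order (term_mem_homog b B _))))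

lemma fifthRHS_mem_order (A₂ A₃ A₄ : Op K V 2) (B₂ B₃ B₄ : Op K V 3) (C₁ C₂ : Op K V 4)
    (D₁ : Op K V 5) : fifthRHS b A₂ A₃ A₄ B₂ B₃ B₄ C₁ C₂ D₁ ∈ order K ι 1 := by
  have ht : ∀ {n : ℕ} (T : Op K V n) (s : Fin n → ℕ), 1 ≤ n → (5 : K) • term b T s ∈ order K ι 1 :=
    fun T s hn => smul_mem_order _ (order_mono hn (homog_le_order (term_mem_homog b T s)))
  rw [fifthRHS_eq]
  exact add_mem (add_mem (add_mem (add_mem (add_mem (add_mem (add_mem (add_mem (add_mem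
    (jet_mem_order 5) (ht _ _ (by omega))) (ht _ _ (by omega))) (ht _ _ (by omega)))
    (ht _ _ (by omega))) (ht _ _ (by omega))) (ht _ _ (by omega))) (ht _ _ (by omega)))
    (ht _ _ (by omega))) (ht _ _ (by omega))

lemma covU_zero : covU b A 0 = jet K ι 0 := rfl

lemma nabla_covU (k : ℕ) : nabla b A (covU b A k) = covU b A (k + 1) := gauge_covJet _ _ _

lemma covU_one (h : Compatible (bil A) (tri F)) : covU b A 1 = jet K ι 1 :=
  covJet_one (compatible_ext b h) vec_totalD_jet

lemma nablaT_jet (h : Compatible (bil A) (tri F)) {B : Op K V 3} (hB : IsModel A B F) :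
    nablaT b A F (mkdvRHS b A B) (covU b A 0)
      = covU b A 3 + (6 : K) • tri (extOp b F) (covU b A 0) (covU b A 0) (covU b A 1) := by
  have e := mkdvRHS_eq_covJet b h hB
  rw [← covU_zero b (A := A), ← covU_one b h] at e
  rw [nablaT, LinearMap.add_apply, covU_zero, vec_evolField_jet_zero]
  exact sub_eq_iff_eq_add.1 e.symm |>.symm

lemma nablaT_nabla (h : Compatible (bil A) (tri F)) {B : Op K V 3} (hB : IsModel A B F)
    (z : ι → DiffPoly K ι) : nablaT b A F (mkdvRHS b A B) (nabla b A z)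
      = nabla b A (nablaT b A F (mkdvRHS b A B) z) :=
  timeFlow_gauge (compatible_ext b h) (isDer_vec b A F _) (isDer_vec b A F _)
    (vec_evolField_totalD _) (nablaT_jet b h hB) z

/-- The covariant `τ`-derivative commutes with `∇` up to the multiplication by the deviation `q` of
the system from its cubic part, corrected by the quintic terms and the Jordan defect. -/
lemma nablaTau_nabla (h : Compatible (bil A) (tri F)) {G q : ι → DiffPoly K ι}
    (hq : nablaTau b A F G (covU b A 0) = fifthCubic (tri (extOp b F)) (covU b A 0) (covU b A 1)
      (covU b A 2) (covU b A 3) (covU b A 5) + q) (z : ι → DiffPoly K ι) :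
    nablaTau b A F G (nabla b A z) = nabla b A (nablaTau b A F G z)
      + bil (extOp b A) (q - quinticTerm (tri (extOp b F)) (covU b A 0) (covU b A 1)
        - jordanDefect (tri (extOp b F)) (covU b A 0) (covU b A 1)) z :=
  fifthTimeFlow_gauge (compatible_ext b h) (isDer_vec b A F _) (isDer_vec b A F _)
    (vec_evolField_totalD _) hq z

/-- The curvature in the directions `t` and `τ` is linear over differential polynomials. Its order
on constant vectors is at least that of the curvature in the directions `x` and `τ`, provided that
the commutator of the evolutionary fields is controlled by it. -/
lemma curvature_smul_and_mem_order [DecidableEq ι] (h : Compatible (bil A) (tri F)) {B : Op K V 3}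
    (hB : IsModel A B F) {G q : ι → DiffPoly K ι} (hG : G ∈ order K ι 1)
    (hq : nablaTau b A F G (covU b A 0) = fifthCubic (tri (extOp b F)) (covU b A 0) (covU b A 1)
      (covU b A 2) (covU b A 3) (covU b A 5) + q) {m : ℕ}
    (hr : q - quinticTerm (tri (extOp b F)) (covU b A 0) (covU b A 1)
        - jordanDefect (tri (extOp b F)) (covU b A 0) (covU b A 1) ∈ order K ι m)
    (hU : ∀ k, (∀ (c : DiffPoly K ι) y, curvature b A F (mkdvRHS b A B) G (c • y)
        = c • curvature b A F (mkdvRHS b A B) G y) →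
      (∀ j, curvature b A F (mkdvRHS b A B) G (Pi.single j 1) ∈ order K ι k) →
      vec (evolField (mkdvRHS b A B)) (vec (evolField G) (jet K ι 0))
        - vec (evolField G) (vec (evolField (mkdvRHS b A B)) (jet K ι 0)) ∈ order K ι (k + 1)) :
    (∀ (c : DiffPoly K ι) y, curvature b A F (mkdvRHS b A B) G (c • y)
        = c • curvature b A F (mkdvRHS b A B) G y) ∧
      ∀ j, curvature b A F (mkdvRHS b A B) G (Pi.single j 1) ∈ order K ι m :=
  curvature_mem_order (a := bil (extOp b A)) rfl
    (fun _ _ _ _ hx hy => bil_mem_order b A hx hy) (vec_bil b _ A) (vec_bil b _ A)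
    (fun _ _ hw => vec_evolField_mem_order' (mkdvRHS_mem_order b B) hw)
    (fun _ _ hw => vec_evolField_mem_order' hG hw)
    (fun _ _ => timeForm_smul b _ _) (fun _ _ => fifthForm_smul b _ _)
    (fun _ _ hw => timeForm_mem_order b h (jet_mem_order 0) (covU_mem_order b 1)
      (covU_mem_order b 2) hw)
    (fun _ _ hw => fifthForm_mem_order b h (jet_mem_order 0) (covU_mem_order b 1)
      (covU_mem_order b 2) (covU_mem_order b 3) (covU_mem_order b 4) hw)
    (nablaT_nabla b h hB) (nablaTau_nabla b h hq) hr hU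

/-- The model fifth-order system built from the products `A` and `F`. -/
noncomputable def modelRHS (A : Op K V 2) (F : Op K V 3) : ι → DiffPoly K ι :=
  fifthRHS b A A 0 (coeffB₂ (bil A) (tri F)) (coeffB₃ (bil A) (tri F)) (coeffB₄ (tri F))
    (coeffC₁ (bil A) (tri F)) (coeffC₂ (bil A) (tri F)) (coeffD₁ (bil A) (tri F))

lemma nablaTau_jet (h : Compatible (bil A) (tri F)) (G : ι → DiffPoly K ι) :
    nablaTau b A F G (covU b A 0) = fifthCubic (tri (extOp b F)) (covU b A 0) (covU b A 1)
      (covU b A 2) (covU b A 3) (covU b A 5) + (G - modelRHS b A F) := by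
  have e : modelRHS b A F = fifthCubic (tri (extOp b F)) (covU b A 0) (covU b A 1)
      (covU b A 2) (covU b A 3) (covU b A 5)
      - fifthForm (bil (extOp b A)) (tri (extOp b F)) (covU b A 0) (covU b A 1)
      (covU b A 2) (covU b A 3) (covU b A 4) (covU b A 0) := by
    rw [covU_one b h]
    exact fifthRHS_eq_covJet b h
  rw [nablaTau, LinearMap.add_apply, e]
  generalize fifthForm (bil (extOp b A)) (tri (extOp b F)) (covU b A 0) (covU b A 1)
      (covU b A 2) (covU b A 3) (covU b A 4) (covU b A 0) = x
  generalize fifthCubic (tri (extOp b F)) (covU b A 0) (covU b A 1)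
      (covU b A 2) (covU b A 3) (covU b A 5) = y
  rw [covU_zero, vec_evolField_jet_zero]
  abel

lemma isTripleDer_nabla (h : Compatible (bil A) (tri F)) :
    IsTripleDer (tri (extOp b F)) (nabla b A) :=
  isTripleDer_gauge (compatible_ext b h) (isTripleDer_vec b F _) _

lemma isTripleDer_nablaT (h : Compatible (bil A) (tri F)) (G : ι → DiffPoly K ι) :
    IsTripleDer (tri (extOp b F)) (nablaT b A F G) :=
  isTripleDer_timeForm (compatible_ext b h) (isTripleDer_vec b F _) _ _ _

lemma isTripleDer_nablaTau (h : Compatible (bil A) (tri F)) (G : ι → DiffPoly K ι) :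
    IsTripleDer (tri (extOp b F)) (nablaTau b A F G) :=
  isTripleDer_fifthForm (compatible_ext b h) (isTripleDer_vec b F _) _ _ _ _ _

lemma nablaT_covU_succ (h : Compatible (bil A) (tri F)) {B : Op K V 3} (hB : IsModel A B F)
    (k : ℕ) : nablaT b A F (mkdvRHS b A B) (covU b A (k + 1))
      = nabla b A (nablaT b A F (mkdvRHS b A B) (covU b A k)) := by
  rw [← nabla_covU, nablaT_nabla b h hB]

lemma comm_evolField_eq (G G' : ι → DiffPoly K ι) (z : ι → DiffPoly K ι) :
    vec (evolField G) (vec (evolField G') z) - vec (evolField G') (vec (evolField G) z)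
      = nablaT b A F G (nablaTau b A F G' z) - nablaTau b A F G' (nablaT b A F G z)
        - curvature b A F G G' z := by
  rw [curvature]
  simp only [LinearMap.sub_apply, LinearMap.comp_apply]
  abel

/-- For a Jordan triple system, adding the quintic terms to the model fifth-order system yields a
symmetry of the third-order system. -/
lemma isSymmetry_of_sub_modelRHS (h : Compatible (bil A) (tri F)) (hJ : JordanTriple (tri F))
    {B : Op K V 3} (hB : IsModel A B F) {G : ι → DiffPoly K ι} (hG : G ∈ order K ι 1)
    (hGq : G - modelRHS b A F = quinticTerm (tri (extOp b F)) (covU b A 0) (covU b A 1)) :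
    IsSymmetry (mkdvRHS b A B) G := by
  classical
  have hJ' := jordanTriple_ext b hJ
  have hq := nablaTau_jet b h G
  have hr : G - modelRHS b A F - quinticTerm (tri (extOp b F)) (covU b A 0) (covU b A 1)
      - jordanDefect (tri (extOp b F)) (covU b A 0) (covU b A 1) = 0 := by
    rw [hGq, jordanDefect_eq_zero hJ', sub_self, sub_zero]
  have hτ : ∀ k, nablaTau b A F G (covU b A (k + 1))
      = nabla b A (nablaTau b A F G (covU b A k)) := fun k => by
    rw [← nabla_covU, nablaTau_nabla b h hq, hr, map_zero, LinearMap.zero_apply, add_zero]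
  rw [hGq, ← fifthFlow_eq] at hq
  have hC : nablaT b A F (mkdvRHS b A B) (nablaTau b A F G (covU b A 0))
      = nablaTau b A F G (nablaT b A F (mkdvRHS b A B) (covU b A 0)) :=
    flow_commute hJ' (isTripleDer_nabla b h) (isTripleDer_nablaT b h _)
      (isTripleDer_nablaTau b h _) (nabla_covU b) (nablaT_jet b h hB) (nablaT_covU_succ b h hB)
      hq hτ
  have hU := comm_evolField_eq b (A := A) (F := F) (mkdvRHS b A B) G (jet K ι 0)
  rw [← covU_zero b (A := A), hC, sub_self, zero_sub, covU_zero] at hU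
  have hq := nablaTau_jet b h G
  have hR : ∀ m, curvature b A F (mkdvRHS b A B) G (jet K ι 0) ∈ order K ι (m + 1) := fun m => by
    have := curvature_smul_and_mem_order b h hB hG hq (m := m) (by rw [hr]; exact zero_mem _)
      fun k hs hk => by
        rw [hU]
        exact neg_mem (map_mem_order_of_const hs hk (jet_mem_order 0))
    exact map_mem_order_of_const this.1 this.2 (jet_mem_order 0)
  rw [isSymmetry_iff, ← sub_eq_zero]
  simp only [vec_evolField_jet_zero] at hU ⊢
  rw [hU, neg_eq_zero]
  funext i
  exact eq_zero_of_forall_mem_pow fun n =>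
    Ideal.pow_le_pow_right (Nat.le_succ n) (mem_order.1 (hR n) i)

/-- A Jordan triple system with the compatibility identities yields a symmetry. -/
theorem isSymmetry_of_jordanTriple (h : Compatible (bil A) (tri F)) (hJ : JordanTriple (tri F))
    {B : Op K V 3} (hB : IsModel A B F) :
    IsSymmetry (mkdvRHS b A B) (fifthRHS b A A 0 (coeffB₂ (bil A) (tri F))
      (coeffB₃ (bil A) (tri F)) (coeffB₄ (tri F)) (coeffC₁ (bil A) (tri F))
      (coeffC₂ (bil A) (tri F)) (coeffD₁ (bil A) (tri F) + (1 / 5 : K) • quinticOp (tri F))) := by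
  refine isSymmetry_of_sub_modelRHS b h hJ hB (fifthRHS_mem_order b _ _ _ _ _ _ _ _ _) ?_
  rw [modelRHS, fifthRHS_eq, fifthRHS_eq, covU_zero, covU_one b h, ← term_quinticOp]
  simp only [term_five, extOp_add, extOp_smul]
  module

end Concrete

/-! ### The leading terms of the symmetry equation -/

section LeadingTerms

variable {K V ι : Type*} [Field K] [CharZero K] [AddCommGroup V] [Module K V] [Fintype ι]
  (b : Module.Basis ι K V) {A : Op K V 2} {F : Op K V 3}

/-- The vector `y` is homogeneous of degree `k` and is the leading term of `x`. -/
def HasLeadingTerm (k : ℕ) (x y : ι → DiffPoly K ι) : Prop :=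
  y ∈ homog K ι k ∧ x - y ∈ order K ι (k + 1)

omit [CharZero K] [Fintype ι] in
lemma HasLeadingTerm.mem_order {k : ℕ} {x y : ι → DiffPoly K ι} (h : HasLeadingTerm k x y) :
    x ∈ order K ι k := by
  rw [← sub_add_cancel x y]
  exact add_mem (order_mono (Nat.le_succ k) h.2) (homog_le_order h.1)

omit [CharZero K] [Fintype ι] in
lemma HasLeadingTerm.add {k : ℕ} {x y x' y' : ι → DiffPoly K ι} (h : HasLeadingTerm k x y)
    (h' : HasLeadingTerm k x' y') : HasLeadingTerm k (x + x') (y + y') :=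
  ⟨add_mem h.1 h'.1, by rw [add_sub_add_comm]; exact add_mem h.2 h'.2⟩

omit [CharZero K] [Fintype ι] in
lemma HasLeadingTerm.smul {k : ℕ} {x y : ι → DiffPoly K ι} (c : K) (h : HasLeadingTerm k x y) :
    HasLeadingTerm k (c • x) (c • y) :=
  ⟨Submodule.smul_mem _ c h.1, by rw [← smul_sub]; exact smul_mem_order c h.2⟩

lemma HasLeadingTerm.tri {k l m n : ℕ} {x y z x' y' z' : ι → DiffPoly K ι}
    (hx : HasLeadingTerm k x x') (hy : HasLeadingTerm l y y') (hz : HasLeadingTerm m z z')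
    (hn : k + l + m = n) :
    HasLeadingTerm n (tri (extOp b F) x y z) (tri (extOp b F) x' y' z') := by
  subst hn
  refine ⟨tri_mem_homog b F hx.1 hy.1 hz.1, ?_⟩
  have e : MKdV.tri (extOp b F) x y z - MKdV.tri (extOp b F) x' y' z'
      = MKdV.tri (extOp b F) (x - x') y z + MKdV.tri (extOp b F) x' (y - y') z
        + MKdV.tri (extOp b F) x' y' (z - z') := by
    simp only [map_sub, LinearMap.sub_apply]
    abel
  rw [e]
  exact add_mem (add_mem
    (order_mono (by omega) (tri_mem_order b F hx.2 hy.mem_order hz.mem_order))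
    (order_mono (by omega) (tri_mem_order b F (homog_le_order hx.1) hy.2 hz.mem_order)))
    (order_mono (by omega) (tri_mem_order b F (homog_le_order hx.1) (homog_le_order hy.1) hz.2))

lemma quinticObstruction_hasLeadingTerm {w w' : ℕ → ι → DiffPoly K ι}
    (h : ∀ k, HasLeadingTerm 1 (w k) (w' k)) :
    HasLeadingTerm 5 (quinticObstruction (tri (extOp b F)) (w 0) (w 1) (w 2) (w 3))
      (quinticObstruction (tri (extOp b F)) (w' 0) (w' 1) (w' 2) (w' 3)) := by
  have hr : ∀ i j k l m, HasLeadingTerm 5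
      (tri (extOp b F) (w i) (w j) (tri (extOp b F) (w k) (w l) (w m)))
      (tri (extOp b F) (w' i) (w' j) (tri (extOp b F) (w' k) (w' l) (w' m))) :=
    fun i j k l m => (h i).tri b (h j) ((h k).tri b (h l) (h m) rfl) rfl
  have hm : ∀ i j k l m, HasLeadingTerm 5
      (tri (extOp b F) (w i) (tri (extOp b F) (w j) (w k) (w l)) (w m))
      (tri (extOp b F) (w' i) (tri (extOp b F) (w' j) (w' k) (w' l)) (w' m)) :=
    fun i j k l m => (h i).tri b ((h j).tri b (h k) (h l) rfl) (h m) rfl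
  simp only [quinticObstruction]
  repeat' first
    | with_reducible apply HasLeadingTerm.add
    | with_reducible apply HasLeadingTerm.smul
    | with_reducible apply hr
    | with_reducible apply hm

lemma covU_hasLeadingTerm (k : ℕ) : HasLeadingTerm 1 (covU b A k) (jet K ι k) := by
  induction k with
  | zero => exact ⟨jet_mem_homog 0, by rw [covU_zero, sub_self]; exact zero_mem _⟩
  | succ k ih =>
    refine ⟨jet_mem_homog _, ?_⟩
    have e : covU b A (k + 1) - jet K ι (k + 1) = vec (totalD K ι) (covU b A k - jet K ι k)
        + bil (extOp b A) (jet K ι 0) (covU b A k) := by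
      rw [← nabla_covU, nabla, gauge, LinearMap.add_apply, map_sub, vec_totalD_jet]
      abel
    rw [e]
    exact add_mem (vec_totalD_mem_order ih.2) (bil_mem_order b A (jet_mem_order 0) ih.mem_order)

lemma quinticTerm_mem_order {x y : ι → DiffPoly K ι} (hx : x ∈ order K ι 1)
    (hy : y ∈ order K ι 1) : quinticTerm (tri (extOp b F)) x y ∈ order K ι 5 := by
  have h1 := tri_mem_order b F hx hx (tri_mem_order b F hx hx hy)
  have h2 := tri_mem_order b F hx (tri_mem_order b F hx hx hx) hy
  rw [quinticTerm]
  exact add_mem (smul_mem_order _ h1) (smul_mem_order _ h2)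

lemma jordanDefect_mem_order {x y : ι → DiffPoly K ι} (hx : x ∈ order K ι 1)
    (hy : y ∈ order K ι 1) : jordanDefect (tri (extOp b F)) x y ∈ order K ι 5 := by
  have h1 := tri_mem_order b F hx hy (tri_mem_order b F hx hx hx)
  have h2 := tri_mem_order b F hx hx (tri_mem_order b F hx hy hx)
  have h3 := tri_mem_order b F hx (tri_mem_order b F hx hx hy) hx
  have h4 := tri_mem_order b F hy hx (tri_mem_order b F hx hx hx)
  have h5 := tri_mem_order b F hx (tri_mem_order b F hx hx hx) hy
  rw [jordanDefect]
  exact sub_mem (add_mem (sub_mem (add_mem (smul_mem_order _ h1) (smul_mem_order _ h2))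
    (smul_mem_order _ h3)) (smul_mem_order _ h4)) (smul_mem_order _ h5)

lemma nabla_sub_mem_order {x y : ι → DiffPoly K ι} {k : ℕ} (hx : x ∈ order K ι k)
    (hxy : x - y ∈ order K ι (k + 1)) :
    nabla b A x - vec (totalD K ι) y ∈ order K ι (k + 1) := by
  have e : nabla b A x - vec (totalD K ι) y
      = vec (totalD K ι) (x - y) + bil (extOp b A) (jet K ι 0) x := by
    rw [nabla, gauge, LinearMap.add_apply, map_sub]
    abel
  rw [e]
  exact add_mem (vec_totalD_mem_order hxy)
    (order_mono (by omega) (bil_mem_order b A (jet_mem_order 0) hx))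

/-- The leading terms of the symmetry equation for a system `G` close to the model one: since the
curvatures contribute only to higher degrees, what remains in lowest degree is the quintic
obstruction and the linearised equation for the deviation. -/
lemma leading_symmetry_equation (h : Compatible (bil A) (tri F)) {B : Op K V 3}
    (hB : IsModel A B F) {G : ι → DiffPoly K ι} (hG : G ∈ order K ι 1)
    (hS : IsSymmetry (mkdvRHS b A B) G) {m : ℕ} (hm : m + 1 ≤ 5)
    (hq : G - modelRHS b A F ∈ order K ι (m + 1)) :
    quinticObstruction (tri (extOp b F)) (covU b A 0) (covU b A 1) (covU b A 2) (covU b A 3)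
      + (vec (evolField (jet K ι 3)) (G - modelRHS b A F)
        - vec (totalD K ι) (vec (totalD K ι) (vec (totalD K ι) (G - modelRHS b A F))))
      ∈ order K ι (m + 2) := by
  classical
  have hτ := nablaTau_jet b h G
  set q := G - modelRHS b A F with hqdef
  set r := q - quinticTerm (tri (extOp b F)) (covU b A 0) (covU b A 1)
      - jordanDefect (tri (extOp b F)) (covU b A 0) (covU b A 1) with hrdef
  have hr : r ∈ order K ι (m + 1) :=
    sub_mem (sub_mem hq (order_mono hm (quinticTerm_mem_order b (covU_mem_order b 0)
      (covU_mem_order b 1)))) (order_mono hm (jordanDefect_mem_order b (covU_mem_order b 0)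
      (covU_mem_order b 1)))
  have hcomm : vec (evolField (mkdvRHS b A B)) (vec (evolField G) (jet K ι 0))
      - vec (evolField G) (vec (evolField (mkdvRHS b A B)) (jet K ι 0)) = 0 := by
    rw [vec_evolField_jet_zero, vec_evolField_jet_zero, (isSymmetry_iff _ _).1 hS, sub_self]
  have hcurv : curvature b A F (mkdvRHS b A B) G (jet K ι 0) ∈ order K ι (m + 2) := by
    have := curvature_smul_and_mem_order b h hB hG hτ hr fun k _ _ => by
      rw [hcomm]
      exact zero_mem _
    exact map_mem_order_of_const this.1 this.2 (jet_mem_order 0)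
  rw [comm_evolField_eq b (A := A) (F := F), sub_eq_zero, ← covU_zero b (A := A)] at hcomm
  have hfc := flow_commutator (fun x y z => (compatible_ext b h).symm x y z)
    (isTripleDer_nabla b h) (isTripleDer_nablaT b h (mkdvRHS b A B))
    (isTripleDer_nablaTau b h G) (nabla_covU b) (nablaT_jet b h hB) (nablaT_covU_succ b h hB)
    hτ (ρ := fun k => bil (extOp b A) r (covU b A k))
    (fun k => by rw [← nabla_covU, nablaTau_nabla b h hτ])
  rw [hcomm] at hfc
  have hρ : ∀ k, bil (extOp b A) r (covU b A k) ∈ order K ι (m + 2) := fun k =>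
    (bil_mem_order b A hr (covU_mem_order b k) : _ ∈ order K ι (m + 1 + 1))
  have hN : ∀ {k : ℕ} {w : ι → DiffPoly K ι}, w ∈ order K ι k → nabla b A w ∈ order K ι k :=
    fun hw => gauge_mem_order b hw
  have h0 := covU_mem_order b (A := A) 0
  have h1 := covU_mem_order b (A := A) 1
  have e1 := add_mem (add_mem (hN (hN (hρ 0))) (hN (hρ 1))) (hρ 2)
  have e2 : (6 : K) • (tri (extOp b F) q (covU b A 0) (covU b A 1)
      + tri (extOp b F) (covU b A 0) q (covU b A 1)
      + tri (extOp b F) (covU b A 0) (covU b A 0) (nabla b A q + bil (extOp b A) r (covU b A 0)))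
      ∈ order K ι (m + 2) :=
    smul_mem_order _ (add_mem (add_mem (order_mono (by omega) (tri_mem_order b F hq h0 h1))
      (order_mono (by omega) (tri_mem_order b F h0 hq h1)))
      (order_mono (by omega) (tri_mem_order b F h0 h0 (add_mem (hN hq)
        (order_mono (Nat.le_succ _) (hρ 0))))))
  have e3 : nabla b A (nabla b A (nabla b A q))
      - vec (totalD K ι) (vec (totalD K ι) (vec (totalD K ι) q)) ∈ order K ι (m + 2) :=
    nabla_sub_mem_order b (hN (hN hq)) (nabla_sub_mem_order b (hN hq)
      (nabla_sub_mem_order b hq (by rw [sub_self]; exact zero_mem _)))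
  have e4 : nablaT b A F (mkdvRHS b A B) q - vec (evolField (jet K ι 3)) q
      ∈ order K ι (m + 2) := by
    have e : mkdvRHS b A B = jet K ι 3 + ((3 : K) • term b A ![0, 2]
        + (3 : K) • term b B ![0, 1, 0]) := by
      rw [mkdvRHS_eq, add_assoc]
    have e' : nablaT b A F (mkdvRHS b A B) q - vec (evolField (jet K ι 3)) q
        = vec (evolField ((3 : K) • term b A ![0, 2] + (3 : K) • term b B ![0, 1, 0])) q
          + timeForm (bil (extOp b A)) (tri (extOp b F)) (covU b A 0) (covU b A 1)
            (covU b A 2) q := by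
      rw [nablaT, LinearMap.add_apply, e, vec_evolField_add]
      abel
    rw [e']
    refine add_mem (vec_evolField_mem_order (add_mem
      (smul_mem_order _ (homog_le_order (term_mem_homog b A _)))
      (smul_mem_order _ (order_mono (by omega) (homog_le_order (term_mem_homog b B _))))) hq) ?_
    exact timeForm_mem_order b h h0 h1 (covU_mem_order b 2) hq
  have key := add_mem (add_mem (add_mem hcurv e1) e2) (sub_mem e3 e4)
  convert key using 1
  rw [← covU_zero b (A := A), hfc]
  abel

end LeadingTerms

/-! ### The Jordan identity from the quintic equation -/

section Combination

set_option linter.unusedSimpArgs false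

variable {K V : Type*} [Field K] [AddCommGroup V] [Module K V]

/-- The part of degree `3` in `w₀` and of degree `1` in `w₁` and `w₃` of the quintic equation. -/
def form₁₃ (K : Type*) {V : Type*} [Field K] [AddCommGroup V] [Module K V]
    (R M Ψ : V → V → V → V → V → V) (x y z u v : V) : V :=
    (60 : K) • R x y z u v + (60 : K) • R x y u z v + (60 : K) • R x u y z v
      + (60 : K) • M x y z u v + (60 : K) • R u x y z v + (60 : K) • R v x y z u
      - (3 : K) • Ψ x y z u v - (3 : K) • Ψ x y u z v - (3 : K) • Ψ x u y z v
      - (3 : K) • Ψ u x y z v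

/-- The part of degree `3` in `w₀` and of degree `2` in `w₂` of the quintic equation. -/
def form₂₂ (K : Type*) {V : Type*} [Field K] [AddCommGroup V] [Module K V]
    (R M Ψ : V → V → V → V → V → V) (x y z u v : V) : V :=
    (60 : K) • R x y z u v + (60 : K) • R x y u z v + (60 : K) • R x u y z v
      + (60 : K) • M x y z u v + (120 : K) • R u x y z v - (3 : K) • Ψ x y z u v
      - (3 : K) • Ψ x y u z v - (3 : K) • Ψ x u y z v - (3 : K) • Ψ u x y z v

/-- The part of degree `2` in `w₀` and `w₁` and of degree `1` in `w₂` of the quintic equation. -/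
def form₁₁₂ (K : Type*) {V : Type*} [Field K] [AddCommGroup V] [Module K V]
    (R M Ψ : V → V → V → V → V → V) (x y z u v : V) : V :=
    (240 : K) • R x y z u v + (60 : K) • R x y z v u + (120 : K) • R x z y u v
      + (60 : K) • R x z y v u + (180 : K) • R x z u y v + (60 : K) • R x v y z u
      + (60 : K) • R x v z y u + (60 : K) • M x y z u v + (60 : K) • M x y z v u
      + (60 : K) • M x z y u v + (60 : K) • M x z y v u + (180 : K) • R z x y u v
      + (60 : K) • R z x y v u + (240 : K) • R z x u y v + (120 : K) • R z u x y v
      + (60 : K) • R z v x y u + (120 : K) • M z x y u v + (60 : K) • M z x y v u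
      + (120 : K) • R v x y z u + (120 : K) • R v x z y u + (60 : K) • R v z x y u
      - (6 : K) • Ψ x y z u v - (3 : K) • Ψ x y z v u - (3 : K) • Ψ x y v z u
      - (6 : K) • Ψ x z y u v - (3 : K) • Ψ x z y v u - (6 : K) • Ψ x z u y v
      - (3 : K) • Ψ x z v y u - (3 : K) • Ψ x v y z u - (3 : K) • Ψ x v z y u
      - (6 : K) • Ψ z x y u v - (3 : K) • Ψ z x y v u - (6 : K) • Ψ z x u y v
      - (3 : K) • Ψ z x v y u - (6 : K) • Ψ z u x y v - (3 : K) • Ψ z v x y u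
      - (3 : K) • Ψ v x y z u - (3 : K) • Ψ v x z y u - (3 : K) • Ψ v z x y u

set_option maxHeartbeats 20000000 in
/-- The Jordan identity is a linear combination of permuted instances of the polarised parts of the
quintic equation, in which the unknown form `Ψ` cancels. Here `R x y u v z = f x y (f u v z)` and
`M x u v z y = f x (f u v z) y`. -/
lemma jordan_of_polarised [CharZero K] {R M Ψ : V → V → V → V → V → V}
    (hR : ∀ x y u v z, R x y u v z = R x y z v u) (hM : ∀ x y u v z, M x y u v z = M z y u v x)
    (hM' : ∀ x y u v z, M x y u v z = M x v u y z)
    (h₁₃ : ∀ x y z u v, form₁₃ K R M Ψ x y z u v + form₁₃ K R M Ψ x z y u v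
        + form₁₃ K R M Ψ y x z u v + form₁₃ K R M Ψ y z x u v
        + form₁₃ K R M Ψ z x y u v + form₁₃ K R M Ψ z y x u v = 0)
    (h₂₂ : ∀ x y z u v, form₂₂ K R M Ψ x y z u v + form₂₂ K R M Ψ x y z v u
        + form₂₂ K R M Ψ x z y u v + form₂₂ K R M Ψ x z y v u
        + form₂₂ K R M Ψ y x z u v + form₂₂ K R M Ψ y x z v u
        + form₂₂ K R M Ψ y z x u v + form₂₂ K R M Ψ y z x v u + form₂₂ K R M Ψ z x y u v
        + form₂₂ K R M Ψ z x y v u + form₂₂ K R M Ψ z y x u v + form₂₂ K R M Ψ z y x v u = 0)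
    (h₁₁₂ : ∀ x y z u v, form₁₁₂ K R M Ψ x y z u v + form₁₁₂ K R M Ψ x y u z v
        + form₁₁₂ K R M Ψ y x z u v + form₁₁₂ K R M Ψ y x u z v = 0)
    (x y z u v : V) : R x y u v z - R z v x y u - R u v x y z + M u y x v z = 0 := by
  have e1 := h₁₃ x z v u y
  have e2 := h₁₁₂ z u y v x
  have e3 := h₂₂ x y v z u
  have e4 := h₁₁₂ z u x v y
  have e5 := h₁₁₂ u v x z y
  have e6 := h₁₃ y z v u x
  have e7 := h₁₁₂ x y u v z
  have e8 := h₁₁₂ z v y u x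
  have e9 := h₁₃ y z u v x
  have e10 := h₁₃ y u v z x
  have e11 := h₁₃ x z u v y
  have e12 := h₁₁₂ x y z u v
  have e13 := h₁₁₂ u v y z x
  have e14 := h₁₃ x u v z y
  have e15 := h₁₁₂ x y z v u
  have e16 := h₁₁₂ z v x u y
  simp only [form₁₃, form₂₂, form₁₁₂, hR, hM, hM']
    at e1 e2 e3 e4 e5 e6 e7 e8 e9 e10 e11 e12 e13 e14 e15 e16 ⊢
  linear_combination (norm := module)
     -(1 / 240 : K) • e1 + (1 / 240 : K) • e2 - (1 / 120 : K) • e3 - (1 / 240 : K) • e4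
      + (1 / 240 : K) • e5 + (1 / 240 : K) • e6 + (1 / 240 : K) • e7 - (1 / 240 : K) • e8
      - (1 / 240 : K) • e9 + (1 / 240 : K) • e10 + (1 / 240 : K) • e11 - (1 / 240 : K) • e12
      - (1 / 240 : K) • e13 - (1 / 240 : K) • e14 + (1 / 240 : K) • e15 + (1 / 240 : K) • e16

/-- Polarisation of a cubic form. -/
lemma sum_perm_eq_zero_of_cubic {g : V → V → V → V}
    (h₁ : ∀ x x' y z, g (x + x') y z = g x y z + g x' y z)
    (h₂ : ∀ x y y' z, g x (y + y') z = g x y z + g x y' z)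
    (h₃ : ∀ x y z z', g x y (z + z') = g x y z + g x y z') (h : ∀ x, g x x x = 0) (x y z : V) :
    g x y z + g x z y + g y x z + g y z x + g z x y + g z y x = 0 := by
  have e1 := h (x + y + z)
  have e2 := h (x + y)
  have e3 := h (x + z)
  have e4 := h (y + z)
  simp only [h₁, h₂, h₃, h] at e1 e2 e3 e4
  linear_combination (norm := module) e1 - e2 - e3 - e4

/-- Polarisation of a quadratic form. -/
lemma sum_swap_eq_zero {g : V → V → V} (h₁ : ∀ x x' y, g (x + x') y = g x y + g x' y)
    (h₂ : ∀ x y y', g x (y + y') = g x y + g x y') (h : ∀ x, g x x = 0) (x y : V) :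
    g x y + g y x = 0 := by
  have e1 := h (x + y)
  simp only [h₁, h₂, h] at e1
  linear_combination (norm := module) e1

/-- The value of `D³ Ψ - δ Ψ` on `(w₀, w₀, w₀, w₀, w₁)`, for derivations with `D w_k = w_{k+1}` and
`δ w_k = w_{k+3}`. -/
def cubeLeibniz (K : Type*) {V : Type*} [Field K] [AddCommGroup V] [Module K V]
    (Ψ : V → V → V → V → V → V) (w₀ w₁ w₂ w₃ : V) : V :=
    (3 : K) • Ψ w₀ w₀ w₀ w₁ w₃ + (3 : K) • Ψ w₀ w₀ w₀ w₂ w₂ + (3 : K) • Ψ w₀ w₀ w₁ w₀ w₃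
      + (6 : K) • Ψ w₀ w₀ w₁ w₁ w₂ + (3 : K) • Ψ w₀ w₀ w₁ w₂ w₁ + (3 : K) • Ψ w₀ w₀ w₂ w₀ w₂
      + (3 : K) • Ψ w₀ w₀ w₂ w₁ w₁ + (3 : K) • Ψ w₀ w₁ w₀ w₀ w₃ + (6 : K) • Ψ w₀ w₁ w₀ w₁ w₂
      + (3 : K) • Ψ w₀ w₁ w₀ w₂ w₁ + (6 : K) • Ψ w₀ w₁ w₁ w₀ w₂ + (6 : K) • Ψ w₀ w₁ w₁ w₁ w₁
      + (3 : K) • Ψ w₀ w₁ w₂ w₀ w₁ + (3 : K) • Ψ w₀ w₂ w₀ w₀ w₂ + (3 : K) • Ψ w₀ w₂ w₀ w₁ w₁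
      + (3 : K) • Ψ w₀ w₂ w₁ w₀ w₁ + (3 : K) • Ψ w₁ w₀ w₀ w₀ w₃ + (6 : K) • Ψ w₁ w₀ w₀ w₁ w₂
      + (3 : K) • Ψ w₁ w₀ w₀ w₂ w₁ + (6 : K) • Ψ w₁ w₀ w₁ w₀ w₂ + (6 : K) • Ψ w₁ w₀ w₁ w₁ w₁
      + (3 : K) • Ψ w₁ w₀ w₂ w₀ w₁ + (6 : K) • Ψ w₁ w₁ w₀ w₀ w₂ + (6 : K) • Ψ w₁ w₁ w₀ w₁ w₁
      + (6 : K) • Ψ w₁ w₁ w₁ w₀ w₁ + (3 : K) • Ψ w₁ w₂ w₀ w₀ w₁ + (3 : K) • Ψ w₂ w₀ w₀ w₀ w₂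
      + (3 : K) • Ψ w₂ w₀ w₀ w₁ w₁ + (3 : K) • Ψ w₂ w₀ w₁ w₀ w₁ + (3 : K) • Ψ w₂ w₁ w₀ w₀ w₁

/-- The quintic obstruction, expressed through the products `R x y u v z = f x y (f u v z)` and
`M x u v z y = f x (f u v z) y`. -/
def quinticForm (K : Type*) {V : Type*} [Field K] [AddCommGroup V] [Module K V]
    (R M : V → V → V → V → V → V) (w₀ w₁ w₂ w₃ : V) : V :=
    (60 : K) • R w₀ w₀ w₀ w₁ w₃ + (60 : K) • R w₀ w₀ w₀ w₂ w₂
      + (60 : K) • R w₀ w₀ w₁ w₀ w₃ + (240 : K) • R w₀ w₀ w₁ w₁ w₂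
      + (60 : K) • R w₀ w₀ w₁ w₂ w₁ + (60 : K) • R w₀ w₀ w₂ w₀ w₂
      + (60 : K) • R w₀ w₁ w₀ w₀ w₃ + (120 : K) • R w₀ w₁ w₀ w₁ w₂
      + (60 : K) • R w₀ w₁ w₀ w₂ w₁ + (180 : K) • R w₀ w₁ w₁ w₀ w₂
      + (120 : K) • R w₀ w₁ w₁ w₁ w₁ + (60 : K) • R w₀ w₂ w₀ w₀ w₂
      + (60 : K) • R w₀ w₂ w₀ w₁ w₁ + (60 : K) • R w₀ w₂ w₁ w₀ w₁
      + (60 : K) • M w₀ w₀ w₀ w₁ w₃ + (60 : K) • M w₀ w₀ w₀ w₂ w₂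
      + (60 : K) • M w₀ w₀ w₁ w₁ w₂ + (60 : K) • M w₀ w₀ w₁ w₂ w₁
      + (60 : K) • M w₀ w₁ w₀ w₁ w₂ + (60 : K) • M w₀ w₁ w₀ w₂ w₁
      + (60 : K) • M w₀ w₁ w₁ w₁ w₁ + (60 : K) • R w₁ w₀ w₀ w₀ w₃
      + (180 : K) • R w₁ w₀ w₀ w₁ w₂ + (60 : K) • R w₁ w₀ w₀ w₂ w₁
      + (240 : K) • R w₁ w₀ w₁ w₀ w₂ + (180 : K) • R w₁ w₀ w₁ w₁ w₁
      + (120 : K) • R w₁ w₁ w₀ w₀ w₂ + (120 : K) • R w₁ w₁ w₀ w₁ w₁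
      + (120 : K) • R w₁ w₁ w₁ w₀ w₁ + (60 : K) • R w₁ w₂ w₀ w₀ w₁
      + (120 : K) • M w₁ w₀ w₀ w₁ w₂ + (60 : K) • M w₁ w₀ w₀ w₂ w₁
      + (60 : K) • M w₁ w₀ w₁ w₁ w₁ + (60 : K) • M w₁ w₁ w₀ w₁ w₁
      + (120 : K) • R w₂ w₀ w₀ w₀ w₂ + (120 : K) • R w₂ w₀ w₀ w₁ w₁
      + (120 : K) • R w₂ w₀ w₁ w₀ w₁ + (60 : K) • R w₂ w₁ w₀ w₀ w₁
      + (60 : K) • R w₃ w₀ w₀ w₀ w₁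

/-- Additivity in each of five arguments. -/
structure PentaAdditive (T : V → V → V → V → V → V) : Prop where
  add₁ : ∀ x x' y z u v, T (x + x') y z u v = T x y z u v + T x' y z u v
  add₂ : ∀ x y y' z u v, T x (y + y') z u v = T x y z u v + T x y' z u v
  add₃ : ∀ x y z z' u v, T x y (z + z') u v = T x y z u v + T x y z' u v
  add₄ : ∀ x y z u u' v, T x y z (u + u') v = T x y z u v + T x y z u' v
  add₅ : ∀ x y z u v v', T x y z u (v + v') = T x y z u v + T x y z u v'

namespace PentaAdditive

variable {T : V → V → V → V → V → V} (hT : PentaAdditive T)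

include hT

lemma zero₁ (y z u v : V) : T 0 y z u v = 0 := by simpa using hT.add₁ 0 0 y z u v

lemma zero₂ (x z u v : V) : T x 0 z u v = 0 := by simpa using hT.add₂ x 0 0 z u v

lemma zero₃ (x y u v : V) : T x y 0 u v = 0 := by simpa using hT.add₃ x y 0 0 u v

lemma zero₄ (x y z v : V) : T x y z 0 v = 0 := by simpa using hT.add₄ x y z 0 0 v

lemma zero₅ (x y z u : V) : T x y z u 0 = 0 := by simpa using hT.add₅ x y z u 0 0

end PentaAdditive

section

variable {R M Ψ : V → V → V → V → V → V} (hR : PentaAdditive R) (hM : PentaAdditive M)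
  (hΨ : PentaAdditive Ψ)

include hR hM hΨ

lemma form₁₃_sum_eq_zero (h : ∀ x u v, form₁₃ K R M Ψ x x x u v = 0) (x y z u v : V) :
    form₁₃ K R M Ψ x y z u v + form₁₃ K R M Ψ x z y u v + form₁₃ K R M Ψ y x z u v
      + form₁₃ K R M Ψ y z x u v + form₁₃ K R M Ψ z x y u v + form₁₃ K R M Ψ z y x u v = 0 := by
  refine sum_perm_eq_zero_of_cubic (g := fun x y z => form₁₃ K R M Ψ x y z u v) ?_ ?_ ?_
    (fun x => h x u v) x y z
  all_goals
    intros
    simp only [form₁₃, hR.add₁, hR.add₂, hR.add₃, hR.add₄, hR.add₅, hM.add₁, hM.add₂, hM.add₃,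
      hM.add₄, hM.add₅, hΨ.add₁, hΨ.add₂, hΨ.add₃, hΨ.add₄, hΨ.add₅]
    module

lemma form₂₂_sum_eq_zero (h : ∀ x u, form₂₂ K R M Ψ x x x u u = 0) (x y z u v : V) :
    form₂₂ K R M Ψ x y z u v + form₂₂ K R M Ψ x y z v u + form₂₂ K R M Ψ x z y u v
      + form₂₂ K R M Ψ x z y v u + form₂₂ K R M Ψ y x z u v + form₂₂ K R M Ψ y x z v u
      + form₂₂ K R M Ψ y z x u v + form₂₂ K R M Ψ y z x v u + form₂₂ K R M Ψ z x y u v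
      + form₂₂ K R M Ψ z x y v u + form₂₂ K R M Ψ z y x u v + form₂₂ K R M Ψ z y x v u = 0 := by
  have h' : ∀ x, form₂₂ K R M Ψ x x x u v + form₂₂ K R M Ψ x x x v u = 0 := fun x => by
    refine sum_swap_eq_zero (g := fun u v => form₂₂ K R M Ψ x x x u v) ?_ ?_ (h x) u v
    all_goals
      intros
      simp only [form₂₂, hR.add₁, hR.add₂, hR.add₃, hR.add₄, hR.add₅, hM.add₁, hM.add₂, hM.add₃,
        hM.add₄, hM.add₅, hΨ.add₁, hΨ.add₂, hΨ.add₃, hΨ.add₄, hΨ.add₅]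
      module
  have e := sum_perm_eq_zero_of_cubic (g := fun x y z => form₂₂ K R M Ψ x y z u v
    + form₂₂ K R M Ψ x y z v u) ?_ ?_ ?_ h' x y z
  · simpa only [add_assoc] using e
  all_goals
    intros
    simp only [form₂₂, hR.add₁, hR.add₂, hR.add₃, hR.add₄, hR.add₅, hM.add₁, hM.add₂, hM.add₃,
      hM.add₄, hM.add₅, hΨ.add₁, hΨ.add₂, hΨ.add₃, hΨ.add₄, hΨ.add₅]
    module

lemma form₁₁₂_sum_eq_zero (h : ∀ x z v, form₁₁₂ K R M Ψ x x z z v = 0) (x y z u v : V) :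
    form₁₁₂ K R M Ψ x y z u v + form₁₁₂ K R M Ψ x y u z v + form₁₁₂ K R M Ψ y x z u v
      + form₁₁₂ K R M Ψ y x u z v = 0 := by
  have h' : ∀ x, form₁₁₂ K R M Ψ x x z u v + form₁₁₂ K R M Ψ x x u z v = 0 := fun x => by
    refine sum_swap_eq_zero (g := fun z u => form₁₁₂ K R M Ψ x x z u v) ?_ ?_
      (fun z => h x z v) z u
    all_goals
      intros
      simp only [form₁₁₂, hR.add₁, hR.add₂, hR.add₃, hR.add₄, hR.add₅, hM.add₁, hM.add₂, hM.add₃,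
        hM.add₄, hM.add₅, hΨ.add₁, hΨ.add₂, hΨ.add₃, hΨ.add₄, hΨ.add₅]
      module
  have e := sum_swap_eq_zero (g := fun x y => form₁₁₂ K R M Ψ x y z u v
    + form₁₁₂ K R M Ψ x y u z v) ?_ ?_ h' x y
  · simpa only [add_assoc] using e
  all_goals
    intros
    simp only [form₁₁₂, hR.add₁, hR.add₂, hR.add₃, hR.add₄, hR.add₅, hM.add₁, hM.add₂, hM.add₃,
      hM.add₄, hM.add₅, hΨ.add₁, hΨ.add₂, hΨ.add₃, hΨ.add₄, hΨ.add₅]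
    module

/-- Setting some of the `w_k` to zero in the quintic equation isolates its part of the given
degrees. -/
lemma form₁₃_eq_zero
    (h : ∀ w₀ w₁ w₂ w₃, quinticForm K R M w₀ w₁ w₂ w₃ = cubeLeibniz K Ψ w₀ w₁ w₂ w₃)
    (x u v : V) : form₁₃ K R M Ψ x x x u v = 0 := by
  have e1 := h x u 0 v
  have e2 := h x u 0 0
  simp only [quinticForm, cubeLeibniz, hR.zero₁, hR.zero₂, hR.zero₃, hR.zero₄, hR.zero₅, hM.zero₁,
    hM.zero₂, hM.zero₃, hM.zero₄, hM.zero₅, hΨ.zero₁, hΨ.zero₂, hΨ.zero₃, hΨ.zero₄, hΨ.zero₅,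
    smul_zero] at e1 e2
  simp only [form₁₃]
  linear_combination (norm := module) e1 - e2

lemma form₂₂_eq_zero
    (h : ∀ w₀ w₁ w₂ w₃, quinticForm K R M w₀ w₁ w₂ w₃ = cubeLeibniz K Ψ w₀ w₁ w₂ w₃)
    (x u : V) : form₂₂ K R M Ψ x x x u u = 0 := by
  have e1 := h x 0 u 0
  simp only [quinticForm, cubeLeibniz, hR.zero₁, hR.zero₂, hR.zero₃, hR.zero₄, hR.zero₅, hM.zero₁,
    hM.zero₂, hM.zero₃, hM.zero₄, hM.zero₅, hΨ.zero₁, hΨ.zero₂, hΨ.zero₃, hΨ.zero₄, hΨ.zero₅,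
    smul_zero] at e1
  simp only [form₂₂]
  linear_combination (norm := module) e1

lemma form₁₁₂_eq_zero
    (h : ∀ w₀ w₁ w₂ w₃, quinticForm K R M w₀ w₁ w₂ w₃ = cubeLeibniz K Ψ w₀ w₁ w₂ w₃)
    (x u v : V) : form₁₁₂ K R M Ψ x x u u v = 0 := by
  have e1 := h x u v 0
  have e2 := h x 0 v 0
  have e3 := h x u 0 0
  simp only [quinticForm, cubeLeibniz, hR.zero₁, hR.zero₂, hR.zero₃, hR.zero₄, hR.zero₅, hM.zero₁,
    hM.zero₂, hM.zero₃, hM.zero₄, hM.zero₅, hΨ.zero₁, hΨ.zero₂, hΨ.zero₃, hΨ.zero₄, hΨ.zero₅,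
    smul_zero] at e1 e2 e3
  simp only [form₁₁₂]
  linear_combination (norm := module) e1 - e2 - e3

end

variable {f : V →ₗ[K] V →ₗ[K] V →ₗ[K] V} {Ψ : V →ₗ[K] V →ₗ[K] V →ₗ[K] V →ₗ[K] V →ₗ[K] V}

/-- The Jordan identity is a consequence of the degree-five part of the symmetry equation. -/
lemma jordan_of_quintic [CharZero K] (hs : ∀ x y z, f x y z = f z y x)
    (h : ∀ w₀ w₁ w₂ w₃, quinticObstruction f w₀ w₁ w₂ w₃
      = cubeLeibniz K (fun x y z u v => Ψ x y z u v) w₀ w₁ w₂ w₃) : JordanTriple f where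
  symm := hs
  jordan x y z u v := by
    have aR : PentaAdditive fun x y u v z => f x y (f u v z) := by
      constructor <;> intros <;> simp only [map_add, LinearMap.add_apply]
    have aM : PentaAdditive fun x u v z y => f x (f u v z) y := by
      constructor <;> intros <;> simp only [map_add, LinearMap.add_apply]
    have aΨ : PentaAdditive fun x y z u v => Ψ x y z u v := by
      constructor <;> intros <;> simp only [map_add, LinearMap.add_apply]
    have h' : ∀ w₀ w₁ w₂ w₃, quinticForm K (fun x y u v z => f x y (f u v z))
        (fun x u v z y => f x (f u v z) y) w₀ w₁ w₂ w₃
        = cubeLeibniz K (fun x y z u v => Ψ x y z u v) w₀ w₁ w₂ w₃ := h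
    have e := jordan_of_polarised (fun x y u v z => by rw [hs u v z])
      (fun x y u v z => by rw [hs x]) (fun x y u v z => by rw [hs y u v])
      (form₁₃_sum_eq_zero aR aM aΨ (form₁₃_eq_zero aR aM aΨ h'))
      (form₂₂_sum_eq_zero aR aM aΨ (form₂₂_eq_zero aR aM aΨ h'))
      (form₁₁₂_sum_eq_zero aR aM aΨ (form₁₁₂_eq_zero aR aM aΨ h')) x y z u v
    rw [hs (f x y u)]
    exact e

end Combination

/-! ### Operations of arity four and five on differential polynomials -/

section HigherArity

variable {K V ι : Type*} [Field K] [CharZero K] [AddCommGroup V] [Module K V] [Fintype ι]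
  (b : Module.Basis ι K V)

lemma evalAt_quad (C : Op K V 4) (p : ι × ℕ → K) (x y z t : ι → DiffPoly K ι) :
    evalAt b p (quad (extOp b C) x y z t)
      = quad C (evalAt b p x) (evalAt b p y) (evalAt b p z) (evalAt b p t) := by
  rw [quad_apply, evalAt_extOp, quad_apply]
  congr 1
  funext s
  fin_cases s <;> rfl

lemma evalAt_quint (E : Op K V 5) (p : ι × ℕ → K) (x y z t u : ι → DiffPoly K ι) :
    evalAt b p (quint (extOp b E) x y z t u)
      = quint E (evalAt b p x) (evalAt b p y) (evalAt b p z) (evalAt b p t) (evalAt b p u) := by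
  rw [quint_apply, evalAt_extOp, quint_apply]
  congr 1
  funext s
  fin_cases s <;> rfl

lemma vec_quad (δ : Derivation K (DiffPoly K ι) (DiffPoly K ι)) (C : Op K V 4)
    (x y z t : ι → DiffPoly K ι) :
    vec δ (quad (extOp b C) x y z t)
      = quad (extOp b C) (vec δ x) y z t + quad (extOp b C) x (vec δ y) z t
        + quad (extOp b C) x y (vec δ z) t + quad (extOp b C) x y z (vec δ t) := by
  simp only [quad_apply]
  rw [vec_extOp, Fin.sum_univ_four]
  refine congrArg₂ _ (congrArg₂ _ (congrArg₂ _ ?_ ?_) ?_) ?_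
  all_goals exact congrArg _ (funext fun s => by fin_cases s <;> rfl)

lemma vec_quint (δ : Derivation K (DiffPoly K ι) (DiffPoly K ι)) (E : Op K V 5)
    (x y z t u : ι → DiffPoly K ι) :
    vec δ (quint (extOp b E) x y z t u)
      = quint (extOp b E) (vec δ x) y z t u + quint (extOp b E) x (vec δ y) z t u
        + quint (extOp b E) x y (vec δ z) t u + quint (extOp b E) x y z (vec δ t) u
        + quint (extOp b E) x y z t (vec δ u) := by
  simp only [quint_apply]
  rw [vec_extOp, Fin.sum_univ_five]
  refine congrArg₂ _ (congrArg₂ _ (congrArg₂ _ (congrArg₂ _ ?_ ?_) ?_) ?_) ?_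
  all_goals exact congrArg _ (funext fun s => by fin_cases s <;> rfl)

omit [CharZero K] [Fintype ι] in
lemma vec_evolField_jet_three (k : ℕ) :
    vec (evolField (jet K ι 3)) (jet K ι k) = jet K ι (k + 3) := by
  induction k with
  | zero => rw [vec_evolField_jet_zero]
  | succ k ih => rw [vec_evolField_jet_succ, ih, vec_totalD_jet, Nat.add_right_comm]

omit [Fintype ι] in
/-- `D³ - δ` is injective on the terms of degree at least two, degree by degree; here `δ` is the
evolutionary field of `U_t = U₃`. -/
lemma mem_order_of_cube_sub_mem {k : ℕ} {q : ι → DiffPoly K ι} (h0 : q ∈ order K ι 2)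
    (h : vec (evolField (jet K ι 3)) q
      - vec (totalD K ι) (vec (totalD K ι) (vec (totalD K ι) q)) ∈ order K ι k) :
    q ∈ order K ι k := by
  rw [← neg_mem_iff, neg_sub] at h
  exact mem_order.2 fun i => mem_pow_of_totalD_cube_sub_mem (mem_order.1 h0 i)
    (mem_order.1 h i)

omit [CharZero K] [Fintype ι] in
lemma vec_cube_sub_mem_homog {k : ℕ} {q : ι → DiffPoly K ι} (h : q ∈ homog K ι (k + 1)) :
    vec (evolField (jet K ι 3)) q
      - vec (totalD K ι) (vec (totalD K ι) (vec (totalD K ι) q)) ∈ homog K ι (k + 1) :=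
  sub_mem (vec_evolField_mem_homog (jet_mem_homog 3) h)
    (vec_totalD_mem_homog (vec_totalD_mem_homog (vec_totalD_mem_homog h)))

end HigherArity

/-! ### Necessity of the Jordan identity -/

section Quintic

variable {K V : Type*} [Field K] [AddCommGroup V] [Module K V]

lemma cube_sub_eq_cubeLeibniz {Ψ : V → V → V → V → V → V} {D δ : V →ₗ[K] V}
    (hD : ∀ x y z t u, D (Ψ x y z t u) = Ψ (D x) y z t u + Ψ x (D y) z t u + Ψ x y (D z) t u
      + Ψ x y z (D t) u + Ψ x y z t (D u))
    (hδ : ∀ x y z t u, δ (Ψ x y z t u) = Ψ (δ x) y z t u + Ψ x (δ y) z t u + Ψ x y (δ z) t u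
      + Ψ x y z (δ t) u + Ψ x y z t (δ u))
    {w : ℕ → V} (hDw : ∀ k, D (w k) = w (k + 1)) (hδw : ∀ k, δ (w k) = w (k + 3)) :
    D (D (D (Ψ (w 0) (w 0) (w 0) (w 0) (w 1)))) - δ (Ψ (w 0) (w 0) (w 0) (w 0) (w 1))
      = cubeLeibniz K Ψ (w 0) (w 1) (w 2) (w 3) := by
  simp only [hD, hδ, hDw, hδw, map_add, cubeLeibniz, Nat.reduceAdd]
  module

end Quintic

section JordanNecessary

variable {K V ι : Type*} [Field K] [CharZero K] [AddCommGroup V] [Module K V] [Fintype ι]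
  (b : Module.Basis ι K V) {A : Op K V 2} {B F : Op K V 3}

lemma quint_mem_homog (E : Op K V 5) : quint (extOp b E) (jet K ι 0) (jet K ι 0) (jet K ι 0)
    (jet K ι 0) (jet K ι 1) ∈ homog K ι 5 := by
  rw [quint_apply, ← term_five]
  exact term_mem_homog b E _

lemma evalAt_quinticObstruction (p : ι × ℕ → K) (w₀ w₁ w₂ w₃ : ι → DiffPoly K ι) :
    evalAt b p (quinticObstruction (tri (extOp b F)) w₀ w₁ w₂ w₃)
      = quinticObstruction (tri F) (evalAt b p w₀) (evalAt b p w₁) (evalAt b p w₂)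
        (evalAt b p w₃) := by
  simp only [quinticObstruction, map_add, map_smul, evalAt_tri]

lemma evalAt_cubeLeibniz (E : Op K V 5) (p : ι × ℕ → K) (w₀ w₁ w₂ w₃ : ι → DiffPoly K ι) :
    evalAt b p (cubeLeibniz K (fun x y z t u => quint (extOp b E) x y z t u) w₀ w₁ w₂ w₃)
      = cubeLeibniz K (fun x y z t u => quint E x y z t u) (evalAt b p w₀) (evalAt b p w₁)
        (evalAt b p w₂) (evalAt b p w₃) := by
  simp only [cubeLeibniz, map_add, map_smul, evalAt_quint]

/-- The Jordan identity is necessary: the terms of degree five of the symmetry equation express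
the quintic obstruction through the quintic terms of the symmetry. -/
theorem jordanTriple_of_isSymmetry (h : Compatible (bil A) (tri F)) (hB : IsModel A B F)
    {G : ι → DiffPoly K ι} (hG : G ∈ order K ι 1) (hS : IsSymmetry (mkdvRHS b A B) G)
    {q : ι → DiffPoly K ι} (hq : q ∈ homog K ι 4) (E : Op K V 5)
    (hqE : G - modelRHS b A F = q + term b E ![0, 0, 0, 0, 1]) : JordanTriple (tri F) := by
  have hobs := quinticObstruction_hasLeadingTerm b (F := F)
    (fun k => covU_hasLeadingTerm b (A := A) k)
  rw [term_five, ← quint_apply] at hqE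
  have hQ := quint_mem_homog b (ι := ι) E
  have h4 : q + quint (extOp b E) (jet K ι 0) (jet K ι 0) (jet K ι 0) (jet K ι 0) (jet K ι 1)
      ∈ order K ι 4 :=
    add_mem (homog_le_order hq) (order_mono (by omega) (homog_le_order hQ))
  have e4 := leading_symmetry_equation b h hB hG hS (m := 3) (by omega) (by rw [hqE]; exact h4)
  have h5 := mem_order_of_cube_sub_mem (order_mono (by omega) (hqE ▸ h4))
    ((add_mem_cancel_left hobs.mem_order).1 e4)
  have hq0 : q = 0 := by
    refine eq_zero_of_mem_homog_of_mem_order hq ?_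
    rw [hqE] at h5
    exact (add_mem_cancel_right (homog_le_order hQ)).1 h5
  have e5 := leading_symmetry_equation b h hB hG hS (m := 4) le_rfl h5
  rw [hqE, hq0, zero_add] at e5
  have e6 := sub_mem e5 hobs.2
  rw [show ∀ x y z : ι → DiffPoly K ι, x + y - (x - z) = z + y from fun x y z => by abel] at e6
  have e7 := eq_zero_of_mem_homog_of_mem_order
    (add_mem hobs.1 (vec_cube_sub_mem_homog hQ)) e6
  rw [add_eq_zero_iff_eq_neg, neg_sub, cube_sub_eq_cubeLeibniz
    (Ψ := fun x y z t u => quint (extOp b E) x y z t u) (fun _ _ _ _ _ => vec_quint b _ _ _ _ _ _ _)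
    (fun _ _ _ _ _ => vec_quint b _ _ _ _ _ _ _) vec_totalD_jet vec_evolField_jet_three] at e7
  refine jordan_of_quintic h.symm (Ψ := quint E) fun w₀ w₁ w₂ w₃ => ?_
  obtain ⟨p, hp⟩ := exists_evalAt_jet b
    fun k => match k with | 0 => w₀ | 1 => w₁ | 2 => w₂ | _ => w₃
  have := congrArg (evalAt b p) e7
  rw [evalAt_quinticObstruction, evalAt_cubeLeibniz] at this
  simpa only [hp] using this

end JordanNecessary

/-! ### The commutator in degrees two, three and four -/

section LowDegree

set_option linter.unusedSimpArgs false
set_option linter.unusedSectionVars false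

variable {K V : Type*} [Field K] [AddCommGroup V] [Module K V]

/-- `T` acts as the evolutionary field of `U_t = X` on the jets `w k` and on the operations `a` and
`f`; here `D` is the total derivative. -/
structure IsEvolution (a : V →ₗ[K] V →ₗ[K] V) (f : V →ₗ[K] V →ₗ[K] V →ₗ[K] V) (D : V →ₗ[K] V)
    (w : ℕ → V) (X : V) (T : V →ₗ[K] V) : Prop where
  der : IsDer a f T
  zero : T (w 0) = X
  succ : ∀ k, T (w (k + 1)) = D (T (w k))

variable (a : V →ₗ[K] V →ₗ[K] V) (f : V →ₗ[K] V →ₗ[K] V →ₗ[K] V) (w : ℕ → V)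

/-- The quadratic terms of the third-order system. -/
def thirdQuadratic : V := (3 : K) • a (w 0) (w 2)

/-- The cubic terms of the third-order system. -/
def thirdCubic : V := (6 : K) • f (w 0) (w 0) (w 1) + (3 : K) • a (w 0) (a (w 0) (w 1))

/-- The quadratic terms of the fifth-order symmetry. -/
def fifthQuadratic : V := (5 : K) • a (w 0) (w 4) + (5 : K) • a (w 1) (w 3)

/-- The cubic terms of the fifth-order symmetry, in terms of the ordinary jets. -/
def fifthTernary : V :=
    (10 : K) • f (w 0) (w 0) (w 3) + (10 : K) • f (w 0) (w 1) (w 2)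
      + (10 : K) • f (w 0) (w 2) (w 1) + (20 : K) • f (w 1) (w 0) (w 2)
      + (10 : K) • f (w 1) (w 1) (w 1) + (10 : K) • a (w 0) (a (w 0) (w 3))
      + (5 : K) • a (w 0) (a (w 1) (w 2)) + (5 : K) • a (w 1) (a (w 0) (w 2))

/-- The terms of degree four in the commutator of the systems with the quadratic and cubic terms
`thirdQuadratic`, `thirdCubic` and `fifthQuadratic`, `fifthTernary`. -/
def quarticForm (w₀ w₁ w₂ w₃ w₄ : V) : V :=
    (30 : K) • a w₀ (f w₀ w₁ w₄) + (60 : K) • a w₀ (f w₀ w₂ w₃) + (30 : K) • a w₀ (f w₀ w₃ w₂)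
      + (30 : K) • a w₀ (f w₁ w₀ w₄) + (180 : K) • a w₀ (f w₁ w₁ w₃)
      + (210 : K) • a w₀ (f w₁ w₂ w₂) + (30 : K) • a w₀ (f w₁ w₃ w₁)
      + (90 : K) • a w₀ (f w₂ w₀ w₃) + (150 : K) • a w₀ (f w₂ w₁ w₂)
      + (30 : K) • a w₁ (f w₀ w₀ w₄) + (90 : K) • a w₁ (f w₀ w₁ w₃)
      + (90 : K) • a w₁ (f w₀ w₂ w₂) + (30 : K) • a w₁ (f w₀ w₃ w₁)
      + (120 : K) • a w₁ (f w₁ w₀ w₃) + (270 : K) • a w₁ (f w₁ w₁ w₂)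
      + (90 : K) • a w₁ (f w₁ w₂ w₁) + (90 : K) • a w₁ (f w₂ w₀ w₂)
      + (30 : K) • a w₂ (f w₀ w₀ w₃) + (30 : K) • a w₂ (f w₀ w₁ w₂)
      + (30 : K) • a w₂ (f w₀ w₂ w₁) + (60 : K) • a w₂ (f w₁ w₀ w₂)
      + (30 : K) • a w₂ (f w₁ w₁ w₁) - (30 : K) • a w₃ (f w₀ w₀ w₂)
      - (30 : K) • a w₃ (f w₀ w₁ w₁) - (30 : K) • a w₃ (f w₁ w₀ w₁)
      - (30 : K) • a w₄ (f w₀ w₀ w₁) + (30 : K) • f w₀ (a w₀ w₂) w₃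
      + (30 : K) • f w₀ (a w₀ w₃) w₂ + (30 : K) • f w₀ (a w₁ w₂) w₂
      + (30 : K) • f w₀ (a w₁ w₃) w₁ + (30 : K) • f w₀ w₀ (a w₁ w₄)
      + (30 : K) • f w₀ w₀ (a w₂ w₃) + (30 : K) • f w₀ w₁ (a w₀ w₄)
      + (60 : K) • f w₀ w₁ (a w₁ w₃) + (30 : K) • f w₀ w₂ (a w₀ w₃)
      + (30 : K) • f w₀ w₂ (a w₁ w₂) + (60 : K) • f w₁ (a w₀ w₂) w₂
      + (30 : K) • f w₁ (a w₀ w₃) w₁ + (30 : K) • f w₁ (a w₁ w₂) w₁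
      + (30 : K) • f w₁ w₀ (a w₀ w₄) + (90 : K) • f w₁ w₀ (a w₁ w₃)
      + (60 : K) • f w₁ w₁ (a w₀ w₃) + (60 : K) • f w₁ w₁ (a w₁ w₂)
      + (30 : K) • f w₁ w₂ (a w₀ w₂) + (60 : K) • f w₂ w₀ (a w₀ w₃)
      + (60 : K) • f w₂ w₀ (a w₁ w₂) + (30 : K) • f w₂ w₁ (a w₀ w₂)
      + (30 : K) • f w₃ w₀ (a w₀ w₂) + (15 : K) • a (a w₀ w₁) (a w₀ w₄)
      + (15 : K) • a (a w₀ w₁) (a w₁ w₃) + (15 : K) • a (a w₀ w₂) (a w₀ w₃)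
      + (30 : K) • a w₀ (a w₀ (a w₁ w₄)) + (30 : K) • a w₀ (a w₀ (a w₂ w₃))
      + (15 : K) • a w₀ (a w₁ (a w₀ w₄)) + (45 : K) • a w₀ (a w₁ (a w₁ w₃))
      + (15 : K) • a w₀ (a w₂ (a w₀ w₃)) + (30 : K) • a w₀ (a w₂ (a w₁ w₂))
      + (15 : K) • a w₀ (a w₃ (a w₀ w₂)) + (15 : K) • a w₀ (a w₄ (a w₀ w₁))
      + (30 : K) • a w₁ (a w₀ (a w₀ w₄)) + (60 : K) • a w₁ (a w₀ (a w₁ w₃))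
      + (45 : K) • a w₁ (a w₁ (a w₀ w₃)) + (45 : K) • a w₁ (a w₁ (a w₁ w₂))
      + (30 : K) • a w₁ (a w₂ (a w₀ w₂)) + (15 : K) • a w₁ (a w₃ (a w₀ w₁))
      + (30 : K) • a w₂ (a w₀ (a w₀ w₃)) + (15 : K) • a w₂ (a w₀ (a w₁ w₂))
      + (15 : K) • a w₂ (a w₁ (a w₀ w₂)) - (15 : K) • a w₃ (a w₀ (a w₀ w₂))
      - (15 : K) • a w₃ (a w₁ (a w₀ w₁)) - (15 : K) • a w₄ (a w₀ (a w₀ w₁))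

variable {a f w} {D T : V →ₗ[K] V} (hD : IsDer a f D) (hDw : ∀ k, D (w k) = w (k + 1))

lemma IsEvolution.jet {X : V} (hT : IsEvolution a f D w X T) (k : ℕ) : T (w k) = D^[k] X := by
  induction k with
  | zero => exact hT.zero
  | succ k ih => rw [hT.succ, ih, Function.iterate_succ_apply']

include hD hDw

/-! Leibniz expansions of the derivatives of the quadratic and cubic terms. -/

lemma iterate_thirdQuadratic_one : D^[1] (thirdQuadratic a w) =
      (3 : K) • a (w 0) (w 3) + (3 : K) • a (w 1) (w 2) := by
  rw [Function.iterate_one, thirdQuadratic]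
  simp only [map_add, map_smul, hD.bil, hD.tri, hDw, Nat.reduceAdd]
  module

lemma iterate_thirdQuadratic_two : D^[2] (thirdQuadratic a w) =
      (3 : K) • a (w 0) (w 4) + (6 : K) • a (w 1) (w 3) + (3 : K) • a (w 2) (w 2) := by
  refine iterate_succ_of_eq (iterate_thirdQuadratic_one hD hDw) ?_
  simp only [map_add, map_smul, hD.bil, hD.tri, hDw, Nat.reduceAdd]
  module

lemma iterate_thirdQuadratic_three : D^[3] (thirdQuadratic a w) =
      (3 : K) • a (w 0) (w 5) + (9 : K) • a (w 1) (w 4) + (9 : K) • a (w 2) (w 3)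
        + (3 : K) • a (w 3) (w 2) := by
  refine iterate_succ_of_eq (iterate_thirdQuadratic_two hD hDw) ?_
  simp only [map_add, map_smul, hD.bil, hD.tri, hDw, Nat.reduceAdd]
  module

lemma iterate_thirdQuadratic_four : D^[4] (thirdQuadratic a w) =
      (3 : K) • a (w 0) (w 6) + (12 : K) • a (w 1) (w 5) + (18 : K) • a (w 2) (w 4)
        + (12 : K) • a (w 3) (w 3) + (3 : K) • a (w 4) (w 2) := by
  refine iterate_succ_of_eq (iterate_thirdQuadratic_three hD hDw) ?_
  simp only [map_add, map_smul, hD.bil, hD.tri, hDw, Nat.reduceAdd]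
  module

lemma iterate_thirdQuadratic_five : D^[5] (thirdQuadratic a w) =
      (3 : K) • a (w 0) (w 7) + (15 : K) • a (w 1) (w 6) + (30 : K) • a (w 2) (w 5)
        + (30 : K) • a (w 3) (w 4) + (15 : K) • a (w 4) (w 3) + (3 : K) • a (w 5) (w 2) := by
  refine iterate_succ_of_eq (iterate_thirdQuadratic_four hD hDw) ?_
  simp only [map_add, map_smul, hD.bil, hD.tri, hDw, Nat.reduceAdd]
  module

lemma iterate_thirdCubic_one : D^[1] (thirdCubic a f w) =
      (6 : K) • f (w 0) (w 0) (w 2) + (6 : K) • f (w 0) (w 1) (w 1)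
        + (6 : K) • f (w 1) (w 0) (w 1) + (3 : K) • a (w 0) (a (w 0) (w 2))
        + (3 : K) • a (w 0) (a (w 1) (w 1)) + (3 : K) • a (w 1) (a (w 0) (w 1)) := by
  rw [Function.iterate_one, thirdCubic]
  simp only [map_add, map_smul, hD.bil, hD.tri, hDw, Nat.reduceAdd]
  module

lemma iterate_thirdCubic_two : D^[2] (thirdCubic a f w) =
      (6 : K) • f (w 0) (w 0) (w 3) + (12 : K) • f (w 0) (w 1) (w 2)
        + (6 : K) • f (w 0) (w 2) (w 1) + (12 : K) • f (w 1) (w 0) (w 2)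
        + (12 : K) • f (w 1) (w 1) (w 1) + (6 : K) • f (w 2) (w 0) (w 1)
        + (3 : K) • a (w 0) (a (w 0) (w 3)) + (6 : K) • a (w 0) (a (w 1) (w 2))
        + (3 : K) • a (w 0) (a (w 2) (w 1)) + (6 : K) • a (w 1) (a (w 0) (w 2))
        + (6 : K) • a (w 1) (a (w 1) (w 1)) + (3 : K) • a (w 2) (a (w 0) (w 1)) := by
  refine iterate_succ_of_eq (iterate_thirdCubic_one hD hDw) ?_
  simp only [map_add, map_smul, hD.bil, hD.tri, hDw, Nat.reduceAdd]
  module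

lemma iterate_thirdCubic_three : D^[3] (thirdCubic a f w) =
      (6 : K) • f (w 0) (w 0) (w 4) + (18 : K) • f (w 0) (w 1) (w 3)
        + (18 : K) • f (w 0) (w 2) (w 2) + (6 : K) • f (w 0) (w 3) (w 1)
        + (18 : K) • f (w 1) (w 0) (w 3) + (36 : K) • f (w 1) (w 1) (w 2)
        + (18 : K) • f (w 1) (w 2) (w 1) + (18 : K) • f (w 2) (w 0) (w 2)
        + (18 : K) • f (w 2) (w 1) (w 1) + (6 : K) • f (w 3) (w 0) (w 1)
        + (3 : K) • a (w 0) (a (w 0) (w 4)) + (9 : K) • a (w 0) (a (w 1) (w 3))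
        + (9 : K) • a (w 0) (a (w 2) (w 2)) + (3 : K) • a (w 0) (a (w 3) (w 1))
        + (9 : K) • a (w 1) (a (w 0) (w 3)) + (18 : K) • a (w 1) (a (w 1) (w 2))
        + (9 : K) • a (w 1) (a (w 2) (w 1)) + (9 : K) • a (w 2) (a (w 0) (w 2))
        + (9 : K) • a (w 2) (a (w 1) (w 1)) + (3 : K) • a (w 3) (a (w 0) (w 1)) := by
  refine iterate_succ_of_eq (iterate_thirdCubic_two hD hDw) ?_
  simp only [map_add, map_smul, hD.bil, hD.tri, hDw, Nat.reduceAdd]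
  module

lemma iterate_thirdCubic_four : D^[4] (thirdCubic a f w) =
      (6 : K) • f (w 0) (w 0) (w 5) + (24 : K) • f (w 0) (w 1) (w 4)
        + (36 : K) • f (w 0) (w 2) (w 3) + (24 : K) • f (w 0) (w 3) (w 2)
        + (6 : K) • f (w 0) (w 4) (w 1) + (24 : K) • f (w 1) (w 0) (w 4)
        + (72 : K) • f (w 1) (w 1) (w 3) + (72 : K) • f (w 1) (w 2) (w 2)
        + (24 : K) • f (w 1) (w 3) (w 1) + (36 : K) • f (w 2) (w 0) (w 3)
        + (72 : K) • f (w 2) (w 1) (w 2) + (36 : K) • f (w 2) (w 2) (w 1)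
        + (24 : K) • f (w 3) (w 0) (w 2) + (24 : K) • f (w 3) (w 1) (w 1)
        + (6 : K) • f (w 4) (w 0) (w 1) + (3 : K) • a (w 0) (a (w 0) (w 5))
        + (12 : K) • a (w 0) (a (w 1) (w 4)) + (18 : K) • a (w 0) (a (w 2) (w 3))
        + (12 : K) • a (w 0) (a (w 3) (w 2)) + (3 : K) • a (w 0) (a (w 4) (w 1))
        + (12 : K) • a (w 1) (a (w 0) (w 4)) + (36 : K) • a (w 1) (a (w 1) (w 3))
        + (36 : K) • a (w 1) (a (w 2) (w 2)) + (12 : K) • a (w 1) (a (w 3) (w 1))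
        + (18 : K) • a (w 2) (a (w 0) (w 3)) + (36 : K) • a (w 2) (a (w 1) (w 2))
        + (18 : K) • a (w 2) (a (w 2) (w 1)) + (12 : K) • a (w 3) (a (w 0) (w 2))
        + (12 : K) • a (w 3) (a (w 1) (w 1)) + (3 : K) • a (w 4) (a (w 0) (w 1)) := by
  refine iterate_succ_of_eq (iterate_thirdCubic_three hD hDw) ?_
  simp only [map_add, map_smul, hD.bil, hD.tri, hDw, Nat.reduceAdd]
  module

lemma iterate_thirdCubic_five : D^[5] (thirdCubic a f w) =
      (6 : K) • f (w 0) (w 0) (w 6) + (30 : K) • f (w 0) (w 1) (w 5)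
        + (60 : K) • f (w 0) (w 2) (w 4) + (60 : K) • f (w 0) (w 3) (w 3)
        + (30 : K) • f (w 0) (w 4) (w 2) + (6 : K) • f (w 0) (w 5) (w 1)
        + (30 : K) • f (w 1) (w 0) (w 5) + (120 : K) • f (w 1) (w 1) (w 4)
        + (180 : K) • f (w 1) (w 2) (w 3) + (120 : K) • f (w 1) (w 3) (w 2)
        + (30 : K) • f (w 1) (w 4) (w 1) + (60 : K) • f (w 2) (w 0) (w 4)
        + (180 : K) • f (w 2) (w 1) (w 3) + (180 : K) • f (w 2) (w 2) (w 2)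
        + (60 : K) • f (w 2) (w 3) (w 1) + (60 : K) • f (w 3) (w 0) (w 3)
        + (120 : K) • f (w 3) (w 1) (w 2) + (60 : K) • f (w 3) (w 2) (w 1)
        + (30 : K) • f (w 4) (w 0) (w 2) + (30 : K) • f (w 4) (w 1) (w 1)
        + (6 : K) • f (w 5) (w 0) (w 1) + (3 : K) • a (w 0) (a (w 0) (w 6))
        + (15 : K) • a (w 0) (a (w 1) (w 5)) + (30 : K) • a (w 0) (a (w 2) (w 4))
        + (30 : K) • a (w 0) (a (w 3) (w 3)) + (15 : K) • a (w 0) (a (w 4) (w 2))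
        + (3 : K) • a (w 0) (a (w 5) (w 1)) + (15 : K) • a (w 1) (a (w 0) (w 5))
        + (60 : K) • a (w 1) (a (w 1) (w 4)) + (90 : K) • a (w 1) (a (w 2) (w 3))
        + (60 : K) • a (w 1) (a (w 3) (w 2)) + (15 : K) • a (w 1) (a (w 4) (w 1))
        + (30 : K) • a (w 2) (a (w 0) (w 4)) + (90 : K) • a (w 2) (a (w 1) (w 3))
        + (90 : K) • a (w 2) (a (w 2) (w 2)) + (30 : K) • a (w 2) (a (w 3) (w 1))
        + (30 : K) • a (w 3) (a (w 0) (w 3)) + (60 : K) • a (w 3) (a (w 1) (w 2))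
        + (30 : K) • a (w 3) (a (w 2) (w 1)) + (15 : K) • a (w 4) (a (w 0) (w 2))
        + (15 : K) • a (w 4) (a (w 1) (w 1)) + (3 : K) • a (w 5) (a (w 0) (w 1)) := by
  refine iterate_succ_of_eq (iterate_thirdCubic_four hD hDw) ?_
  simp only [map_add, map_smul, hD.bil, hD.tri, hDw, Nat.reduceAdd]
  module

lemma iterate_fifthQuadratic_one : D^[1] (fifthQuadratic a w) =
      (5 : K) • a (w 0) (w 5) + (10 : K) • a (w 1) (w 4) + (5 : K) • a (w 2) (w 3) := by
  rw [Function.iterate_one, fifthQuadratic]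
  simp only [map_add, map_smul, hD.bil, hD.tri, hDw, Nat.reduceAdd]
  module

lemma iterate_fifthQuadratic_two : D^[2] (fifthQuadratic a w) =
      (5 : K) • a (w 0) (w 6) + (15 : K) • a (w 1) (w 5) + (15 : K) • a (w 2) (w 4)
        + (5 : K) • a (w 3) (w 3) := by
  refine iterate_succ_of_eq (iterate_fifthQuadratic_one hD hDw) ?_
  simp only [map_add, map_smul, hD.bil, hD.tri, hDw, Nat.reduceAdd]
  module

lemma iterate_fifthQuadratic_three : D^[3] (fifthQuadratic a w) =
      (5 : K) • a (w 0) (w 7) + (20 : K) • a (w 1) (w 6) + (30 : K) • a (w 2) (w 5)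
        + (20 : K) • a (w 3) (w 4) + (5 : K) • a (w 4) (w 3) := by
  refine iterate_succ_of_eq (iterate_fifthQuadratic_two hD hDw) ?_
  simp only [map_add, map_smul, hD.bil, hD.tri, hDw, Nat.reduceAdd]
  module

lemma iterate_fifthTernary_one : D^[1] (fifthTernary a f w) =
      (10 : K) • f (w 0) (w 0) (w 4) + (20 : K) • f (w 0) (w 1) (w 3)
        + (20 : K) • f (w 0) (w 2) (w 2) + (10 : K) • f (w 0) (w 3) (w 1)
        + (30 : K) • f (w 1) (w 0) (w 3) + (40 : K) • f (w 1) (w 1) (w 2)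
        + (20 : K) • f (w 1) (w 2) (w 1) + (20 : K) • f (w 2) (w 0) (w 2)
        + (10 : K) • f (w 2) (w 1) (w 1) + (10 : K) • a (w 0) (a (w 0) (w 4))
        + (15 : K) • a (w 0) (a (w 1) (w 3)) + (5 : K) • a (w 0) (a (w 2) (w 2))
        + (15 : K) • a (w 1) (a (w 0) (w 3)) + (10 : K) • a (w 1) (a (w 1) (w 2))
        + (5 : K) • a (w 2) (a (w 0) (w 2)) := by
  rw [Function.iterate_one, fifthTernary]
  simp only [map_add, map_smul, hD.bil, hD.tri, hDw, Nat.reduceAdd]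
  module

lemma iterate_fifthTernary_two : D^[2] (fifthTernary a f w) =
      (10 : K) • f (w 0) (w 0) (w 5) + (30 : K) • f (w 0) (w 1) (w 4)
        + (40 : K) • f (w 0) (w 2) (w 3) + (30 : K) • f (w 0) (w 3) (w 2)
        + (10 : K) • f (w 0) (w 4) (w 1) + (40 : K) • f (w 1) (w 0) (w 4)
        + (90 : K) • f (w 1) (w 1) (w 3) + (80 : K) • f (w 1) (w 2) (w 2)
        + (30 : K) • f (w 1) (w 3) (w 1) + (50 : K) • f (w 2) (w 0) (w 3)
        + (70 : K) • f (w 2) (w 1) (w 2) + (30 : K) • f (w 2) (w 2) (w 1)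
        + (20 : K) • f (w 3) (w 0) (w 2) + (10 : K) • f (w 3) (w 1) (w 1)
        + (10 : K) • a (w 0) (a (w 0) (w 5)) + (25 : K) • a (w 0) (a (w 1) (w 4))
        + (20 : K) • a (w 0) (a (w 2) (w 3)) + (5 : K) • a (w 0) (a (w 3) (w 2))
        + (25 : K) • a (w 1) (a (w 0) (w 4)) + (40 : K) • a (w 1) (a (w 1) (w 3))
        + (15 : K) • a (w 1) (a (w 2) (w 2)) + (20 : K) • a (w 2) (a (w 0) (w 3))
        + (15 : K) • a (w 2) (a (w 1) (w 2)) + (5 : K) • a (w 3) (a (w 0) (w 2)) := by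
  refine iterate_succ_of_eq (iterate_fifthTernary_one hD hDw) ?_
  simp only [map_add, map_smul, hD.bil, hD.tri, hDw, Nat.reduceAdd]
  module

lemma iterate_fifthTernary_three : D^[3] (fifthTernary a f w) =
      (10 : K) • f (w 0) (w 0) (w 6) + (40 : K) • f (w 0) (w 1) (w 5)
        + (70 : K) • f (w 0) (w 2) (w 4) + (70 : K) • f (w 0) (w 3) (w 3)
        + (40 : K) • f (w 0) (w 4) (w 2) + (10 : K) • f (w 0) (w 5) (w 1)
        + (50 : K) • f (w 1) (w 0) (w 5) + (160 : K) • f (w 1) (w 1) (w 4)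
        + (210 : K) • f (w 1) (w 2) (w 3) + (140 : K) • f (w 1) (w 3) (w 2)
        + (40 : K) • f (w 1) (w 4) (w 1) + (90 : K) • f (w 2) (w 0) (w 4)
        + (210 : K) • f (w 2) (w 1) (w 3) + (180 : K) • f (w 2) (w 2) (w 2)
        + (60 : K) • f (w 2) (w 3) (w 1) + (70 : K) • f (w 3) (w 0) (w 3)
        + (100 : K) • f (w 3) (w 1) (w 2) + (40 : K) • f (w 3) (w 2) (w 1)
        + (20 : K) • f (w 4) (w 0) (w 2) + (10 : K) • f (w 4) (w 1) (w 1)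
        + (10 : K) • a (w 0) (a (w 0) (w 6)) + (35 : K) • a (w 0) (a (w 1) (w 5))
        + (45 : K) • a (w 0) (a (w 2) (w 4)) + (25 : K) • a (w 0) (a (w 3) (w 3))
        + (5 : K) • a (w 0) (a (w 4) (w 2)) + (35 : K) • a (w 1) (a (w 0) (w 5))
        + (90 : K) • a (w 1) (a (w 1) (w 4)) + (75 : K) • a (w 1) (a (w 2) (w 3))
        + (20 : K) • a (w 1) (a (w 3) (w 2)) + (45 : K) • a (w 2) (a (w 0) (w 4))
        + (75 : K) • a (w 2) (a (w 1) (w 3)) + (30 : K) • a (w 2) (a (w 2) (w 2))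
        + (25 : K) • a (w 3) (a (w 0) (w 3)) + (20 : K) • a (w 3) (a (w 1) (w 2))
        + (5 : K) • a (w 4) (a (w 0) (w 2)) := by
  refine iterate_succ_of_eq (iterate_fifthTernary_two hD hDw) ?_
  simp only [map_add, map_smul, hD.bil, hD.tri, hDw, Nat.reduceAdd]
  module

/-- The terms of degree two in the commutator cancel. -/
lemma commutator_degree_two (hk : ∀ x y, a x y = - a y x)
    {T₁ T₂ S₁ S₂ : V →ₗ[K] V}
    (hT₁ : IsEvolution a f D w (w 3) T₁)
    (hT₂ : IsEvolution a f D w (thirdQuadratic a w) T₂)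
    (hS₁ : IsEvolution a f D w (w 5) S₁)
    (hS₂ : IsEvolution a f D w (fifthQuadratic a w) S₂) :
    T₁ (fifthQuadratic a w) + T₂ (w 5) - S₂ (w 3) - S₁ (thirdQuadratic a w) = 0 := by
  have s1 : a (w 4) (w 3) = - a (w 3) (w 4) := hk _ _
  simp only [fifthQuadratic, thirdQuadratic]
  simp only [map_add, map_smul, hT₁.der.bil, hT₂.der.bil, hS₁.der.bil, hS₂.der.bil, hT₁.jet,
    hT₂.jet, hS₁.jet, hS₂.jet, iterate_jet hDw, iterate_fifthQuadratic_three hD hDw,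
    iterate_thirdQuadratic_five hD hDw, Function.iterate_zero_apply, LinearMap.add_apply,
    LinearMap.smul_apply, Nat.reduceAdd]
  simp only [s1, map_neg, map_zero, LinearMap.neg_apply, LinearMap.zero_apply]
  module

/-- The terms of degree three in the commutator cancel. -/
lemma commutator_degree_three (hk : ∀ x y, a x y = - a y x)
    (ha : ∀ x, a x x = 0) (hs : ∀ x y z, f x y z = f z y x)
    {T₁ T₂ T₃ S₁ S₂ S₃ : V →ₗ[K] V}
    (hT₁ : IsEvolution a f D w (w 3) T₁)
    (hT₂ : IsEvolution a f D w (thirdQuadratic a w) T₂)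
    (hT₃ : IsEvolution a f D w (thirdCubic a f w) T₃)
    (hS₁ : IsEvolution a f D w (w 5) S₁)
    (hS₂ : IsEvolution a f D w (fifthQuadratic a w) S₂)
    (hS₃ : IsEvolution a f D w (fifthTernary a f w) S₃) :
    T₁ (fifthTernary a f w) + T₂ (fifthQuadratic a w) + T₃ (w 5) - S₃ (w 3)
      - S₂ (thirdQuadratic a w) - S₁ (thirdCubic a f w) = 0 := by
  have s1 : a (a (w 0) (w 2)) (w 4) = - a (w 4) (a (w 0) (w 2)) := hk _ _
  have s2 : a (a (w 0) (w 3)) (w 3) = - a (w 3) (a (w 0) (w 3)) := hk _ _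
  have s3 : a (a (w 0) (w 4)) (w 2) = - a (w 2) (a (w 0) (w 4)) := hk _ _
  have s4 : a (a (w 1) (w 2)) (w 3) = - a (w 3) (a (w 1) (w 2)) := hk _ _
  have s5 : a (a (w 1) (w 3)) (w 2) = - a (w 2) (a (w 1) (w 3)) := hk _ _
  have s6 : a (w 2) (w 1) = - a (w 1) (w 2) := hk _ _
  have s7 : a (w 3) (w 1) = - a (w 1) (w 3) := hk _ _
  have s8 : a (w 3) (w 2) = - a (w 2) (w 3) := hk _ _
  have s9 : a (w 4) (w 1) = - a (w 1) (w 4) := hk _ _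
  have s10 : a (w 4) (w 2) = - a (w 2) (w 4) := hk _ _
  have s11 : a (w 1) (w 1) = 0 := ha _
  have s12 : a (w 2) (w 2) = 0 := ha _
  have s13 : a (w 3) (w 3) = 0 := ha _
  have s14 : f (w 3) (w 1) (w 2) = f (w 2) (w 1) (w 3) := hs _ _ _
  have s15 : f (w 3) (w 2) (w 1) = f (w 1) (w 2) (w 3) := hs _ _ _
  have s16 : f (w 4) (w 0) (w 2) = f (w 2) (w 0) (w 4) := hs _ _ _
  have s17 : f (w 4) (w 1) (w 1) = f (w 1) (w 1) (w 4) := hs _ _ _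
  simp only [fifthTernary, thirdQuadratic, fifthQuadratic, thirdCubic]
  simp only [map_add, map_smul, hT₁.der.bil, hT₂.der.bil, hT₃.der.bil, hS₁.der.bil, hS₂.der.bil,
    hS₃.der.bil, hT₁.der.tri, hT₂.der.tri, hT₃.der.tri, hS₁.der.tri, hS₂.der.tri, hS₃.der.tri,
    hT₁.jet, hT₂.jet, hT₃.jet, hS₁.jet, hS₂.jet, hS₃.jet, iterate_jet hDw,
    iterate_fifthTernary_three hD hDw, iterate_thirdQuadratic_one hD hDw,
    iterate_thirdQuadratic_three hD hDw, iterate_thirdQuadratic_four hD hDw,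
    iterate_fifthQuadratic_two hD hDw, iterate_thirdCubic_five hD hDw,
    Function.iterate_zero_apply, LinearMap.add_apply, LinearMap.smul_apply, Nat.reduceAdd]
  simp only [fifthTernary, thirdQuadratic, fifthQuadratic, thirdCubic, map_add, map_smul,
    LinearMap.add_apply, LinearMap.smul_apply]
  simp only [s1, s2, s3, s4, s5, s6, s7, s8, s9, s10, s11, s12, s13, s14, s15, s16, s17, map_neg,
    map_zero, LinearMap.neg_apply, LinearMap.zero_apply]
  obtain ⟨a', ha'⟩ := exists_function_eq₂ a
  obtain ⟨f', hf'⟩ := exists_function_eq f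
  simp only [ha', hf']
  module

set_option maxHeartbeats 2000000 in
/-- The terms of degree four in the commutator. -/
lemma commutator_degree_four (hk : ∀ x y, a x y = - a y x)
    (ha : ∀ x, a x x = 0) (hs : ∀ x y z, f x y z = f z y x)
    {T₂ T₃ S₂ S₃ : V →ₗ[K] V}
    (hT₂ : IsEvolution a f D w (thirdQuadratic a w) T₂)
    (hT₃ : IsEvolution a f D w (thirdCubic a f w) T₃)
    (hS₂ : IsEvolution a f D w (fifthQuadratic a w) S₂)
    (hS₃ : IsEvolution a f D w (fifthTernary a f w) S₃) :
    T₂ (fifthTernary a f w) + T₃ (fifthQuadratic a w) - S₃ (thirdQuadratic a w)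
      - S₂ (thirdCubic a f w) = quarticForm a f (w 0) (w 1) (w 2) (w 3) (w 4) := by
  have s1 : a (a (w 0) (a (w 0) (w 1))) (w 4) = - a (w 4) (a (w 0) (a (w 0) (w 1))) := hk _ _
  have s2 : a (a (w 0) (a (w 0) (w 2))) (w 3) = - a (w 3) (a (w 0) (a (w 0) (w 2))) := hk _ _
  have s3 : a (a (w 0) (a (w 0) (w 3))) (w 2) = - a (w 2) (a (w 0) (a (w 0) (w 3))) := hk _ _
  have s4 : a (a (w 0) (a (w 1) (w 2))) (w 2) = - a (w 2) (a (w 0) (a (w 1) (w 2))) := hk _ _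
  have s5 : a (a (w 0) (w 2)) (w 2) = - a (w 2) (a (w 0) (w 2)) := hk _ _
  have s6 : a (a (w 0) (w 2)) (w 3) = - a (w 3) (a (w 0) (w 2)) := hk _ _
  have s7 : a (a (w 0) (w 3)) (a (w 0) (w 2)) = - a (a (w 0) (w 2)) (a (w 0) (w 3)) := hk _ _
  have s8 : a (a (w 0) (w 3)) (w 2) = - a (w 2) (a (w 0) (w 3)) := hk _ _
  have s9 : a (a (w 0) (w 4)) (a (w 0) (w 1)) = - a (a (w 0) (w 1)) (a (w 0) (w 4)) := hk _ _
  have s10 : a (a (w 0) (w 4)) (w 1) = - a (w 1) (a (w 0) (w 4)) := hk _ _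
  have s11 : a (a (w 1) (a (w 0) (w 1))) (w 3) = - a (w 3) (a (w 1) (a (w 0) (w 1))) := hk _ _
  have s12 : a (a (w 1) (a (w 0) (w 2))) (w 2) = - a (w 2) (a (w 1) (a (w 0) (w 2))) := hk _ _
  have s13 : a (a (w 1) (w 2)) (a (w 0) (w 2)) = - a (a (w 0) (w 2)) (a (w 1) (w 2)) := hk _ _
  have s14 : a (a (w 1) (w 2)) (w 2) = - a (w 2) (a (w 1) (w 2)) := hk _ _
  have s15 : a (a (w 1) (w 3)) (a (w 0) (w 1)) = - a (a (w 0) (w 1)) (a (w 1) (w 3)) := hk _ _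
  have s16 : a (a (w 1) (w 3)) (w 1) = - a (w 1) (a (w 1) (w 3)) := hk _ _
  have s17 : a (f (w 0) (w 0) (w 1)) (w 4) = - a (w 4) (f (w 0) (w 0) (w 1)) := hk _ _
  have s18 : a (f (w 0) (w 0) (w 2)) (w 3) = - a (w 3) (f (w 0) (w 0) (w 2)) := hk _ _
  have s19 : a (f (w 0) (w 0) (w 3)) (w 2) = - a (w 2) (f (w 0) (w 0) (w 3)) := hk _ _
  have s20 : a (f (w 0) (w 1) (w 1)) (w 3) = - a (w 3) (f (w 0) (w 1) (w 1)) := hk _ _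
  have s21 : a (f (w 0) (w 1) (w 2)) (w 2) = - a (w 2) (f (w 0) (w 1) (w 2)) := hk _ _
  have s22 : a (f (w 0) (w 2) (w 1)) (w 2) = - a (w 2) (f (w 0) (w 2) (w 1)) := hk _ _
  have s23 : a (f (w 1) (w 0) (w 1)) (w 3) = - a (w 3) (f (w 1) (w 0) (w 1)) := hk _ _
  have s24 : a (f (w 1) (w 0) (w 2)) (w 2) = - a (w 2) (f (w 1) (w 0) (w 2)) := hk _ _
  have s25 : a (f (w 1) (w 1) (w 1)) (w 2) = - a (w 2) (f (w 1) (w 1) (w 1)) := hk _ _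
  have s26 : a (w 2) (w 1) = - a (w 1) (w 2) := hk _ _
  have s27 : a (w 3) (w 1) = - a (w 1) (w 3) := hk _ _
  have s28 : a (w 3) (w 2) = - a (w 2) (w 3) := hk _ _
  have s29 : a (w 4) (w 1) = - a (w 1) (w 4) := hk _ _
  have s30 : a (w 1) (w 1) = 0 := ha _
  have s31 : a (w 2) (w 2) = 0 := ha _
  have s32 : f (a (w 0) (w 2)) (w 0) (w 3) = f (w 3) (w 0) (a (w 0) (w 2)) := hs _ _ _
  have s33 : f (a (w 0) (w 2)) (w 1) (w 2) = f (w 2) (w 1) (a (w 0) (w 2)) := hs _ _ _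
  have s34 : f (a (w 0) (w 2)) (w 2) (w 1) = f (w 1) (w 2) (a (w 0) (w 2)) := hs _ _ _
  have s35 : f (a (w 0) (w 3)) (w 0) (w 2) = f (w 2) (w 0) (a (w 0) (w 3)) := hs _ _ _
  have s36 : f (a (w 0) (w 3)) (w 1) (w 1) = f (w 1) (w 1) (a (w 0) (w 3)) := hs _ _ _
  have s37 : f (a (w 0) (w 4)) (w 0) (w 1) = f (w 1) (w 0) (a (w 0) (w 4)) := hs _ _ _
  have s38 : f (a (w 1) (w 2)) (w 0) (w 2) = f (w 2) (w 0) (a (w 1) (w 2)) := hs _ _ _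
  have s39 : f (a (w 1) (w 2)) (w 1) (w 1) = f (w 1) (w 1) (a (w 1) (w 2)) := hs _ _ _
  have s40 : f (a (w 1) (w 3)) (w 0) (w 1) = f (w 1) (w 0) (a (w 1) (w 3)) := hs _ _ _
  have s41 : f (w 2) (w 1) (w 1) = f (w 1) (w 1) (w 2) := hs _ _ _
  have s42 : f (w 2) (w 2) (w 1) = f (w 1) (w 2) (w 2) := hs _ _ _
  have s43 : f (w 3) (w 0) (w 1) = f (w 1) (w 0) (w 3) := hs _ _ _
  have s44 : f (w 3) (w 0) (w 2) = f (w 2) (w 0) (w 3) := hs _ _ _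
  have s45 : f (w 3) (w 1) (w 1) = f (w 1) (w 1) (w 3) := hs _ _ _
  have s46 : f (w 4) (w 0) (w 1) = f (w 1) (w 0) (w 4) := hs _ _ _
  simp only [thirdQuadratic, fifthTernary, thirdCubic, fifthQuadratic, quarticForm]
  simp only [map_add, map_smul, hT₂.der.bil, hT₃.der.bil, hS₂.der.bil, hS₃.der.bil, hT₂.der.tri,
    hT₃.der.tri, hS₂.der.tri, hS₃.der.tri, hT₂.jet, hT₃.jet, hS₂.jet, hS₃.jet, iterate_jet hDw,
    iterate_thirdQuadratic_one hD hDw, iterate_thirdQuadratic_two hD hDw,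
    iterate_thirdQuadratic_three hD hDw, iterate_fifthTernary_two hD hDw,
    iterate_thirdCubic_one hD hDw, iterate_thirdCubic_three hD hDw,
    iterate_thirdCubic_four hD hDw, iterate_fifthQuadratic_one hD hDw,
    Function.iterate_zero_apply, LinearMap.add_apply, LinearMap.smul_apply, Nat.reduceAdd]
  simp only [thirdQuadratic, fifthTernary, thirdCubic, fifthQuadratic, map_add, map_smul,
    LinearMap.add_apply, LinearMap.smul_apply]
  simp only [s1, s2, s3, s4, s5, s6, s7, s8, s9, s10, s11, s12, s13, s14, s15, s16, s17, s18, s19,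
    s20, s21, s22, s23, s24, s25, s26, s27, s28, s29, s30, s31, s32, s33, s34, s35, s36, s37,
    s38, s39, s40, s41, s42, s43, s44, s45, s46, map_neg, map_zero, LinearMap.neg_apply,
    LinearMap.zero_apply]
  obtain ⟨a', ha'⟩ := exists_function_eq₂ a
  obtain ⟨f', hf'⟩ := exists_function_eq f
  simp only [ha', hf']
  module

end LowDegree

/-! ### The terms of low degree of a symmetry -/

section Truncation

variable {K V ι : Type*} [Field K] [CharZero K] [AddCommGroup V] [Module K V] [Fintype ι]
  (b : Module.Basis ι K V) {A : Op K V 2} {B F : Op K V 3}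

lemma isEvolution_vec (X : ι → DiffPoly K ι) :
    IsEvolution (bil (extOp b A)) (tri (extOp b F)) (vec (totalD K ι)) (jet K ι) X
      (vec (evolField X)) :=
  ⟨isDer_vec b A F _, vec_evolField_jet_zero X, vec_evolField_jet_succ X⟩

/-- The terms of degree at most three of the model fifth-order system. -/
noncomputable def truncatedRHS (A : Op K V 2) (F : Op K V 3) : ι → DiffPoly K ι :=
  jet K ι 5 + fifthQuadratic (bil (extOp b A)) (jet K ι)
    + fifthTernary (bil (extOp b A)) (tri (extOp b F)) (jet K ι)

lemma mkdvRHS_eq_graded (hB : IsModel A B F) :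
    mkdvRHS b A B = jet K ι 3 + thirdQuadratic (bil (extOp b A)) (jet K ι)
      + thirdCubic (bil (extOp b A)) (tri (extOp b F)) (jet K ι) := by
  rw [mkdvRHS_eq_jets b hB, thirdQuadratic, thirdCubic]
  abel

lemma term_coeffB_eq :
    (5 : K) • term b (coeffB₂ (bil A) (tri F)) ![0, 0, 3]
      + (5 : K) • term b (coeffB₃ (bil A) (tri F)) ![0, 1, 2]
      + (5 : K) • term b (coeffB₄ (tri F)) ![1, 1, 1]
      = fifthTernary (bil (extOp b A)) (tri (extOp b F)) (jet K ι) := by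
  simp only [term_three, extOp_coeffB₂, extOp_coeffB₃, extOp_coeffB₄]
  simp only [coeffB₂, coeffB₃, coeffB₄, MultilinearMap.mk'_apply, Matrix.cons_val_zero,
    Matrix.cons_val_one, Matrix.cons_val, fifthTernary]
  module

lemma thirdQuadratic_mem_homog (A : Op K V 2) :
    thirdQuadratic (bil (extOp b A)) (jet K ι) ∈ homog K ι 2 := by
  rw [thirdQuadratic, ← term_two]
  exact Submodule.smul_mem _ _ (term_mem_homog b A _)

lemma fifthQuadratic_mem_homog (A : Op K V 2) :
    fifthQuadratic (bil (extOp b A)) (jet K ι) ∈ homog K ι 2 := by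
  rw [fifthQuadratic, ← term_two, ← term_two]
  exact add_mem (Submodule.smul_mem _ _ (term_mem_homog b A _))
    (Submodule.smul_mem _ _ (term_mem_homog b A _))

lemma thirdCubic_mem_homog (A : Op K V 2) (F : Op K V 3) :
    thirdCubic (bil (extOp b A)) (tri (extOp b F)) (jet K ι) ∈ homog K ι 3 := by
  have hj := jet_mem_homog (K := K) (ι := ι)
  rw [thirdCubic]
  exact add_mem (Submodule.smul_mem _ _ (tri_mem_homog b F (hj 0) (hj 0) (hj 1)))
    (Submodule.smul_mem _ _ (bil_mem_homog b A (hj 0) (bil_mem_homog b A (hj 0) (hj 1))))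

lemma fifthTernary_mem_homog (A : Op K V 2) (F : Op K V 3) :
    fifthTernary (bil (extOp b A)) (tri (extOp b F)) (jet K ι) ∈ homog K ι 3 := by
  rw [← term_coeffB_eq]
  exact add_mem (add_mem (Submodule.smul_mem _ _ (term_mem_homog b _ _))
    (Submodule.smul_mem _ _ (term_mem_homog b _ _)))
    (Submodule.smul_mem _ _ (term_mem_homog b _ _))

/-- The symmetry equation for `G`, in terms of the deviation `q` of `G` from the terms of degree
at most three of the model system. -/
lemma truncated_symmetry_equation (hA : ∀ x y, bil A x y = - bil A y x)
    (hF : ∀ x y z, tri F x y z = tri F z y x) (hB : IsModel A B F) {G : ι → DiffPoly K ι}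
    (hS : IsSymmetry (mkdvRHS b A B) G) {q : ι → DiffPoly K ι} (hq : G = truncatedRHS b A F + q) :
    quarticForm (bil (extOp b A)) (tri (extOp b F)) (jet K ι 0) (jet K ι 1) (jet K ι 2)
        (jet K ι 3) (jet K ι 4)
      + (vec (evolField (jet K ι 3)) q
        - vec (totalD K ι) (vec (totalD K ι) (vec (totalD K ι) q)))
      + (vec (evolField (thirdCubic (bil (extOp b A)) (tri (extOp b F)) (jet K ι)))
          (fifthTernary (bil (extOp b A)) (tri (extOp b F)) (jet K ι))
        - vec (evolField (fifthTernary (bil (extOp b A)) (tri (extOp b F)) (jet K ι)))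
          (thirdCubic (bil (extOp b A)) (tri (extOp b F)) (jet K ι)))
      + (vec (evolField (thirdQuadratic (bil (extOp b A)) (jet K ι))) q
        + vec (evolField (thirdCubic (bil (extOp b A)) (tri (extOp b F)) (jet K ι))) q
        - vec (evolField q) (thirdQuadratic (bil (extOp b A)) (jet K ι))
        - vec (evolField q) (thirdCubic (bil (extOp b A)) (tri (extOp b F)) (jet K ι))) = 0 := by
  have hk : ∀ x y, bil (extOp b A) x y = - bil (extOp b A) y x := fun x y =>
    ext_evalAt b fun p => by rw [map_neg, evalAt_bil, evalAt_bil, hA]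
  have hs : ∀ x y z, tri (extOp b F) x y z = tri (extOp b F) z y x := fun x y z =>
    ext_evalAt b fun p => by rw [evalAt_tri, evalAt_tri, hF]
  have ha : ∀ x, bil (extOp b A) x x = 0 := fun x => by
    have h2 : (2 : K) • bil (extOp b A) x x = 0 := by
      linear_combination (norm := module) hk x x
    exact (smul_eq_zero.1 h2).resolve_left two_ne_zero
  have hD : IsDer (bil (extOp b A)) (tri (extOp b F)) (vec (totalD K ι)) := isDer_vec b A F _
  have hDw := vec_totalD_jet (K := K) (ι := ι)
  have hev := isEvolution_vec b (A := A) (F := F)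
  have e2 := commutator_degree_two hD hDw hk (hev _) (hev _) (hev _) (hev _)
  have e3 := commutator_degree_three hD hDw hk ha hs (hev _) (hev _) (hev _) (hev _) (hev _)
    (hev _)
  have e4 := commutator_degree_four hD hDw hk ha hs (hev _) (hev _) (hev _) (hev _)
  have e1 : vec (evolField (jet K ι 3)) (jet K ι 5) = vec (evolField (jet K ι 5)) (jet K ι 3) := by
    rw [(hev _).jet, (hev _).jet, iterate_jet hDw, iterate_jet hDw]
  have eq' : vec (evolField q) (jet K ι 3)
      = vec (totalD K ι) (vec (totalD K ι) (vec (totalD K ι) q)) := (hev q).jet 3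
  rw [isSymmetry_iff, mkdvRHS_eq_graded b hB, hq, truncatedRHS] at hS
  simp only [vec_evolField_add, map_add] at hS
  rw [← e4, ← eq']
  linear_combination (norm := abel) hS - e1 - e2 - e3

/-- A symmetry agrees with the model system up to degree three, and its terms of degree four
satisfy the degree-four part of the symmetry equation. -/
theorem deviation_of_isSymmetry (hA : ∀ x y, bil A x y = - bil A y x)
    (hF : ∀ x y z, tri F x y z = tri F z y x) (hB : IsModel A B F) {G : ι → DiffPoly K ι}
    (hS : IsSymmetry (mkdvRHS b A B) G) {g₂ g₃ g₄ g₅ : ι → DiffPoly K ι}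
    (h₂ : g₂ ∈ homog K ι 2) (h₃ : g₃ ∈ homog K ι 3) (h₄ : g₄ ∈ homog K ι 4)
    (h₅ : g₅ ∈ homog K ι 5) (hq : G = truncatedRHS b A F + (g₂ + g₃ + g₄ + g₅)) :
    g₂ = 0 ∧ g₃ = 0 ∧
    quarticForm (bil (extOp b A)) (tri (extOp b F)) (jet K ι 0) (jet K ι 1) (jet K ι 2)
        (jet K ι 3) (jet K ι 4)
      + (vec (evolField (jet K ι 3)) g₄
        - vec (totalD K ι) (vec (totalD K ι) (vec (totalD K ι) g₄))) = 0 := by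
  have key := truncated_symmetry_equation b hA hF hB hS hq
  have hk : ∀ x y, bil (extOp b A) x y = - bil (extOp b A) y x := fun x y =>
    ext_evalAt b fun p => by rw [map_neg, evalAt_bil, evalAt_bil, hA]
  have hs : ∀ x y z, tri (extOp b F) x y z = tri (extOp b F) z y x := fun x y z =>
    ext_evalAt b fun p => by rw [evalAt_tri, evalAt_tri, hF]
  have ha : ∀ x, bil (extOp b A) x x = 0 := fun x => by
    have h2 : (2 : K) • bil (extOp b A) x x = 0 := by
      linear_combination (norm := module) hk x x
    exact (smul_eq_zero.1 h2).resolve_left two_ne_zero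
  have hev := isEvolution_vec b (A := A) (F := F)
  have hx₂ := thirdQuadratic_mem_homog b (ι := ι) A
  have hy₂ := fifthQuadratic_mem_homog b (ι := ι) A
  have hx₃ := thirdCubic_mem_homog b (ι := ι) A F
  have hy₃ := fifthTernary_mem_homog b (ι := ι) A F
  have hquart : quarticForm (bil (extOp b A)) (tri (extOp b F)) (jet K ι 0) (jet K ι 1)
      (jet K ι 2) (jet K ι 3) (jet K ι 4) ∈ homog K ι 4 := by
    rw [← commutator_degree_four (isDer_vec b A F _) vec_totalD_jet hk ha hs (hev _) (hev _)
      (hev _) (hev _)]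
    exact sub_mem (sub_mem (add_mem (vec_evolField_mem_homog hx₂ hy₃)
      (vec_evolField_mem_homog hx₃ hy₂)) (vec_evolField_mem_homog hy₃ hx₂))
      (vec_evolField_mem_homog hy₂ hx₃)
  generalize thirdQuadratic (bil (extOp b A)) (jet K ι) = x₂ at *
  generalize thirdCubic (bil (extOp b A)) (tri (extOp b F)) (jet K ι) = x₃ at *
  generalize fifthTernary (bil (extOp b A)) (tri (extOp b F)) (jet K ι) = y₃ at *
  generalize quarticForm (bil (extOp b A)) (tri (extOp b F)) (jet K ι 0) (jet K ι 1)
      (jet K ι 2) (jet K ι 3) (jet K ι 4) = h at *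
  set q := g₂ + g₃ + g₄ + g₅ with hqdef
  have hquint : vec (evolField x₃) y₃ - vec (evolField y₃) x₃ ∈ order K ι 5 :=
    sub_mem (vec_evolField_mem_order (homog_le_order hx₃) (homog_le_order hy₃))
      (vec_evolField_mem_order (homog_le_order hy₃) (homog_le_order hx₃))
  have hrest : ∀ m, q ∈ order K ι (m + 1) → vec (evolField x₂) q + vec (evolField x₃) q
      - vec (evolField q) x₂ - vec (evolField q) x₃ ∈ order K ι (m + 2) := fun m hm =>
    sub_mem (sub_mem (add_mem (vec_evolField_mem_order (homog_le_order hx₂) hm)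
      (order_mono (by omega) (vec_evolField_mem_order (homog_le_order hx₃) hm)))
      (order_mono (by omega) (vec_evolField_mem_order (k := 1) hm (homog_le_order hx₂))))
      (order_mono (by omega) (vec_evolField_mem_order (k := 2) hm (homog_le_order hx₃)))
  -- Each step raises the order of vanishing of the deviation by one, up to the degree of the
  -- first term that does not cancel.
  have hstep : ∀ m, m + 2 ≤ 4 → q ∈ order K ι 2 → q ∈ order K ι (m + 1) →
      q ∈ order K ι (m + 2) := fun m hm4 h2 hm => by
    refine mem_order_of_cube_sub_mem h2 ?_
    have := add_mem (add_mem (order_mono hm4 (homog_le_order hquart))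
      (order_mono (by omega) hquint)) (hrest m hm)
    rw [← neg_mem_iff] at this
    convert this using 1
    linear_combination (norm := abel) key
  have o₃ := homog_le_order h₃
  have o₄ := homog_le_order h₄
  have o₅ := homog_le_order h₅
  have hq2 : q ∈ order K ι 2 := add_mem (add_mem (add_mem (homog_le_order h₂)
    (order_mono (by omega) o₃)) (order_mono (by omega) o₄)) (order_mono (by omega) o₅)
  have hq3 := hstep 1 (by omega) hq2 hq2
  have z₂ : g₂ = 0 := by
    refine eq_zero_of_mem_homog_of_mem_order h₂ ?_
    have := sub_mem (sub_mem (sub_mem hq3 (order_mono (by omega) o₅))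
      (order_mono (by omega) o₄)) o₃
    convert this using 1
    rw [hqdef]
    abel
  have hq4 := hstep 2 (by omega) hq2 hq3
  have z₃ : g₃ = 0 := by
    refine eq_zero_of_mem_homog_of_mem_order h₃ ?_
    have := sub_mem (sub_mem hq4 (order_mono (by omega) o₅)) o₄
    convert this using 1
    rw [hqdef, z₂]
    abel
  refine ⟨z₂, z₃, eq_zero_of_mem_homog_of_mem_order
    (add_mem hquart (vec_cube_sub_mem_homog h₄)) ?_⟩
  have hd₅ := homog_le_order (vec_cube_sub_mem_homog h₅)
  have := add_mem (add_mem hquint (hrest 3 hq4)) hd₅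
  rw [← neg_mem_iff] at this
  convert this using 1
  have hq45 : q = g₄ + g₅ := by rw [hqdef, z₂, z₃, zero_add, zero_add]
  rw [hq45] at key ⊢
  simp only [map_add] at key ⊢
  linear_combination (norm := abel) key

lemma term_zero {n : ℕ} (s : Fin n → ℕ) : term b (0 : Op K V n) s = 0 := by
  rw [term_eq_extOp, extOp_zero]

lemma modelRHS_eq : modelRHS b A F = truncatedRHS b A F
      + (5 : K) • term b (coeffC₁ (bil A) (tri F)) ![0, 0, 0, 2]
      + (5 : K) • term b (coeffC₂ (bil A) (tri F)) ![0, 1, 1, 0]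
      + (5 : K) • term b (coeffD₁ (bil A) (tri F)) ![0, 0, 0, 0, 1] := by
  rw [modelRHS, fifthRHS_eq, truncatedRHS, ← term_coeffB_eq, term_zero, fifthQuadratic, term_two,
    term_two, smul_zero]
  abel

end Truncation

/-! ### The compatibility identities from the quartic equation -/

section QuarticIdentities

set_option linter.unusedSimpArgs false

variable {K V : Type*} [Field K] [AddCommGroup V] [Module K V]

/-- The terms `5 c₁(U, U, U, U₂) + 5 c₂(U, U₁, U₁, U)` of a symmetry contribute this form to its
commutator with `U_t = U₃`. -/
def quarticCube (K : Type*) {V : Type*} [Field K] [AddCommGroup V] [Module K V]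
    (c₁ c₂ : V → V → V → V → V) (w₀ w₁ w₂ w₃ w₄ : V) : V :=
    -(15 : K) • c₁ w₀ w₀ w₁ w₄ - (15 : K) • c₁ w₀ w₀ w₂ w₃ - (15 : K) • c₁ w₀ w₁ w₀ w₄
      - (30 : K) • c₁ w₀ w₁ w₁ w₃ - (15 : K) • c₁ w₀ w₁ w₂ w₂ - (15 : K) • c₁ w₀ w₂ w₀ w₃
      - (15 : K) • c₁ w₀ w₂ w₁ w₂ - (15 : K) • c₁ w₁ w₀ w₀ w₄ - (30 : K) • c₁ w₁ w₀ w₁ w₃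
      - (15 : K) • c₁ w₁ w₀ w₂ w₂ - (30 : K) • c₁ w₁ w₁ w₀ w₃ - (30 : K) • c₁ w₁ w₁ w₁ w₂
      - (15 : K) • c₁ w₁ w₂ w₀ w₂ - (15 : K) • c₁ w₂ w₀ w₀ w₃ - (15 : K) • c₁ w₂ w₀ w₁ w₂
      - (15 : K) • c₁ w₂ w₁ w₀ w₂ - (15 : K) • c₂ w₀ w₁ w₂ w₂ - (15 : K) • c₂ w₀ w₁ w₃ w₁
      - (15 : K) • c₂ w₀ w₂ w₁ w₂ - (30 : K) • c₂ w₀ w₂ w₂ w₁ - (15 : K) • c₂ w₀ w₂ w₃ w₀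
      - (15 : K) • c₂ w₀ w₃ w₁ w₁ - (15 : K) • c₂ w₀ w₃ w₂ w₀ - (15 : K) • c₂ w₁ w₁ w₁ w₂
      - (30 : K) • c₂ w₁ w₁ w₂ w₁ - (15 : K) • c₂ w₁ w₁ w₃ w₀ - (30 : K) • c₂ w₁ w₂ w₁ w₁
      - (30 : K) • c₂ w₁ w₂ w₂ w₀ - (15 : K) • c₂ w₁ w₃ w₁ w₀ - (15 : K) • c₂ w₂ w₁ w₁ w₁
      - (15 : K) • c₂ w₂ w₁ w₂ w₀ - (15 : K) • c₂ w₂ w₂ w₁ w₀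

lemma sub_cube_eq_quarticCube {c₁ c₂ : V → V → V → V → V} {D δ : V →ₗ[K] V}
    (hD₁ : ∀ x y z t, D (c₁ x y z t) = c₁ (D x) y z t + c₁ x (D y) z t + c₁ x y (D z) t
      + c₁ x y z (D t))
    (hD₂ : ∀ x y z t, D (c₂ x y z t) = c₂ (D x) y z t + c₂ x (D y) z t + c₂ x y (D z) t
      + c₂ x y z (D t))
    (hδ₁ : ∀ x y z t, δ (c₁ x y z t) = c₁ (δ x) y z t + c₁ x (δ y) z t + c₁ x y (δ z) t
      + c₁ x y z (δ t))
    (hδ₂ : ∀ x y z t, δ (c₂ x y z t) = c₂ (δ x) y z t + c₂ x (δ y) z t + c₂ x y (δ z) t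
      + c₂ x y z (δ t))
    {w : ℕ → V} (hDw : ∀ k, D (w k) = w (k + 1)) (hδw : ∀ k, δ (w k) = w (k + 3)) :
    δ ((5 : K) • c₁ (w 0) (w 0) (w 0) (w 2) + (5 : K) • c₂ (w 0) (w 1) (w 1) (w 0))
      - D (D (D ((5 : K) • c₁ (w 0) (w 0) (w 0) (w 2) + (5 : K) • c₂ (w 0) (w 1) (w 1) (w 0))))
      = quarticCube K c₁ c₂ (w 0) (w 1) (w 2) (w 3) (w 4) := by
  simp only [hD₁, hD₂, hδ₁, hδ₂, hDw, hδw, map_add, map_smul, quarticCube, Nat.reduceAdd]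
  module

/-- The polarised part of degree two in `w₀` and of degree one in `w₁` and `w₄` of the quartic
equation. -/
def quarticPart₁₄ (K : Type*) {V : Type*} [Field K] [AddCommGroup V] [Module K V]
    (a : V → V → V) (f : V → V → V → V) (c₁ : V → V → V → V → V) (x x' y z : V) : V :=
    -(15 : K) • c₁ x' x y z - (15 : K) • c₁ x' y x z - (15 : K) • c₁ x x' y z
      - (15 : K) • c₁ x y x' z - (15 : K) • c₁ y x' x z - (15 : K) • c₁ y x x' z
      + (30 : K) • a x' (f x y z) + (30 : K) • a x' (f y x z) + (30 : K) • a x (f x' y z)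
      + (30 : K) • a x (f y x' z) + (30 : K) • a y (f x' x z) + (30 : K) • a y (f x x' z)
      - (30 : K) • a z (f x' x y) - (30 : K) • a z (f x x' y) + (30 : K) • f x' x (a y z)
      + (30 : K) • f x' y (a x z) + (30 : K) • f x x' (a y z) + (30 : K) • f x y (a x' z)
      + (30 : K) • f y x' (a x z) + (30 : K) • f y x (a x' z) + (30 : K) • a x' (a x (a y z))
      + (15 : K) • a x' (a y (a x z)) + (15 : K) • a x' (a z (a x y))
      + (30 : K) • a x (a x' (a y z)) + (15 : K) • a x (a y (a x' z))
      + (15 : K) • a x (a z (a x' y)) + (30 : K) • a y (a x' (a x z))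
      + (30 : K) • a y (a x (a x' z)) - (15 : K) • a z (a x' (a x y))
      - (15 : K) • a z (a x (a x' y)) + (15 : K) • a (a x' y) (a x z)
      + (15 : K) • a (a x y) (a x' z)

/-- The polarised part of degree two in `w₀` and of degree one in `w₂` and `w₃` of the quartic
equation. -/
def quarticPart₂₃ (K : Type*) {V : Type*} [Field K] [AddCommGroup V] [Module K V]
    (a : V → V → V) (f : V → V → V → V) (c₁ c₂ : V → V → V → V → V) (x x' y z : V) : V :=
    -(15 : K) • c₁ x' x y z - (15 : K) • c₁ x' y x z - (15 : K) • c₁ x x' y z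
      - (15 : K) • c₁ x y x' z - (15 : K) • c₁ y x' x z - (15 : K) • c₁ y x x' z
      - (15 : K) • c₂ x' y z x - (15 : K) • c₂ x' z y x - (15 : K) • c₂ x y z x'
      - (15 : K) • c₂ x z y x' + (60 : K) • a x' (f x y z) + (30 : K) • a x' (f x z y)
      + (90 : K) • a x' (f y x z) + (60 : K) • a x (f x' y z) + (30 : K) • a x (f x' z y)
      + (90 : K) • a x (f y x' z) + (30 : K) • a y (f x' x z) + (30 : K) • a y (f x x' z)
      - (30 : K) • a z (f x' x y) - (30 : K) • a z (f x x' y) + (30 : K) • f x' x (a y z)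
      + (30 : K) • f x' y (a x z) + (30 : K) • f x' (a x y) z + (30 : K) • f x' (a x z) y
      + (30 : K) • f x x' (a y z) + (30 : K) • f x y (a x' z) + (30 : K) • f x (a x' y) z
      + (30 : K) • f x (a x' z) y + (60 : K) • f y x' (a x z) + (60 : K) • f y x (a x' z)
      + (30 : K) • f z x' (a x y) + (30 : K) • f z x (a x' y) + (30 : K) • a x' (a x (a y z))
      + (15 : K) • a x' (a y (a x z)) + (15 : K) • a x' (a z (a x y))
      + (30 : K) • a x (a x' (a y z)) + (15 : K) • a x (a y (a x' z))
      + (15 : K) • a x (a z (a x' y)) + (30 : K) • a y (a x' (a x z))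
      + (30 : K) • a y (a x (a x' z)) - (15 : K) • a z (a x' (a x y))
      - (15 : K) • a z (a x (a x' y)) + (15 : K) • a (a x' y) (a x z)
      + (15 : K) • a (a x y) (a x' z)

/-- The polarised part of degree two in `w₁` and of degree one in `w₀` and `w₃` of the quartic
equation. -/
def quarticPart₁₁₃ (K : Type*) {V : Type*} [Field K] [AddCommGroup V] [Module K V]
    (a : V → V → V) (f : V → V → V → V) (c₁ c₂ : V → V → V → V → V) (x y y' z : V) : V :=
    -(30 : K) • c₁ y' x y z - (30 : K) • c₁ y' y x z - (30 : K) • c₁ x y' y z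
      - (30 : K) • c₁ x y y' z - (30 : K) • c₁ y y' x z - (30 : K) • c₁ y x y' z
      - (15 : K) • c₂ y' y z x - (15 : K) • c₂ y' z y x - (15 : K) • c₂ x y' z y
      - (15 : K) • c₂ x y z y' - (15 : K) • c₂ x z y' y - (15 : K) • c₂ x z y y'
      - (15 : K) • c₂ y y' z x - (15 : K) • c₂ y z y' x + (90 : K) • a y' (f x y z)
      + (30 : K) • a y' (f x z y) + (120 : K) • a y' (f y x z) + (180 : K) • a x (f y' y z)
      + (30 : K) • a x (f y' z y) + (180 : K) • a x (f y y' z) + (30 : K) • a x (f y z y')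
      + (120 : K) • a y (f y' x z) + (90 : K) • a y (f x y' z) + (30 : K) • a y (f x z y')
      - (30 : K) • a z (f y' x y) - (30 : K) • a z (f x y' y) - (30 : K) • a z (f x y y')
      - (30 : K) • a z (f y x y') + (90 : K) • f y' x (a y z) + (60 : K) • f y' y (a x z)
      + (30 : K) • f y' (a x z) y + (60 : K) • f x y' (a y z) + (60 : K) • f x y (a y' z)
      + (30 : K) • f x (a y' z) y + (30 : K) • f x (a y z) y' + (60 : K) • f y y' (a x z)
      + (90 : K) • f y x (a y' z) + (30 : K) • f y (a x z) y' + (60 : K) • a y' (a x (a y z))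
      + (45 : K) • a y' (a y (a x z)) + (15 : K) • a y' (a z (a x y))
      + (45 : K) • a x (a y' (a y z)) + (45 : K) • a x (a y (a y' z))
      + (45 : K) • a y (a y' (a x z)) + (60 : K) • a y (a x (a y' z))
      + (15 : K) • a y (a z (a x y')) - (15 : K) • a z (a y' (a x y))
      - (15 : K) • a z (a y (a x y')) + (15 : K) • a (a x y') (a y z)
      + (15 : K) • a (a x y) (a y' z)

section

variable {a : V → V → V} {f : V → V → V → V} {c₁ c₂ : V → V → V → V → V}
  (hk : ∀ x y, a x y = - a y x) (hs : ∀ x y z, f x y z = f z y x)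
  (ha₁ : ∀ x y, a (-x) y = - a x y)
  (ha₂ : ∀ x y, a x (-y) = - a x y)
  (hf₂ : ∀ x y z, f x (-y) z = - f x y z) (hf₃ : ∀ x y z, f x y (-z) = - f x y z)

include hk hs ha₁ ha₂ hf₃

include hf₂ in
/-- Left multiplications by the binary product are derivations of the triple product: in a
combination of permuted instances of two polarised parts, the unknown `c₁` and `c₂` cancel. -/
lemma der_of_quarticPart [CharZero K]
    (h₂₃ : ∀ x x' y z, quarticPart₂₃ K a f c₁ c₂ x x' y z = 0)
    (h₁₁₃ : ∀ x y y' z, quarticPart₁₁₃ K a f c₁ c₂ x y y' z = 0)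
    (x y z u : V) : a x (f y z u) = f (a x y) z u + f y (a x z) u + f y z (a x u) := by
  have s1 : a u y = - a y u := hk _ _
  have s2 : a u z = - a z u := hk _ _
  have s3 : a z y = - a y z := hk _ _
  have s4 : a (a y u) (a x z) = - a (a x z) (a y u) := hk _ _
  have s5 : a (a y z) (a x u) = - a (a x u) (a y z) := hk _ _
  have s6 : a (a z u) (a x y) = - a (a x y) (a z u) := hk _ _
  have s7 : f u x y = f y x u := hs _ _ _
  have s8 : f u x z = f z x u := hs _ _ _
  have s9 : f u y z = f z y u := hs _ _ _
  have s10 : f u z y = f y z u := hs _ _ _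
  have s11 : f u (a x y) z = f z (a x y) u := hs _ _ _
  have s12 : f u (a x z) y = f y (a x z) u := hs _ _ _
  have s13 : f z u y = f y u z := hs _ _ _
  have s14 : f z x y = f y x z := hs _ _ _
  have s15 : f z (a x u) y = f y (a x u) z := hs _ _ _
  have s16 : f (a x y) z u = f u z (a x y) := hs _ _ _
  have e1 := h₁₁₃ x y z u
  have e2 := h₂₃ x y u z
  have e3 := h₁₁₃ x z u y
  have e4 := h₂₃ x u z y
  have e5 := h₂₃ x z y u
  have e6 := h₂₃ x u y z
  have e7 := h₂₃ x y z u
  have e8 := h₁₁₃ x y u z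
  have e9 := h₂₃ x z u y
  simp only [quarticPart₁₁₃, quarticPart₂₃, s1, s2, s3, s4, s5, s6, s7, s8, s9, s10, s11, s12, s13,
    s14, s15, s16, ha₁, ha₂, hf₂, hf₃]
    at e1 e2 e3 e4 e5 e6 e7 e8 e9 ⊢
  linear_combination (norm := module) (1 / 60 : K) • e1 + (1 / 60 : K) • e2 + (1 / 60 : K) • e3
      - (1 / 60 : K) • e4 - (1 / 60 : K) • e5 + (1 / 60 : K) • e6 - (1 / 60 : K) • e7
      - (1 / 60 : K) • e8 - (1 / 60 : K) • e9

/-- The third compatibility identity, with the Jacobians written out. Only the part of the quartic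
equation containing the fourth derivative enters. -/
lemma third_of_quarticPart [CharZero K]
    (h₁₄ : ∀ x x' y z, quarticPart₁₄ K a f c₁ x x' y z = 0)
    (x y z u : V) : -(2 : K) • a z (f x u y) + (2 : K) • a z (f x y u) - a u (a y (a x z))
        - a u (a (a x y) z) + a x (a u (a y z)) + a x (a y (a z u))
        + (2 : K) • a x (a z (a u y)) - a y (a z (a x u))
        - a y (a (a x z) u) - a z (a u (a x y)) - a z (a x (a u y)) + a z (a (a u y) x)
        - a z (a (a x u) y) + a (a u y) (a x z) - a (a x u) (a y z) - a (a x y) (a z u)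
        - a (a x z) (a u y) = 0 := by
  have s1 : a u y = - a y u := hk _ _
  have s2 : a u z = - a z u := hk _ _
  have s3 : a (a x u) y = - a y (a x u) := hk _ _
  have s4 : a (a x y) z = - a z (a x y) := hk _ _
  have s5 : a (a x z) u = - a u (a x z) := hk _ _
  have s6 : a (a y u) x = - a x (a y u) := hk _ _
  have s7 : a (a y u) (a x z) = - a (a x z) (a y u) := hk _ _
  have s8 : f u x y = f y x u := hs _ _ _
  have s9 : f u x z = f z x u := hs _ _ _
  have s10 : f u y z = f z y u := hs _ _ _
  have e1 := h₁₄ x y u z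
  have e2 := h₁₄ x u y z
  simp only [quarticPart₁₄, s1, s2, s3, s4, s5, s6, s7, s8, s9, s10, ha₁, ha₂, hf₃]
    at e1 e2 ⊢
  linear_combination (norm := module) -(1 / 15 : K) • e1 + (1 / 15 : K) • e2

end

variable {a : V →ₗ[K] V →ₗ[K] V} {f : V →ₗ[K] V →ₗ[K] V →ₗ[K] V}
  {c₁ c₂ : V →ₗ[K] V →ₗ[K] V →ₗ[K] V →ₗ[K] V}
  (h : ∀ w₀ w₁ w₂ w₃ w₄, quarticForm a f w₀ w₁ w₂ w₃ w₄
    + quarticCube K (fun x y z t => c₁ x y z t) (fun x y z t => c₂ x y z t) w₀ w₁ w₂ w₃ w₄ = 0)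

include h

set_option maxHeartbeats 800000 in
lemma quarticPart₁₄_eq_zero (x x' y z : V) :
    quarticPart₁₄ K (fun x y => a x y) (fun x y z => f x y z) (fun x y z t => c₁ x y z t)
      x x' y z = 0 := by
  have e1 := h (x + x') y 0 0 z
  have e2 := h x y 0 0 z
  have e3 := h x' y 0 0 z
  simp only [quarticForm, quarticCube, map_zero, map_add, LinearMap.zero_apply,
    LinearMap.add_apply, smul_zero, add_zero, zero_add, sub_zero] at e1 e2 e3
  simp only [quarticPart₁₄]
  obtain ⟨a', ha'⟩ := exists_function_eq₂ a
  obtain ⟨f', hf'⟩ := exists_function_eq f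
  obtain ⟨d₁, hd₁⟩ : ∃ d : V → V → V → V → V, ∀ x y z t, c₁ x y z t = d x y z t :=
    ⟨_, fun _ _ _ _ => rfl⟩
  simp only [ha', hf', hd₁] at e1 e2 e3 ⊢
  linear_combination (norm := module) e1 - e2 - e3

set_option maxHeartbeats 800000 in
lemma quarticPart₂₃_eq_zero (x x' y z : V) :
    quarticPart₂₃ K (fun x y => a x y) (fun x y z => f x y z) (fun x y z t => c₁ x y z t)
      (fun x y z t => c₂ x y z t) x x' y z = 0 := by
  have e1 := h (x + x') 0 y z 0
  have e2 := h x 0 y z 0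
  have e3 := h x' 0 y z 0
  simp only [quarticForm, quarticCube, map_zero, map_add, LinearMap.zero_apply,
    LinearMap.add_apply, smul_zero, add_zero, zero_add, sub_zero] at e1 e2 e3
  simp only [quarticPart₂₃]
  obtain ⟨a', ha'⟩ := exists_function_eq₂ a
  obtain ⟨f', hf'⟩ := exists_function_eq f
  obtain ⟨d₁, hd₁⟩ : ∃ d : V → V → V → V → V, ∀ x y z t, c₁ x y z t = d x y z t :=
    ⟨_, fun _ _ _ _ => rfl⟩
  obtain ⟨d₂, hd₂⟩ : ∃ d : V → V → V → V → V, ∀ x y z t, c₂ x y z t = d x y z t :=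
    ⟨_, fun _ _ _ _ => rfl⟩
  simp only [ha', hf', hd₁, hd₂] at e1 e2 e3 ⊢
  linear_combination (norm := module) e1 - e2 - e3

set_option maxHeartbeats 800000 in
lemma quarticPart₁₁₃_eq_zero (x y y' z : V) :
    quarticPart₁₁₃ K (fun x y => a x y) (fun x y z => f x y z) (fun x y z t => c₁ x y z t)
      (fun x y z t => c₂ x y z t) x y y' z = 0 := by
  have e1 := h x (y + y') 0 z 0
  have e2 := h x y 0 z 0
  have e3 := h x y' 0 z 0
  simp only [quarticForm, quarticCube, map_zero, map_add, LinearMap.zero_apply,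
    LinearMap.add_apply, smul_zero, add_zero, zero_add, sub_zero] at e1 e2 e3
  simp only [quarticPart₁₁₃]
  obtain ⟨a', ha'⟩ := exists_function_eq₂ a
  obtain ⟨f', hf'⟩ := exists_function_eq f
  obtain ⟨d₁, hd₁⟩ : ∃ d : V → V → V → V → V, ∀ x y z t, c₁ x y z t = d x y z t :=
    ⟨_, fun _ _ _ _ => rfl⟩
  obtain ⟨d₂, hd₂⟩ : ∃ d : V → V → V → V → V, ∀ x y z t, c₂ x y z t = d x y z t :=
    ⟨_, fun _ _ _ _ => rfl⟩
  simp only [ha', hf', hd₁, hd₂] at e1 e2 e3 ⊢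
  linear_combination (norm := module) e1 - e2 - e3

/-- The degree-four part of the symmetry equation implies the identities of compatibility. -/
lemma compatible_of_quartic [CharZero K] (hk : ∀ x y, a x y = - a y x)
    (hs : ∀ x y z, f x y z = f z y x) : Compatible a f where
  skew := hk
  symm := hs
  der := der_of_quarticPart (K := K) (a := fun x y => a x y) (f := fun x y z => f x y z) hk hs
    (fun _ _ => by simp only [map_neg, LinearMap.neg_apply]) (fun _ _ => by simp only [map_neg])
    (fun _ _ _ => by simp only [map_neg, LinearMap.neg_apply])
    (fun _ _ _ => by simp only [map_neg]) (quarticPart₂₃_eq_zero h) (quarticPart₁₁₃_eq_zero h)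
  third x y z u := by
    have e := third_of_quarticPart (K := K) (a := fun x y => a x y) (f := fun x y z => f x y z)
      hk hs (fun _ _ => by simp only [map_neg, LinearMap.neg_apply])
      (fun _ _ => by simp only [map_neg])
      (fun _ _ _ => by simp only [map_neg]) (quarticPart₁₄_eq_zero h) x y z u
    simp only [jacobian, map_sub, map_add, map_smul, LinearMap.add_apply]
    linear_combination (norm := module) e

end QuarticIdentities

/-! ### The triple product determined by the system -/

section TripleProduct

variable {K V : Type*} [Field K] [CharZero K] [AddCommGroup V] [Module K V]

/-- The triple product `F` determined by the operations `A` and `B` of the system: if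
`S(x, z; y) = B(x, y, z) - z(xy)/2 - x(zy)/2`, then
`2 F(x, y, z) = S(x, y; z) + S(y, z; x) - S(x, z; y)`. -/
def tripleOp (A : Op K V 2) (B : Op K V 3) : Op K V 3 :=
  MultilinearMap.mk' (fun v =>
      (1 / 2 : K) • (tri B (v 0) (v 2) (v 1) - (1 / 2 : K) • bil A (v 1) (bil A (v 0) (v 2))
          - (1 / 2 : K) • bil A (v 0) (bil A (v 1) (v 2)))
        + (1 / 2 : K) • (tri B (v 1) (v 0) (v 2) - (1 / 2 : K) • bil A (v 2) (bil A (v 1) (v 0))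
          - (1 / 2 : K) • bil A (v 1) (bil A (v 2) (v 0)))
        - (1 / 2 : K) • (tri B (v 0) (v 1) (v 2) - (1 / 2 : K) • bil A (v 2) (bil A (v 0) (v 1))
          - (1 / 2 : K) • bil A (v 0) (bil A (v 2) (v 1))))
    (fun m i x y => by fin_cases i <;> simp [-bil_apply, -tri_apply] <;> module)
    (fun m i c x => by fin_cases i <;> simp [-bil_apply, -tri_apply] <;> module)

variable {A : Op K V 2} {B : Op K V 3}

lemma tri_tripleOp (x y z : V) : tri (tripleOp A B) x y z =
      (1 / 2 : K) • (tri B x z y - (1 / 2 : K) • bil A y (bil A x z)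
          - (1 / 2 : K) • bil A x (bil A y z))
        + (1 / 2 : K) • (tri B y x z - (1 / 2 : K) • bil A z (bil A y x)
          - (1 / 2 : K) • bil A y (bil A z x))
        - (1 / 2 : K) • (tri B x y z - (1 / 2 : K) • bil A z (bil A x y)
          - (1 / 2 : K) • bil A x (bil A z y)) := rfl

lemma tripleOp_symm (hB : ∀ x y z, tri B x y z = tri B z y x) (x y z : V) :
    tri (tripleOp A B) x y z = tri (tripleOp A B) z y x := by
  rw [tri_tripleOp, tri_tripleOp, hB x z y, hB y x z, hB x y z]
  module

lemma isModel_tripleOp (hB : ∀ x y z, tri B x y z = tri B z y x) :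
    IsModel A B (tripleOp A B) := fun x y z => by
  have e : tri B x y z = tri (tripleOp A B) x z y + tri (tripleOp A B) z x y
      + (1 / 2 : K) • bil A z (bil A x y) + (1 / 2 : K) • bil A x (bil A z y) := by
    rw [tri_tripleOp, tri_tripleOp, hB z y x, hB x z y, hB z x y]
    module
  exact e

end TripleProduct

/-! ### A symmetric system comes from a compatible Jordan triple system -/

section Necessity

variable {K V ι : Type*} [Field K] [CharZero K] [AddCommGroup V] [Module K V] [Fintype ι]
  (b : Module.Basis ι K V) {A : Op K V 2} {B F : Op K V 3}

/-- A system with a fifth-order symmetry comes from a compatible Jordan triple system. -/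
theorem compatible_and_jordanTriple_of_isSymmetry (hA : ∀ x y, bil A x y = - bil A y x)
    (hF : ∀ x y z, tri F x y z = tri F z y x) (hB : IsModel A B F) {A₂ A₃ A₄ : Op K V 2}
    {B₂ B₃ B₄ : Op K V 3} {C₁ C₂ : Op K V 4} {D₁ : Op K V 5}
    (hS : IsSymmetry (mkdvRHS b A B) (fifthRHS b A₂ A₃ A₄ B₂ B₃ B₄ C₁ C₂ D₁)) :
    Compatible (bil A) (tri F) ∧ JordanTriple (tri F) := by
  have hterm : ∀ {n : ℕ} (T : Op K V n) (s : Fin n → ℕ), (5 : K) • term b T s ∈ homog K ι n :=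
    fun T s => Submodule.smul_mem _ _ (term_mem_homog b T s)
  have hC := add_mem (hterm C₁ ![0, 0, 0, 2]) (hterm C₂ ![0, 1, 1, 0])
  obtain ⟨z₂, z₃, e₄⟩ := deviation_of_isSymmetry b hA hF hB hS
    (sub_mem (add_mem (add_mem (hterm A₂ ![0, 4]) (hterm A₃ ![1, 3])) (hterm A₄ ![2, 2]))
      (fifthQuadratic_mem_homog b A))
    (sub_mem (add_mem (add_mem (hterm B₂ ![0, 0, 3]) (hterm B₃ ![0, 1, 2]))
      (hterm B₄ ![1, 1, 1])) (fifthTernary_mem_homog b A F)) hC (hterm D₁ ![0, 0, 0, 0, 1])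
    (by rw [fifthRHS_eq, truncatedRHS]; abel)
  have hcomp : Compatible (bil A) (tri F) := by
    refine compatible_of_quartic (c₁ := quad C₁) (c₂ := quad C₂) (fun w₀ w₁ w₂ w₃ w₄ => ?_) hA hF
    rw [term_four, term_four, ← quad_apply, ← quad_apply,
      sub_cube_eq_quarticCube (c₁ := fun x y z t => quad (extOp b C₁) x y z t)
      (c₂ := fun x y z t => quad (extOp b C₂) x y z t) (fun _ _ _ _ => vec_quad b _ _ _ _ _ _)
      (fun _ _ _ _ => vec_quad b _ _ _ _ _ _) (fun _ _ _ _ => vec_quad b _ _ _ _ _ _)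
      (fun _ _ _ _ => vec_quad b _ _ _ _ _ _) vec_totalD_jet vec_evolField_jet_three] at e₄
    obtain ⟨p, hp⟩ := exists_evalAt_jet b
      fun k => match k with | 0 => w₀ | 1 => w₁ | 2 => w₂ | 3 => w₃ | _ => w₄
    have := congrArg (evalAt b p) e₄
    simpa only [quarticForm, quarticCube, map_add, map_sub, map_neg, map_smul, map_zero, evalAt_bil,
      evalAt_tri, evalAt_quad, hp] using this
  refine ⟨hcomp, jordanTriple_of_isSymmetry b hcomp hB (fifthRHS_mem_order b _ _ _ _ _ _ _ _ _) hS
    (q := (5 : K) • term b C₁ ![0, 0, 0, 2] + (5 : K) • term b C₂ ![0, 1, 1, 0]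
      - ((5 : K) • term b (coeffC₁ (bil A) (tri F)) ![0, 0, 0, 2]
        + (5 : K) • term b (coeffC₂ (bil A) (tri F)) ![0, 1, 1, 0]))
    (sub_mem hC (add_mem (hterm _ _) (hterm _ _)))
    ((5 : K) • (D₁ + (-1 : K) • coeffD₁ (bil A) (tri F))) ?_⟩
  have e : term b ((5 : K) • (D₁ + (-1 : K) • coeffD₁ (bil A) (tri F))) ![0, 0, 0, 0, 1]
      = (5 : K) • term b D₁ ![0, 0, 0, 0, 1]
        - (5 : K) • term b (coeffD₁ (bil A) (tri F)) ![0, 0, 0, 0, 1] := by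
    simp only [term_eq_extOp, extOp_smul, extOp_add]
    module
  rw [e, modelRHS_eq, truncatedRHS, fifthRHS_eq]
  linear_combination (norm := abel) z₂ + z₃

end Necessity

end MKdV

theorem theorem3 {K V ι : Type*} [Field K] [CharZero K] [AddCommGroup V] [Module K V]
    [Fintype ι] (b : Module.Basis ι K V) (A : MKdV.Op K V 2) (B : MKdV.Op K V 3)
    (hA : ∀ x y : V, A ![x, y] = - A ![y, x])
    (hB : ∀ x y z : V, B ![x, y, z] = B ![z, y, x]) :
    (∃ (A₂ A₃ A₄ : MKdV.Op K V 2) (B₂ B₃ B₄ : MKdV.Op K V 3) (C₁ C₂ : MKdV.Op K V 4)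
        (D₁ : MKdV.Op K V 5),
        MKdV.IsSymmetry (MKdV.mkdvRHS b A B)
          (MKdV.fifthRHS b A₂ A₃ A₄ B₂ B₃ B₄ C₁ C₂ D₁)) ↔
      ∃ F : MKdV.Op K V 3, MKdV.IsJordanTriple F ∧
        (∀ x y z : V, B ![x, y, z] = F ![x, z, y] + F ![z, x, y]
          + (1 / 2 : K) • A ![z, A ![x, y]] + (1 / 2 : K) • A ![x, A ![z, y]]) ∧
        (∀ x y z u : V, A ![x, F ![y, z, u]] =
          F ![A ![x, y], z, u] + F ![y, A ![x, z], u] + F ![y, z, A ![x, u]]) ∧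
        (∀ x y z u : V,
          A ![z, (2 : K) • F ![x, y, u] - (2 : K) • F ![x, u, y] - A ![x, A ![u, y]]]
            + MKdV.jac A (A ![u, y]) x z + A ![x, MKdV.jac A y z u]
            - MKdV.jac A (A ![x, y]) z u - MKdV.jac A y (A ![x, z]) u
            - MKdV.jac A y z (A ![x, u]) = 0) := by
  constructor
  · rintro ⟨A₂, A₃, A₄, B₂, B₃, B₄, C₁, C₂, D₁, hS⟩
    have hM := MKdV.isModel_tripleOp (A := A) (B := B) hB
    obtain ⟨hc, hJ⟩ := MKdV.compatible_and_jordanTriple_of_isSymmetry b hA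
      (MKdV.tripleOp_symm hB) hM hS
    exact ⟨MKdV.tripleOp A B, ⟨hJ.symm, hJ.jordan⟩, hM, hc.der, hc.third⟩
  · rintro ⟨F, hJ, hM, hder, hthird⟩
    exact ⟨_, _, _, _, _, _, _, _, _, MKdV.isSymmetry_of_jordanTriple b
      ⟨hA, hJ.symm, hder, hthird⟩ ⟨hJ.symm, hJ.jordan⟩ hM⟩
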